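/- **Setting.** Let $d\ge 0$ and $m\ge3$ be integers and $h_0,c_0,\tau_0>0$, $\delta\in(0,1]$, $K\ge1$ real numbers. Let $\Lambda_1\subset\mathbb R^d\setminus\{0\}$ be finite, let $\tau_\lambda\ge0$ ($\lambda\in\Lambda_1$) be numbers, and let $q_\lambda\ge0$, $p_\lambda$ ($\lambda\in\Lambda_1$), $c$, $f$ be real functions on $\mathbb R^d$. Put $|\Lambda_1|^2=\sum_{\lambda\in\Lambda_1}|\lambda|^2$, $\|\Lambda_1\|^2=\sum_{\lambda\in\Lambda_1}|\tau_\lambda\lambda|^2$, and for $h\in(0,h_0]$ $$\delta_{h,\lambda}\varphi(x)=\tfrac{\varphi(x+h\lambda)-\varphi(x)}h,\qquad L_h\varphi=\tfrac1h\sum_{\lambda\in\Lambda_1}q_\lambda\delta_{h,\lambda}\varphi+\sum_{\lambda\in\Lambda_1}p_\lambda\delta_{h,\lambda}\varphi-c\varphi,$$ $$\mathcal L=\tfrac12\sum_{\lambda\in\Lambda_1}\sum_{i,j=1}^dq_\lambda\lambda_i\lambda_jD_iD_j+\sum_{\lambda\in\Lambda_1}\sum_{i=1}^dp_\lambda\lambda_iD_i-c,\qquad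 \chi_{h,\lambda}=q_\lambda+hp_\lambda.$$ For an integer $n\ge0$, $\mathfrak B^n$ is the set of bounded continuous functions $\psi$ on $\mathbb R^d$ whose generalized derivatives $D^\alpha\psi$, $|\alpha|\le n$, are bounded functions; $\|\psi\|_n^2=\sup\sum_{|\alpha|\le n}|D^\alpha\psi|^2$ (essential supremum) and $|D^k\psi|^2=\sum_{|\alpha|=k}|D^\alpha\psi|^2$. A solution of $\mathcal Lv+f=0$ is a $v\in\mathfrak B^2$ satisfying the equation almost everywhere. Let $\Lambda=\Lambda_1\cup\Lambda_2$ (disjoint union), where $\Lambda_2=\{\ell^1,\dots,\ell^d\}$ consists of $d$ distinct labels. For $\lambda\in\Lambda_1$ put $T_{h,\lambda}\varphi(x)=\varphi(x+h\lambda)$ and $\bar\delta_{h,\lambda}=\tau_\lambda\delta_{h,\lambda}$; put $T_{h,\ell^i}\varphi=\varphi$ and $\bar\delta_{h,\ell^i}=\tau_0D_i$. For $\lambda=(\lambda^1,\lambda^2)\in\Lambda^2$ put $T_{h,\lambda}=T_{h,\lambda^1}T_{h,\lambda^2}$, $\bar\delta_{h,\lambda}=\bar\delta_{h,\lambda^1}\bar\delta_{h,\lambda^2}$.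 For $\mu\in\Lambda\cup\Lambda^2$ let $$Q_{h,\mu}\varphi=\tfrac1h\sum_{\lambda\in\Lambda_1}(\bar\delta_{h,\mu}q_\lambda)\delta_{h,\lambda}\varphi,\qquad L^0_{h,\mu}\varphi=Q_{h,\mu}\varphi+\sum_{\lambda\in\Lambda_1}(\bar\delta_{h,\mu}p_\lambda)\delta_{h,\lambda}\varphi,$$ $$A_h(\varphi)=2\sum_{\lambda\in\Lambda}(\bar\delta_{h,\lambda}\varphi)L^0_{h,\lambda}T_{h,\lambda}\varphi,\qquad \mathcal Q_h(\varphi)=\sum_{\lambda\in\Lambda_1}\chi_{h,\lambda}(\delta_{h,\lambda}\varphi)^2.$$ Let $\mathfrak K$ be the set of bounded linear operators $\mathcal K$ on the space of bounded Borel functions on $\mathbb R^d$ that map nonnegative functions to nonnegative functions and satisfy $\mathcal K1\le1$. **Assumptions.** 1. $p_\lambda,q_\lambda,c,f\in\mathfrak B^m$ for $\lambda\in\Lambda_1$, and for $k=0,\dots,m$, with constants $M_k$, $\sup\big(\sum_{\lambda\in\Lambda_1}(|D^kq_\lambda|^2+|D^kp_\lambda|^2)+|D^kc|^2\big)\le M_k^2$.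 2. $\chi_{h,\lambda}\ge0$ on $\mathbb R^d$ for all $h\in(0,h_0]$, $\lambda\in\Lambda_1$. 3. $\sum_{\lambda\in\Lambda_1}\lambda q_\lambda(x)=0$ for all $x$. 4. $c\ge c_0$. 5. For every $h\in(0,h_0]$ there is $\mathcal K_h\in\mathfrak K$ such that, for all smooth $\varphi$ bounded together with all their derivatives, on $\mathbb R^d$ $$mA_h(\varphi)\le(1-\delta)\sum_{\lambda\in\Lambda}\mathcal Q_h(\bar\delta_{h,\lambda}\varphi)+K\mathcal Q_h(\varphi)+2(1-\delta)c\,\mathcal K_h\Big(\sum_{\lambda\in\Lambda}|\bar\delta_{h,\lambda}\varphi|^2\Big).$$ 6. For every $h\in(0,h_0]$ and $n=1,\dots,m$ there is $\mathcal K_h\in\mathfrak K$ such that, for all such $\varphi$, on $\mathbb R^d$ $$n\sum_{\nu\in\Lambda}A_h(\bar\delta_{h,\nu}\varphi)+n(n-1)\sum_{\lambda\in\Lambda^2}(\bar\delta_{h,\lambda}\varphi)Q_{h,\lambda}T_{h,\lambda}\varphi\le(1-\delta)\sum_{\lambda\in\Lambda^2}\mathcal Q_h(\bar\delta_{h,\lambda}\varphi)+K\sum_{\lambda\in\Lambda}\mathcal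 Q_h(\bar\delta_{h,\lambda}\varphi)$$ $$\qquad+2(1-\delta)c\,\mathcal K_h\Big(\sum_{\lambda\in\Lambda^2}|\bar\delta_{h,\lambda}\varphi|^2\Big)+K\mathcal K_h\Big(\sum_{\lambda\in\Lambda}|\bar\delta_{h,\lambda}\varphi|^2\Big).$$ Condition (S): $\Lambda_1=-\Lambda_1$ and $q_\lambda=q_{-\lambda}$ for all $\lambda\in\Lambda_1$. **Theorem.** Under Assumptions 1–6, let $k\ge0$ be an integer such that one of the following holds: (i) $m\ge3k+3$; (ii) $m\ge2k+3$ and (S) holds; (iii) $k$ is odd, $m\ge2k+2$, (S) holds, and $p_{-\lambda}=-p_\lambda$ for all $\lambda\in\Lambda_1$. Then for every $h\in(0,h_0]$ the equation $L_hv_h+f=0$ on $\mathbb R^d$ has a unique bounded solution $v_h$, and there are functions $v^{(0)},\dots,v^{(k)}$ on $\mathbb R^d$ (independent of $h$) and $R_h$, $h\in(0,h_0]$, on $\mathbb R^d$ such that $v^{(0)}$ is the unique solution in $\mathfrak B^m$ of $\mathcal Lv+f=0$ and $$v_h(x)=v^{(0)}(x)+\sum_{1\le j\le k}\frac{h^j}{j!}v^{(j)}(x)+h^{k+1}R_h(x)\quad\text{for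 all }x\in\mathbb R^d,\ h\in(0,h_0],$$ $$\sup_{h\in(0,h_0]}\sup_{\mathbb R^d}|R_h|\le N\|f\|_m,$$ where $N$ depends only on $d,m,\delta,c_0,\tau_0,K,|\Lambda_1|,\|\Lambda_1\|,M_0,\dots,M_m$. Moreover, when (iii) holds, $v^{(j)}=0$ for all odd $j\le k$. -/

import Mathlib

open MeasureTheory Set
open scoped ContDiff

namespace EllipticFD

noncomputable section

/-- The Euclidean space `ℝ^d`. -/
abbrev E (d : ℕ) : Type := EuclideanSpace ℝ (Fin d)

/-! ### Derivatives, generalized derivatives and the spaces `𝔅^m` -/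

/-- The classical partial derivative `D_i φ`. -/
def partialD {d : ℕ} (i : Fin d) (φ : E d → ℝ) : E d → ℝ :=
  fun x => fderiv ℝ φ x (EuclideanSpace.single i 1)

/-- `D^α φ = D_1^{α_1} ⋯ D_d^{α_d} φ` (classical), used for smooth `φ`. -/
def multiD {d : ℕ} (α : Fin d → ℕ) (φ : E d → ℝ) : E d → ℝ :=
  (List.finRange d).foldr (fun i g => (partialD i)^[α i] g) φ

/-- The generalized function `D^α u` is the function `g`. -/
def IsWeakDeriv {d : ℕ} (α : Fin d → ℕ) (u g : E d → ℝ) : Prop :=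
  ∀ φ : E d → ℝ, ContDiff ℝ ∞ φ → HasCompactSupport φ →
    ∫ x, u x * multiD α φ x = (-1 : ℝ) ^ (∑ i, α i) * ∫ x, g x * φ x

/-- `g` is a bounded Borel function representing the generalized function `D^α u`. -/
def IsBddWeakDeriv {d : ℕ} (α : Fin d → ℕ) (u g : E d → ℝ) : Prop :=
  Measurable g ∧ (∃ C : ℝ, ∀ x, |g x| ≤ C) ∧ IsWeakDeriv α u g

open scoped Classical in
/-- A bounded Borel version of the generalized derivative `D^α u`; it is determined up to a set
of Lebesgue measure zero, and is only used inside almost everywhere statements and essential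
suprema. The value `0` is used when `D^α u` is not a bounded function. -/
def weakD {d : ℕ} (α : Fin d → ℕ) (u : E d → ℝ) : E d → ℝ :=
  if h : ∃ g, IsBddWeakDeriv α u g then h.choose else 0

/-- `u ∈ 𝔅^m` (functions independent of `t`): `u` is bounded and continuous, and the generalized
derivatives `D^α u`, `|α| ≤ m`, are bounded functions. -/
def MemB {d : ℕ} (m : ℕ) (u : E d → ℝ) : Prop :=
  Continuous u ∧ (∃ C : ℝ, ∀ x, |u x| ≤ C) ∧
    ∀ α : Fin d → ℕ, ∑ i, α i ≤ m → ∃ g, IsBddWeakDeriv α u g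

/-- `|D^k u|² = ∑_{|α| = k} |D^α u|²`. -/
def sqD {d : ℕ} (k : ℕ) (u : E d → ℝ) : E d → ℝ :=
  fun x => ∑ α ∈ Finset.piAntidiag (Finset.univ : Finset (Fin d)) k, (weakD α u x) ^ 2

/-- `‖u‖_m = (sup ∑_{|α| ≤ m} |D^α u|²)^{1/2}` for `u ∈ 𝔅^m`; since the top derivatives are
only defined almost everywhere, the supremum is the essential one. -/
def normB {d : ℕ} (m : ℕ) (u : E d → ℝ) : ℝ :=
  Real.sqrt (essSup (fun x => ∑ k ∈ Finset.range (m + 1), sqD k u x) volume)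

/-- Smooth functions which are bounded together with all their derivatives. -/
def SmoothBdd {d : ℕ} (φ : E d → ℝ) : Prop :=
  ContDiff ℝ ∞ φ ∧ ∀ n : ℕ, ∃ C : ℝ, ∀ x, ‖iteratedFDeriv ℝ n φ x‖ ≤ C

/-! ### The scheme and the limit operator -/

/-- The data of a (time independent) finite difference scheme on `ℝ^d`: the finite set `Λ₁ ∌ 0`,
the coefficients `q_λ ≥ 0`, `p_λ`, `λ ∈ Λ₁`, and `c`, and the weights `τ_λ ≥ 0`, `λ ∈ Λ₁`.
Values of `q`, `p`, `τ` at indices outside `Λ₁` play no role. -/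
structure Scheme (d : ℕ) where
  Λ₁ : Finset (E d)
  zero_notMem : (0 : E d) ∉ Λ₁
  q : E d → E d → ℝ
  p : E d → E d → ℝ
  c : E d → ℝ
  τ : E d → ℝ
  q_nonneg : ∀ l ∈ Λ₁, ∀ x, 0 ≤ q l x
  τ_nonneg : ∀ l ∈ Λ₁, 0 ≤ τ l

/-- `δ_{h,l} φ (x) = (φ(x + h l) - φ(x)) / h`. -/
def fdiff {d : ℕ} (h : ℝ) (l : E d) (φ : E d → ℝ) : E d → ℝ :=
  fun x => h⁻¹ * (φ (x + h • l) - φ x)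

namespace Scheme

variable {d : ℕ} (S : Scheme d)

/-- `|Λ₁| = (∑ |λ|²)^{1/2}`. -/
def size : ℝ := Real.sqrt (∑ l ∈ S.Λ₁, ‖l‖ ^ 2)

/-- `‖Λ₁‖ = (∑ |τ_λ λ|²)^{1/2}`. -/
def wsize : ℝ := Real.sqrt (∑ l ∈ S.Λ₁, ‖S.τ l • l‖ ^ 2)

/-- `χ_{h,λ} = q_λ + h p_λ`. -/
def χ (h : ℝ) (l : E d) : E d → ℝ := fun x => S.q l x + h * S.p l x

/-- `L_h φ = h⁻¹ ∑ q_λ δ_{h,λ} φ + ∑ p_λ δ_{h,λ} φ - c φ`. -/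
def L (h : ℝ) (φ : E d → ℝ) : E d → ℝ := fun x =>
  h⁻¹ * ∑ l ∈ S.Λ₁, S.q l x * fdiff h l φ x + ∑ l ∈ S.Λ₁, S.p l x * fdiff h l φ x - S.c x * φ x

/-- `w` is a bounded solution of the finite difference equation `L_h w + f = 0` on `ℝ^d`. -/
def IsDiscreteSol (h : ℝ) (f w : E d → ℝ) : Prop :=
  (∃ C : ℝ, ∀ x, |w x| ≤ C) ∧ ∀ x, S.L h w x + f x = 0

/-- `𝓛 v = ½ ∑_λ ∑_{i,j} q_λ λ_i λ_j D_i D_j v + ∑_λ ∑_i p_λ λ_i D_i v - c v`, with generalized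
derivatives of `v`. -/
def limitOp (v : E d → ℝ) : E d → ℝ := fun x =>
  (1 / 2 : ℝ) * ∑ l ∈ S.Λ₁, ∑ i, ∑ j,
      S.q l x * l i * l j * weakD (Pi.single i 1 + Pi.single j 1) v x
    + ∑ l ∈ S.Λ₁, ∑ i, S.p l x * l i * weakD (Pi.single i 1) v x
    - S.c x * v x

/-- `v` is a solution of `𝓛 v + f = 0`: it belongs to `𝔅²` and the equation holds almost
everywhere. -/
def IsLimitSol (f v : E d → ℝ) : Prop :=
  MemB 2 v ∧ ∀ᵐ x, S.limitOp v x + f x = 0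

/-! ### The operators entering the structural assumptions

The index set `Λ = Λ₁ ∪ Λ₂`, where `Λ₂` consists of `d` labels, one for each coordinate direction,
is realized as a disjoint union. Classical derivatives are used in `bar`: it is applied at most
twice, to coefficients of class `𝔅^m` with `m ≥ 3` (these are of class `C²`) and to smooth
functions. -/

/-- The index set `Λ = Λ₁ ∪ Λ₂`. -/
def idx : Finset (E d ⊕ Fin d) := S.Λ₁.disjSum Finset.univ

/-- `T_{h,λ} φ (x) = φ(x + h λ)` for `λ ∈ Λ₁`, and the identity for the labels in `Λ₂`. -/
def T (h : ℝ) : E d ⊕ Fin d → (E d → ℝ) → E d → ℝ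
  | .inl l, φ => fun x => φ (x + h • l)
  | .inr _, φ => φ

/-- `δ̄_{h,λ} = τ_λ h⁻¹ (T_{h,λ} - 1)` for `λ ∈ Λ₁`, and `τ₀ D_i` for the `i`-th label in `Λ₂`. -/
def bar (τ₀ h : ℝ) : E d ⊕ Fin d → (E d → ℝ) → E d → ℝ
  | .inl l, φ => fun x => S.τ l * fdiff h l φ x
  | .inr i, φ => fun x => τ₀ * partialD i φ x

/-- `Q_{h,μ} φ = h⁻¹ ∑_{λ ∈ Λ₁} (δ̄_{h,μ} q_λ) δ_{h,λ} φ`, where `B` is the operator `δ̄_{h,μ}`,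
`μ ∈ Λ` or `μ ∈ Λ²`. -/
def Qμ (h : ℝ) (B : (E d → ℝ) → E d → ℝ) (φ : E d → ℝ) : E d → ℝ := fun x =>
  h⁻¹ * ∑ l ∈ S.Λ₁, B (S.q l) x * fdiff h l φ x

/-- `L⁰_{h,μ} φ = Q_{h,μ} φ + ∑_{λ ∈ Λ₁} (δ̄_{h,μ} p_λ) δ_{h,λ} φ`, where `B` is `δ̄_{h,μ}`. -/
def L₀μ (h : ℝ) (B : (E d → ℝ) → E d → ℝ) (φ : E d → ℝ) : E d → ℝ := fun x =>
  S.Qμ h B φ x + ∑ l ∈ S.Λ₁, B (S.p l) x * fdiff h l φ x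

/-- `A_h(φ) = 2 ∑_{λ ∈ Λ} (δ̄_{h,λ} φ) L⁰_{h,λ} T_{h,λ} φ`. -/
def A (τ₀ h : ℝ) (φ : E d → ℝ) : E d → ℝ := fun x =>
  2 * ∑ μ ∈ S.idx, S.bar τ₀ h μ φ x * S.L₀μ h (S.bar τ₀ h μ) (T h μ φ) x

/-- `𝒬_h(φ) = ∑_{λ ∈ Λ₁} χ_{h,λ} (δ_{h,λ} φ)²`. -/
def 𝒬 (h : ℝ) (φ : E d → ℝ) : E d → ℝ := fun x =>
  ∑ l ∈ S.Λ₁, S.χ h l x * (fdiff h l φ x) ^ 2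

/-- `∑_{λ ∈ Λ} |δ̄_{h,λ} φ|²`. -/
def sqBar (τ₀ h : ℝ) (φ : E d → ℝ) : E d → ℝ := fun x =>
  ∑ μ ∈ S.idx, (S.bar τ₀ h μ φ x) ^ 2

/-- `∑_{λ ∈ Λ²} |δ̄_{h,λ} φ|²`. -/
def sqBar₂ (τ₀ h : ℝ) (φ : E d → ℝ) : E d → ℝ := fun x =>
  ∑ μ ∈ S.idx, ∑ ν ∈ S.idx, (S.bar τ₀ h μ (S.bar τ₀ h ν φ) x) ^ 2

end Scheme

/-- Bounded Borel functions on `ℝ^d`. -/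
def BddBorel {d : ℕ} (φ : E d → ℝ) : Prop := Measurable φ ∧ ∃ C : ℝ, ∀ x, |φ x| ≤ C

/-- The class `𝔎` of bounded linear operators on the space `B(ℝ^d)` of bounded Borel functions
which preserve the cone of nonnegative functions and satisfy `𝒦 1 ≤ 1`. An operator is represented
by a map on all functions, whose values outside `B(ℝ^d)` are irrelevant. Boundedness (with norm at
most one) is automatic from positivity and `𝒦 1 ≤ 1`. -/
structure Mem𝔎 {d : ℕ} (𝒦 : (E d → ℝ) → E d → ℝ) : Prop where
  bddBorel : ∀ φ, BddBorel φ → BddBorel (𝒦 φ)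
  add : ∀ φ ψ, BddBorel φ → BddBorel ψ → 𝒦 (φ + ψ) = 𝒦 φ + 𝒦 ψ
  smul : ∀ (a : ℝ) φ, BddBorel φ → 𝒦 (a • φ) = a • 𝒦 φ
  nonneg : ∀ φ, BddBorel φ → (∀ x, 0 ≤ φ x) → ∀ x, 0 ≤ 𝒦 φ x
  one_le : ∀ x, 𝒦 (fun _ => 1) x ≤ 1

/-! ### The assumptions -/

namespace Scheme

variable {d : ℕ} (S : Scheme d)

/-- Regularity of the data: `p_λ, q_λ, c, f ∈ 𝔅^m` and, for `k ≤ m`,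
`sup (∑_λ (|D^k q_λ|² + |D^k p_λ|²) + |D^k c|²) ≤ M_k²`. -/
def Regular (m : ℕ) (M : Fin (m + 1) → ℝ) (f : E d → ℝ) : Prop :=
  (∀ l ∈ S.Λ₁, MemB m (S.q l) ∧ MemB m (S.p l)) ∧ MemB m S.c ∧ MemB m f ∧
    ∀ k : Fin (m + 1), ∀ᵐ x,
      ∑ l ∈ S.Λ₁, (sqD k (S.q l) x + sqD k (S.p l) x) + sqD k S.c x ≤ M k ^ 2

/-- `χ_{h,λ} ≥ 0` for all `h ∈ (0, h₀]`, `λ ∈ Λ₁`. -/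
def ChiNonneg (h₀ : ℝ) : Prop :=
  ∀ h ∈ Ioc 0 h₀, ∀ l ∈ S.Λ₁, ∀ x, 0 ≤ S.χ h l x

/-- `∑_{λ ∈ Λ₁} λ q_λ = 0`. -/
def Balanced : Prop := ∀ x, ∑ l ∈ S.Λ₁, S.q l x • l = 0

/-- The first order structural assumption. -/
def Structural₁ (m : ℕ) (δ K τ₀ h₀ : ℝ) : Prop :=
  ∀ h ∈ Ioc 0 h₀, ∃ 𝒦 : (E d → ℝ) → E d → ℝ, Mem𝔎 𝒦 ∧ ∀ φ, SmoothBdd φ → ∀ x,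
    (m : ℝ) * S.A τ₀ h φ x ≤
      (1 - δ) * ∑ μ ∈ S.idx, S.𝒬 h (S.bar τ₀ h μ φ) x
        + K * S.𝒬 h φ x
        + 2 * (1 - δ) * S.c x * 𝒦 (S.sqBar τ₀ h φ) x

/-- The second order structural assumption. -/
def Structural₂ (m : ℕ) (δ K τ₀ h₀ : ℝ) : Prop :=
  ∀ h ∈ Ioc 0 h₀, ∀ n : ℕ, 1 ≤ n → n ≤ m →
    ∃ 𝒦 : (E d → ℝ) → E d → ℝ, Mem𝔎 𝒦 ∧ ∀ φ, SmoothBdd φ → ∀ x,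
      (n : ℝ) * ∑ ν ∈ S.idx, S.A τ₀ h (S.bar τ₀ h ν φ) x
          + (n : ℝ) * ((n : ℝ) - 1) * ∑ μ ∈ S.idx, ∑ ν ∈ S.idx,
              S.bar τ₀ h μ (S.bar τ₀ h ν φ) x *
                S.Qμ h (fun ψ => S.bar τ₀ h μ (S.bar τ₀ h ν ψ)) (T h μ (T h ν φ)) x ≤
        (1 - δ) * ∑ μ ∈ S.idx, ∑ ν ∈ S.idx, S.𝒬 h (S.bar τ₀ h μ (S.bar τ₀ h ν φ)) x
          + K * ∑ μ ∈ S.idx, S.𝒬 h (S.bar τ₀ h μ φ) x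
          + 2 * (1 - δ) * S.c x * 𝒦 (S.sqBar₂ τ₀ h φ) x
          + K * 𝒦 (S.sqBar τ₀ h φ) x

/-- The symmetry condition (S): `Λ₁ = -Λ₁` and `q_λ = q_{-λ}`. -/
def Symm : Prop := ∀ l ∈ S.Λ₁, -l ∈ S.Λ₁ ∧ ∀ x, S.q l x = S.q (-l) x

/-- `p_{-λ} = -p_λ` for `λ ∈ Λ₁`. -/
def AntisymmP : Prop := ∀ l ∈ S.Λ₁, ∀ x, S.p (-l) x = -S.p l x

end Scheme

end

end EllipticFD

open EllipticFD

namespace EllipticFD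

noncomputable section

variable {d : ℕ}

/-- The `n`-th derivative of `φ` is bounded by `B`. -/
def Bd (n : ℕ) (B : ℝ) (φ : E d → ℝ) : Prop := ∀ x, ‖iteratedFDeriv ℝ n φ x‖ ≤ B

theorem Bd.mono {n : ℕ} {B C : ℝ} {φ : E d → ℝ} (h : Bd n B φ) (hBC : B ≤ C) : Bd n C φ :=
  fun x => (h x).trans hBC

theorem Bd.nonneg {n : ℕ} {B : ℝ} {φ : E d → ℝ} (h : Bd n B φ) : 0 ≤ B :=
  (norm_nonneg _).trans (h 0)

theorem bd_zero_iff {B : ℝ} {φ : E d → ℝ} : Bd 0 B φ ↔ ∀ x, |φ x| ≤ B := by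
  simp [Bd, Real.norm_eq_abs]

theorem Bd.abs_le {B : ℝ} {φ : E d → ℝ} (h : Bd 0 B φ) (x : E d) : |φ x| ≤ B :=
  bd_zero_iff.1 h x

theorem smooth_at {φ : E d → ℝ} (hφ : ContDiff ℝ ∞ φ) (n : ℕ) : ContDiff ℝ n φ :=
  hφ.of_le (by exact_mod_cast le_top)

theorem Bd.add {n : ℕ} {B C : ℝ} {φ ψ : E d → ℝ} (hφ : ContDiff ℝ ∞ φ) (hψ : ContDiff ℝ ∞ ψ)
    (h₁ : Bd n B φ) (h₂ : Bd n C ψ) : Bd n (B + C) (fun x => φ x + ψ x) := fun x => by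
  have : iteratedFDeriv ℝ n (fun x => φ x + ψ x) x
      = iteratedFDeriv ℝ n φ x + iteratedFDeriv ℝ n ψ x :=
    iteratedFDeriv_add_apply (smooth_at hφ n).contDiffAt (smooth_at hψ n).contDiffAt
  rw [this]
  exact (norm_add_le _ _).trans (add_le_add (h₁ x) (h₂ x))

theorem Bd.const_mul {n : ℕ} {B : ℝ} {φ : E d → ℝ} (hφ : ContDiff ℝ ∞ φ) (h : Bd n B φ) (a : ℝ) :
    Bd n (|a| * B) (fun x => a * φ x) := fun x => by
  have : iteratedFDeriv ℝ n (fun x => a * φ x) x = a • iteratedFDeriv ℝ n φ x :=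
    iteratedFDeriv_const_smul_apply (a := a) (smooth_at hφ n).contDiffAt
  rw [this, norm_smul, Real.norm_eq_abs]
  exact mul_le_mul_of_nonneg_left (h x) (abs_nonneg a)

theorem bd_zero_fun (n : ℕ) : Bd n 0 (fun _ : E d => (0 : ℝ)) := fun x => by
  have : iteratedFDeriv ℝ n (fun _ : E d => (0 : ℝ)) x = 0 := by
    have := iteratedFDeriv_fun_zero (𝕜 := ℝ) (E := E d) (F := ℝ) (n := n)
    exact congrFun this x
  rw [this, norm_zero]

theorem Bd.sum {κ : Type*} {n : ℕ} (s : Finset κ) {B : κ → ℝ} {φ : κ → E d → ℝ}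
    (hφ : ∀ i ∈ s, ContDiff ℝ ∞ (φ i)) (h : ∀ i ∈ s, Bd n (B i) (φ i)) :
    Bd n (∑ i ∈ s, B i) (fun x => ∑ i ∈ s, φ i x) := fun x => by
  have : iteratedFDeriv ℝ n (fun x => ∑ i ∈ s, φ i x) x = ∑ i ∈ s, iteratedFDeriv ℝ n (φ i) x := by
    exact iteratedFDeriv_fun_sum_apply fun j hj => (smooth_at (hφ j hj) n).contDiffAt
  rw [this]
  exact (norm_sum_le _ _).trans (Finset.sum_le_sum fun i hi => h i hi x)

theorem Bd.mul {n : ℕ} {B C : ℕ → ℝ} {φ ψ : E d → ℝ} (hφ : ContDiff ℝ ∞ φ) (hψ : ContDiff ℝ ∞ ψ)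
    (h₁ : ∀ j ≤ n, Bd j (B j) φ) (h₂ : ∀ j ≤ n, Bd j (C j) ψ) :
    Bd n (∑ i ∈ Finset.range (n + 1), (n.choose i : ℝ) * B i * C (n - i))
      (fun x => φ x * ψ x) := fun x => by
  refine (norm_iteratedFDeriv_mul_le hφ hψ x (n := n) (by exact_mod_cast le_top)).trans ?_
  refine Finset.sum_le_sum fun i hi => ?_
  have hi' : i ≤ n := Nat.lt_succ_iff.1 (Finset.mem_range.1 hi)
  have := h₁ i hi' x
  have := h₂ (n - i) (Nat.sub_le _ _) x
  have := (h₁ i hi').nonneg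
  gcongr

theorem Bd.shift {n : ℕ} {B : ℝ} {φ : E d → ℝ} (h : Bd n B φ) (v : E d) :
    Bd n B (fun x => φ (x + v)) := fun x => by
  rw [iteratedFDeriv_comp_add_right]
  exact h _

theorem bd_succ_iff_fderiv {n : ℕ} {B : ℝ} {φ : E d → ℝ} :
    Bd (n + 1) B φ ↔ ∀ x, ‖iteratedFDeriv ℝ n (fderiv ℝ φ) x‖ ≤ B := by
  simp only [Bd, norm_iteratedFDeriv_fderiv]

theorem smooth_fderiv {φ : E d → ℝ} (hφ : ContDiff ℝ ∞ φ) : ContDiff ℝ ∞ (fderiv ℝ φ) :=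
  hφ.fderiv_right (by simp)

theorem smooth_differentiable {φ : E d → ℝ} (hφ : ContDiff ℝ ∞ φ) : Differentiable ℝ φ :=
  hφ.differentiable (by simp)

/-- Directional derivative. -/
def dirD (l : E d) (φ : E d → ℝ) : E d → ℝ := fun x => fderiv ℝ φ x l

theorem partialD_eq_dirD (i : Fin d) (φ : E d → ℝ) :
    partialD i φ = dirD (EuclideanSpace.single i 1) φ := rfl

theorem smooth_dirD {φ : E d → ℝ} (hφ : ContDiff ℝ ∞ φ) (l : E d) : ContDiff ℝ ∞ (dirD l φ) :=
  (smooth_fderiv hφ).clm_apply contDiff_const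

theorem smooth_partialD {φ : E d → ℝ} (hφ : ContDiff ℝ ∞ φ) (i : Fin d) :
    ContDiff ℝ ∞ (partialD i φ) := smooth_dirD hφ _

theorem Bd.dirD {n : ℕ} {B : ℝ} {φ : E d → ℝ} (hφ : ContDiff ℝ ∞ φ) (h : Bd (n + 1) B φ) (l : E d) :
    Bd n (‖l‖ * B) (dirD l φ) := fun x => by
  have h1 := bd_succ_iff_fderiv.1 h x
  have hs : ContDiffAt ℝ n (fderiv ℝ φ) x :=
    ((smooth_fderiv hφ).of_le (by exact_mod_cast le_top)).contDiffAt
  have h2 : iteratedFDeriv ℝ n (EllipticFD.dirD l φ) x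
      = (ContinuousLinearMap.apply ℝ ℝ l).compContinuousMultilinearMap
          (iteratedFDeriv ℝ n (fderiv ℝ φ) x) :=
    (ContinuousLinearMap.apply ℝ ℝ l).iteratedFDeriv_comp_left hs le_rfl
  rw [h2]
  refine (ContinuousLinearMap.norm_compContinuousMultilinearMap_le _ _).trans ?_
  have h3 : ‖ContinuousLinearMap.apply ℝ ℝ l‖ ≤ ‖l‖ := by
    refine ContinuousLinearMap.opNorm_le_bound _ (norm_nonneg _) fun g => ?_
    rw [mul_comm]; exact g.le_opNorm l
  have := norm_nonneg l
  gcongr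

theorem Bd.partialD {n : ℕ} {B : ℝ} {φ : E d → ℝ} (hφ : ContDiff ℝ ∞ φ) (h : Bd (n + 1) B φ)
    (i : Fin d) : Bd n B (partialD i φ) := by
  have := h.dirD hφ (EuclideanSpace.single i (1 : ℝ))
  rw [partialD_eq_dirD]
  simpa using this

theorem fderiv_eq_sum_partialD (φ : E d → ℝ) (x v : E d) :
    fderiv ℝ φ x v = ∑ i, v i * partialD i φ x := by
  conv_lhs => rw [show v = ∑ i, v i • EuclideanSpace.single i (1 : ℝ) from by
    ext j
    simp [Finset.sum_apply, Pi.single_apply]]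
  simp only [map_sum, map_smul, smul_eq_mul]
  rfl

theorem bd_succ_of_partialD {n : ℕ} {B : ℝ} {φ : E d → ℝ} (hφ : ContDiff ℝ ∞ φ)
    (h : ∀ i, Bd n B (EllipticFD.partialD i φ)) : Bd (n + 1) (d * B) φ := by
  rw [bd_succ_iff_fderiv]
  intro x
  have hs : fderiv ℝ φ = fun x => ∑ i : Fin d,
      (ContinuousLinearMap.toSpanSingleton ℝ (EuclideanSpace.proj i : E d →L[ℝ] ℝ))
        (EllipticFD.partialD i φ x) := by
    funext y
    ext v
    rw [fderiv_eq_sum_partialD]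
    simp [mul_comm]
  have hp : ∀ i : Fin d, ContDiff ℝ n (EllipticFD.partialD i φ) :=
    fun i => smooth_at (smooth_partialD hφ i) n
  rw [hs, iteratedFDeriv_fun_sum_apply (f := fun i x =>
    (ContinuousLinearMap.toSpanSingleton ℝ (EuclideanSpace.proj i : E d →L[ℝ] ℝ))
      (EllipticFD.partialD i φ x)) (fun j _ => (ContDiff.comp
    (ContinuousLinearMap.contDiff _) (hp j)).contDiffAt)]
  refine (norm_sum_le _ _).trans ?_
  have : ∀ i ∈ (Finset.univ : Finset (Fin d)), ‖iteratedFDeriv ℝ n (fun x =>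
      (ContinuousLinearMap.toSpanSingleton ℝ (EuclideanSpace.proj i : E d →L[ℝ] ℝ))
        (EllipticFD.partialD i φ x)) x‖ ≤ B := by
    intro i _
    have h2 := (ContinuousLinearMap.toSpanSingleton ℝ
      (EuclideanSpace.proj i : E d →L[ℝ] ℝ)).iteratedFDeriv_comp_left
        (hp i).contDiffAt (x := x) le_rfl
    have h2' : iteratedFDeriv ℝ n (fun x =>
      (ContinuousLinearMap.toSpanSingleton ℝ (EuclideanSpace.proj i : E d →L[ℝ] ℝ))
        (EllipticFD.partialD i φ x)) x = _ := h2
    rw [h2']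
    refine (ContinuousLinearMap.norm_compContinuousMultilinearMap_le _ _).trans ?_
    have h3 : ‖ContinuousLinearMap.toSpanSingleton ℝ (EuclideanSpace.proj i : E d →L[ℝ] ℝ)‖ ≤ 1 := by
      rw [ContinuousLinearMap.norm_toSpanSingleton]
      refine ContinuousLinearMap.opNorm_le_bound _ zero_le_one fun v => ?_
      rw [one_mul]
      exact PiLp.norm_apply_le v i
    calc _ ≤ 1 * B := by
          have := h i x
          have := (h i).nonneg
          gcongr
      _ = B := one_mul _
  refine (Finset.sum_le_sum this).trans ?_
  simp

theorem smooth_shift {φ : E d → ℝ} (hφ : ContDiff ℝ ∞ φ) (v : E d) :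
    ContDiff ℝ ∞ (fun x => φ (x + v)) := hφ.comp (contDiff_id.add contDiff_const)

theorem smooth_fdiff {φ : E d → ℝ} (hφ : ContDiff ℝ ∞ φ) (h : ℝ) (l : E d) :
    ContDiff ℝ ∞ (fdiff h l φ) :=
  contDiff_const.mul ((smooth_shift hφ _).sub hφ)

theorem Bd.sub_shift {n : ℕ} {B : ℝ} {φ : E d → ℝ} (hφ : ContDiff ℝ ∞ φ) (hb : Bd (n + 1) B φ)
    (v : E d) : Bd n (‖v‖ * B) (fun x => φ (x + v) - φ x) := fun x => by
  have h1 : iteratedFDeriv ℝ n (fun x => φ (x + v) - φ x) x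
      = iteratedFDeriv ℝ n φ (x + v) - iteratedFDeriv ℝ n φ x := by
    have := iteratedFDeriv_sub_apply (𝕜 := ℝ) (i := n) (x := x)
      (smooth_at (smooth_shift hφ v) n).contDiffAt (smooth_at hφ n).contDiffAt
    rw [iteratedFDeriv_comp_add_right] at this
    exact this
  rw [h1]
  have h2 : Differentiable ℝ (iteratedFDeriv ℝ n φ) :=
    (smooth_at hφ (n + 1)).differentiable_iteratedFDeriv (by exact_mod_cast Nat.lt_succ_self n)
  have h3 := Convex.norm_image_sub_le_of_norm_fderiv_le (𝕜 := ℝ) (s := univ)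
    (f := iteratedFDeriv ℝ n φ) (C := B) (x := x) (y := x + v)
    (fun y _ => h2 y) (fun y _ => by rw [norm_fderiv_iteratedFDeriv]; exact hb y) convex_univ
    (mem_univ _) (mem_univ _)
  rw [mul_comm]
  simpa using h3

theorem Bd.fdiff {n : ℕ} {B : ℝ} {φ : E d → ℝ} (hφ : ContDiff ℝ ∞ φ) (hb : Bd (n + 1) B φ)
    {h : ℝ} (hh : 0 < h) (l : E d) : Bd n (‖l‖ * B) (fdiff h l φ) := by
  have := (hb.sub_shift hφ (h • l)).const_mul ((smooth_shift hφ (h • l)).sub hφ) h⁻¹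
  refine this.mono (le_of_eq ?_)
  rw [norm_smul, abs_inv, Real.norm_eq_abs, abs_of_pos hh]
  field_simp

/-! ### Smooth bounded functions -/

theorem SmoothBdd.bd {φ : E d → ℝ} (h : SmoothBdd φ) (n : ℕ) : ∃ B, Bd n B φ := h.2 n

theorem SmoothBdd.bdd {φ : E d → ℝ} (h : SmoothBdd φ) : ∃ B, ∀ x, |φ x| ≤ B :=
  (h.bd 0).imp fun _ hB => hB.abs_le

theorem SmoothBdd.add {φ ψ : E d → ℝ} (h₁ : SmoothBdd φ) (h₂ : SmoothBdd ψ) :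
    SmoothBdd (fun x => φ x + ψ x) :=
  ⟨h₁.1.add h₂.1, fun n => by
    obtain ⟨B, hB⟩ := h₁.bd n
    obtain ⟨C, hC⟩ := h₂.bd n
    exact ⟨_, hB.add h₁.1 h₂.1 hC⟩⟩

theorem SmoothBdd.const_mul {φ : E d → ℝ} (h₁ : SmoothBdd φ) (a : ℝ) :
    SmoothBdd (fun x => a * φ x) :=
  ⟨contDiff_const.mul h₁.1, fun n => by
    obtain ⟨B, hB⟩ := h₁.bd n
    exact ⟨_, hB.const_mul h₁.1 a⟩⟩

theorem SmoothBdd.sum {κ : Type*} (s : Finset κ) {φ : κ → E d → ℝ}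
    (h : ∀ i ∈ s, SmoothBdd (φ i)) : SmoothBdd (fun x => ∑ i ∈ s, φ i x) := by
  refine ⟨ContDiff.sum fun i hi => (h i hi).1, fun n => ?_⟩
  have : ∀ i, ∃ B, i ∈ s → Bd n B (φ i) := fun i => by
    by_cases hi : i ∈ s
    · exact ((h i hi).bd n).imp fun B hB _ => hB
    · exact ⟨0, fun h => absurd h hi⟩
  choose B hB using this
  exact ⟨_, Bd.sum s (fun i hi => (h i hi).1) hB⟩

theorem SmoothBdd.mul {φ ψ : E d → ℝ} (h₁ : SmoothBdd φ) (h₂ : SmoothBdd ψ) :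
    SmoothBdd (fun x => φ x * ψ x) :=
  ⟨h₁.1.mul h₂.1, fun n => by
    choose B hB using h₁.bd
    choose C hC using h₂.bd
    exact ⟨_, Bd.mul h₁.1 h₂.1 (n := n) (fun j _ => hB j) (fun j _ => hC j)⟩⟩

theorem SmoothBdd.sub {φ ψ : E d → ℝ} (h₁ : SmoothBdd φ) (h₂ : SmoothBdd ψ) :
    SmoothBdd (fun x => φ x - ψ x) := by
  have := h₁.add (h₂.const_mul (-1))
  simpa [sub_eq_add_neg] using this

theorem SmoothBdd.shift {φ : E d → ℝ} (h₁ : SmoothBdd φ) (v : E d) :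
    SmoothBdd (fun x => φ (x + v)) :=
  ⟨smooth_shift h₁.1 v, fun n => (h₁.bd n).imp fun _ hB => hB.shift v⟩

theorem SmoothBdd.fdiff {φ : E d → ℝ} (h₁ : SmoothBdd φ) (h : ℝ) (l : E d) :
    SmoothBdd (fdiff h l φ) := ((h₁.shift (h • l)).sub h₁).const_mul h⁻¹

theorem SmoothBdd.dirD {φ : E d → ℝ} (h₁ : SmoothBdd φ) (l : E d) : SmoothBdd (dirD l φ) :=
  ⟨smooth_dirD h₁.1 l, fun n => by
    obtain ⟨B, hB⟩ := h₁.bd (n + 1)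
    exact ⟨_, hB.dirD h₁.1 l⟩⟩

theorem SmoothBdd.partialD {φ : E d → ℝ} (h₁ : SmoothBdd φ) (i : Fin d) :
    SmoothBdd (partialD i φ) := h₁.dirD _

theorem SmoothBdd.dirD_iterate {φ : E d → ℝ} (h₁ : SmoothBdd φ) (l : E d) (n : ℕ) :
    SmoothBdd ((EllipticFD.dirD l)^[n] φ) := by
  induction n with
  | zero => exact h₁
  | succ n ih => rw [Function.iterate_succ_apply']; exact ih.dirD l

theorem Bd.dirD_iterate {n r : ℕ} {B : ℝ} {φ : E d → ℝ} (hφ : ContDiff ℝ ∞ φ)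
    (h : Bd (n + r) B φ) (l : E d) : Bd n (‖l‖ ^ r * B) ((EllipticFD.dirD l)^[r] φ) := by
  induction r generalizing φ B with
  | zero => simpa using h
  | succ r ih =>
    rw [Function.iterate_succ_apply]
    have := ih (smooth_dirD hφ l) (h.dirD hφ l)
    rwa [← mul_assoc, ← pow_succ] at this

theorem dirD_comm {φ : E d → ℝ} (hφ : ContDiff ℝ ∞ φ) (l k : E d) :
    dirD l (dirD k φ) = dirD k (dirD l φ) := by
  funext x
  have h1 : ∀ v w : E d, dirD v (dirD w φ) x = fderiv ℝ (fderiv ℝ φ) x v w := by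
    intro v w
    have hd : DifferentiableAt ℝ (fderiv ℝ φ) x :=
      (smooth_fderiv hφ).differentiable (by simp) x
    have := (hd.hasFDerivAt.clm_apply (hasFDerivAt_const w x)).fderiv
    unfold dirD
    rw [this]
    simp
  rw [h1, h1]
  have h2 : IsSymmSndFDerivAt ℝ φ x :=
    hφ.contDiffAt.isSymmSndFDerivAt (by simp; norm_cast)
  exact h2 _ _

theorem dirD_shift (φ : E d → ℝ) (l v : E d) :
    dirD l (fun x => φ (x + v)) = fun x => dirD l φ (x + v) := by
  funext x
  simp only [dirD]
  rw [fderiv_comp_add_right]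

theorem dirD_fdiff {φ : E d → ℝ} (hφ : Differentiable ℝ φ) (h : ℝ) (l k : E d) :
    dirD k (fdiff h l φ) = fdiff h l (dirD k φ) := by
  funext x
  have h1 : DifferentiableAt ℝ (fun x => φ (x + h • l)) x :=
    (hφ _).comp x (differentiableAt_id.add (differentiableAt_const _))
  have h2 : HasFDerivAt (fun x => φ (x + h • l)) (fderiv ℝ φ (x + h • l)) x := by
    rw [← fderiv_comp_add_right]
    exact h1.hasFDerivAt
  have h3 := ((h2.sub (hφ x).hasFDerivAt).const_mul h⁻¹).fderiv
  have h4 : fderiv ℝ (fdiff h l φ) x = _ := h3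
  simp only [dirD]
  rw [h4]
  rfl

end

end EllipticFD

namespace EllipticFD

noncomputable section

variable {d : ℕ}

/-! ### Lists of given length with entries in a finite set -/

/-- The lists of length `n` with entries in `s`. -/
def lists {α : Type*} (s : Finset α) : ℕ → Finset (List α)
  | 0 => {[]}
  | n + 1 => (s ×ˢ lists s n).map ⟨fun p => p.1 :: p.2, fun p q h => by
      simp only [List.cons.injEq] at h; exact Prod.ext h.1 h.2⟩

theorem sum_lists_zero {α : Type*} (s : Finset α) (F : List α → ℝ) :
    ∑ I ∈ lists s 0, F I = F [] := by simp [lists]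

theorem sum_lists_succ {α : Type*} (s : Finset α) (n : ℕ) (F : List α → ℝ) :
    ∑ I ∈ lists s (n + 1), F I = ∑ a ∈ s, ∑ I ∈ lists s n, F (a :: I) := by
  rw [lists, Finset.sum_map, Finset.sum_product]
  rfl

theorem mem_lists_succ {α : Type*} {s : Finset α} {n : ℕ} {I : List α} :
    I ∈ lists s (n + 1) ↔ ∃ a ∈ s, ∃ J ∈ lists s n, I = a :: J := by
  simp only [lists, Finset.mem_map, Finset.mem_product, Prod.exists]
  constructor
  · rintro ⟨a, J, ⟨ha, hJ⟩, rfl⟩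
    exact ⟨a, ha, J, hJ, rfl⟩
  · rintro ⟨a, ha, J, hJ, rfl⟩
    exact ⟨a, J, ⟨ha, hJ⟩, rfl⟩

theorem sum_lists_append {α : Type*} (s : Finset α) (k n : ℕ) (F : List α → ℝ) :
    ∑ I ∈ lists s (k + n), F I = ∑ J ∈ lists s k, ∑ I ∈ lists s n, F (J ++ I) := by
  induction k generalizing F with
  | zero => simp [sum_lists_zero]
  | succ k ih =>
    rw [show k + 1 + n = (k + n) + 1 by ring, sum_lists_succ, sum_lists_succ]
    refine Finset.sum_congr rfl fun a _ => ?_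
    rw [ih]
    rfl

namespace Scheme

variable (S : Scheme d)

/-- Iterated weighted differences `δ̄_I`. -/
def barL (τ₀ h : ℝ) (I : List (E d ⊕ Fin d)) (φ : E d → ℝ) : E d → ℝ :=
  I.foldr (S.bar τ₀ h) φ

/-- Iterated shifts `T_I`. -/
def TL (h : ℝ) (I : List (E d ⊕ Fin d)) (φ : E d → ℝ) : E d → ℝ := I.foldr (Scheme.T h) φ

@[simp] theorem barL_nil (τ₀ h : ℝ) (φ : E d → ℝ) : S.barL τ₀ h [] φ = φ := rfl

@[simp] theorem barL_cons (τ₀ h : ℝ) (a : E d ⊕ Fin d) (I : List (E d ⊕ Fin d)) (φ : E d → ℝ) :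
    S.barL τ₀ h (a :: I) φ = S.bar τ₀ h a (S.barL τ₀ h I φ) := rfl

theorem barL_append (τ₀ h : ℝ) (J I : List (E d ⊕ Fin d)) (φ : E d → ℝ) :
    S.barL τ₀ h (J ++ I) φ = S.barL τ₀ h J (S.barL τ₀ h I φ) := by
  simp [barL, List.foldr_append]

@[simp] theorem TL_nil (h : ℝ) (φ : E d → ℝ) : TL h [] φ = φ := rfl

@[simp] theorem TL_cons (h : ℝ) (a : E d ⊕ Fin d) (I : List (E d ⊕ Fin d)) (φ : E d → ℝ) :
    TL h (a :: I) φ = T h a (TL h I φ) := rfl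

/-- The weight of an index: `τ_λ |λ|` for `λ ∈ Λ₁`, and `τ₀` for the labels. -/
def wt (τ₀ : ℝ) : E d ⊕ Fin d → ℝ
  | .inl l => |S.τ l| * ‖l‖
  | .inr _ => |τ₀|

/-- Product of the weights. -/
def wtL (τ₀ : ℝ) (I : List (E d ⊕ Fin d)) : ℝ := (I.map (S.wt τ₀)).prod

theorem wt_nonneg (τ₀ : ℝ) (a : E d ⊕ Fin d) : 0 ≤ S.wt τ₀ a := by
  cases a <;> simp only [wt] <;> positivity

@[simp] theorem wtL_nil (τ₀ : ℝ) : S.wtL τ₀ [] = 1 := rfl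

@[simp] theorem wtL_cons (τ₀ : ℝ) (a : E d ⊕ Fin d) (I : List (E d ⊕ Fin d)) :
    S.wtL τ₀ (a :: I) = S.wt τ₀ a * S.wtL τ₀ I := by simp [wtL]

theorem wtL_append (τ₀ : ℝ) (J I : List (E d ⊕ Fin d)) :
    S.wtL τ₀ (J ++ I) = S.wtL τ₀ J * S.wtL τ₀ I := by simp [wtL]

theorem wtL_nonneg (τ₀ : ℝ) (I : List (E d ⊕ Fin d)) : 0 ≤ S.wtL τ₀ I := by
  induction I with
  | nil => simp
  | cons a I ih => rw [wtL_cons]; exact mul_nonneg (S.wt_nonneg τ₀ a) ih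

theorem sum_wtL_sq (τ₀ : ℝ) (n : ℕ) :
    ∑ I ∈ lists S.idx n, S.wtL τ₀ I ^ 2 = (S.wsize ^ 2 + d * τ₀ ^ 2) ^ n := by
  induction n with
  | zero => simp [sum_lists_zero]
  | succ n ih =>
    rw [sum_lists_succ]
    simp only [wtL_cons, mul_pow, ← Finset.mul_sum, ih]
    rw [← Finset.sum_mul, pow_succ _ n, mul_comm]
    congr 1
    rw [wsize, Real.sq_sqrt (Finset.sum_nonneg fun _ _ => by positivity), idx,
      Finset.sum_disjSum]
    simp [wt, norm_smul, mul_pow]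

variable {S}

theorem smoothBdd_bar {φ : E d → ℝ} (hφ : SmoothBdd φ) (τ₀ h : ℝ) (a : E d ⊕ Fin d) :
    SmoothBdd (S.bar τ₀ h a φ) := by
  cases a with
  | inl l => exact (hφ.fdiff h l).const_mul _
  | inr i => exact (hφ.partialD i).const_mul _

theorem smoothBdd_T {φ : E d → ℝ} (hφ : SmoothBdd φ) (h : ℝ) (a : E d ⊕ Fin d) :
    SmoothBdd (Scheme.T h a φ) := by
  cases a with
  | inl l => exact hφ.shift _
  | inr i => exact hφ

theorem smoothBdd_barL {φ : E d → ℝ} (hφ : SmoothBdd φ) (τ₀ h : ℝ) (I : List (E d ⊕ Fin d)) :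
    SmoothBdd (S.barL τ₀ h I φ) := by
  induction I with
  | nil => exact hφ
  | cons a I ih => exact smoothBdd_bar ih τ₀ h a

theorem smoothBdd_TL {φ : E d → ℝ} (hφ : SmoothBdd φ) (h : ℝ) (I : List (E d ⊕ Fin d)) :
    SmoothBdd (TL h I φ) := by
  induction I with
  | nil => exact hφ
  | cons a I ih => exact smoothBdd_T ih h a

theorem bd_bar {n : ℕ} {B : ℝ} {φ : E d → ℝ} (hφ : ContDiff ℝ ∞ φ) (hb : Bd (n + 1) B φ)
    (τ₀ : ℝ) {h : ℝ} (hh : 0 < h) (a : E d ⊕ Fin d) :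
    Bd n (S.wt τ₀ a * B) (S.bar τ₀ h a φ) := by
  cases a with
  | inl l =>
    have := (hb.fdiff hφ hh l).const_mul (smooth_fdiff hφ h l) (S.τ l)
    rwa [← mul_assoc] at this
  | inr i => exact (hb.partialD hφ i).const_mul (smooth_partialD hφ i) τ₀

theorem bd_T {n : ℕ} {B : ℝ} {φ : E d → ℝ} (hb : Bd n B φ) (h : ℝ) (a : E d ⊕ Fin d) :
    Bd n B (Scheme.T h a φ) := by
  cases a with
  | inl l => exact hb.shift _
  | inr i => exact hb

theorem bd_TL {n : ℕ} {B : ℝ} {φ : E d → ℝ} (hb : Bd n B φ) (h : ℝ) (I : List (E d ⊕ Fin d)) :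
    Bd n B (TL h I φ) := by
  induction I with
  | nil => exact hb
  | cons a I ih => exact bd_T ih h a

theorem bd_barL {k n : ℕ} {s : Finset (E d ⊕ Fin d)} {B : ℝ} {φ : E d → ℝ} (hφ : SmoothBdd φ)
    (hb : Bd (n + k) B φ) (τ₀ : ℝ) {h : ℝ} (hh : 0 < h) {I : List (E d ⊕ Fin d)}
    (hI : I ∈ lists s k) :
    Bd n (S.wtL τ₀ I * B) (S.barL τ₀ h I φ) := by
  induction k generalizing n I with
  | zero =>
    simp only [lists, Finset.mem_singleton] at hI
    subst hI
    simpa using hb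
  | succ k ih =>
    obtain ⟨a, -, J, hJ, rfl⟩ := mem_lists_succ.1 hI
    have h1 := ih (n := n + 1) (by convert hb using 1; ring) hJ
    have := bd_bar (S := S) (smoothBdd_barL hφ τ₀ h J).1 h1 τ₀ hh a
    rw [wtL_cons, mul_assoc]
    exact this

/-! ### Commutation -/

theorem bar_comm {φ : E d → ℝ} (hφ : ContDiff ℝ ∞ φ) (τ₀ h : ℝ) (a b : E d ⊕ Fin d) :
    S.bar τ₀ h a (S.bar τ₀ h b φ) = S.bar τ₀ h b (S.bar τ₀ h a φ) := by
  have key : ∀ (l : E d) (c : ℝ) (i : Fin d), partialD i (fun x => c * fdiff h l φ x)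
      = fun x => c * fdiff h l (partialD i φ) x := by
    intro l c i
    rw [partialD_eq_dirD, partialD_eq_dirD, ← dirD_fdiff (smooth_differentiable hφ)]
    funext x
    simp only [dirD]
    rw [fderiv_const_mul (smooth_differentiable (smooth_fdiff hφ h l) x)]
    rfl
  have key2 : ∀ (c : ℝ) (i j : Fin d), partialD i (fun x => c * partialD j φ x)
      = fun x => c * partialD i (partialD j φ) x := by
    intro c i j
    funext x
    have := fderiv_const_mul (smooth_differentiable (smooth_partialD hφ j) x) c
    simp only [partialD] at this ⊢
    rw [this]
    rfl
  cases a with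
  | inl l =>
    cases b with
    | inl k =>
      funext x
      simp only [bar, fdiff]
      rw [add_right_comm]
      ring
    | inr i =>
      funext x
      simp only [bar, key]
      simp only [fdiff]
      ring
  | inr i =>
    cases b with
    | inl k =>
      funext x
      simp only [bar, key]
      simp only [fdiff]
      ring
    | inr j =>
      funext x
      simp only [bar, key2]
      rw [partialD_eq_dirD, partialD_eq_dirD, partialD_eq_dirD, partialD_eq_dirD, dirD_comm hφ]

theorem bar_T (φ : E d → ℝ) (τ₀ h : ℝ) (a b : E d ⊕ Fin d) :
    S.bar τ₀ h a (Scheme.T h b φ) = Scheme.T h b (S.bar τ₀ h a φ) := by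
  cases b with
  | inr j => rfl
  | inl k =>
    cases a with
    | inl l =>
      funext x
      simp only [bar, fdiff, Scheme.T]
      rw [add_right_comm]
    | inr i =>
      funext x
      simp only [bar, Scheme.T, partialD_eq_dirD]
      rw [dirD_shift]

theorem barL_bar {φ : E d → ℝ} (hφ : SmoothBdd φ) (τ₀ h : ℝ) (a : E d ⊕ Fin d)
    (I : List (E d ⊕ Fin d)) :
    S.barL τ₀ h I (S.bar τ₀ h a φ) = S.bar τ₀ h a (S.barL τ₀ h I φ) := by
  induction I with
  | nil => rfl
  | cons b I ih => rw [barL_cons, ih, bar_comm (smoothBdd_barL hφ τ₀ h I).1, barL_cons]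

theorem barL_T (φ : E d → ℝ) (τ₀ h : ℝ) (a : E d ⊕ Fin d) (I : List (E d ⊕ Fin d)) :
    S.barL τ₀ h I (Scheme.T h a φ) = Scheme.T h a (S.barL τ₀ h I φ) := by
  induction I with
  | nil => rfl
  | cons b I ih => rw [barL_cons, ih, bar_T, barL_cons]

theorem T_comm (φ : E d → ℝ) (h : ℝ) (a b : E d ⊕ Fin d) :
    Scheme.T h a (Scheme.T h b φ) = Scheme.T h b (Scheme.T h a φ) := by
  cases a <;> cases b <;> simp only [Scheme.T]
  funext x
  rw [add_right_comm]

theorem TL_T (φ : E d → ℝ) (h : ℝ) (a : E d ⊕ Fin d) (I : List (E d ⊕ Fin d)) :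
    TL h I (Scheme.T h a φ) = Scheme.T h a (TL h I φ) := by
  induction I with
  | nil => rfl
  | cons b I ih => rw [TL_cons, ih, T_comm, TL_cons]

theorem fdiff_T (φ : E d → ℝ) (h : ℝ) (l : E d) (a : E d ⊕ Fin d) :
    fdiff h l (Scheme.T h a φ) = Scheme.T h a (fdiff h l φ) := by
  cases a with
  | inr i => rfl
  | inl k =>
    funext x
    simp only [fdiff, Scheme.T]
    rw [add_right_comm]

theorem fdiff_TL (φ : E d → ℝ) (h : ℝ) (l : E d) (I : List (E d ⊕ Fin d)) :
    fdiff h l (TL h I φ) = TL h I (fdiff h l φ) := by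
  induction I with
  | nil => rfl
  | cons a I ih => rw [TL_cons, TL_cons, fdiff_T, ih]

theorem fdiff_bar {φ : E d → ℝ} (hφ : Differentiable ℝ φ) (τ₀ h : ℝ) (l : E d)
    (a : E d ⊕ Fin d) :
    fdiff h l (S.bar τ₀ h a φ) = S.bar τ₀ h a (fdiff h l φ) := by
  cases a with
  | inl k =>
    funext x
    simp only [fdiff, bar]
    rw [add_right_comm]
    ring
  | inr i =>
    funext x
    simp only [bar, partialD_eq_dirD, dirD_fdiff hφ]
    simp only [fdiff]
    ring

theorem fdiff_barL {φ : E d → ℝ} (hφ : SmoothBdd φ) (τ₀ h : ℝ) (l : E d)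
    (I : List (E d ⊕ Fin d)) :
    fdiff h l (S.barL τ₀ h I φ) = S.barL τ₀ h I (fdiff h l φ) := by
  induction I with
  | nil => rfl
  | cons a I ih =>
    rw [barL_cons, barL_cons, fdiff_bar (smooth_differentiable (smoothBdd_barL hφ τ₀ h I).1), ih]

/-! ### Linearity and the Leibniz rule -/

theorem bar_add {φ ψ : E d → ℝ} (hφ : Differentiable ℝ φ) (hψ : Differentiable ℝ ψ) (τ₀ h : ℝ)
    (a : E d ⊕ Fin d) :
    S.bar τ₀ h a (fun x => φ x + ψ x) = fun x => S.bar τ₀ h a φ x + S.bar τ₀ h a ψ x := by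
  cases a with
  | inl l => funext x; simp only [bar, fdiff]; ring
  | inr i =>
    funext x
    simp only [bar, partialD]
    rw [fderiv_fun_add (hφ x) (hψ x)]
    simp only [add_apply]
    ring

theorem bar_const_mul {φ : E d → ℝ} (hφ : Differentiable ℝ φ) (τ₀ h : ℝ) (c : ℝ)
    (a : E d ⊕ Fin d) :
    S.bar τ₀ h a (fun x => c * φ x) = fun x => c * S.bar τ₀ h a φ x := by
  cases a with
  | inl l => funext x; simp only [bar, fdiff]; ring
  | inr i =>
    funext x
    simp only [bar, partialD]
    rw [fderiv_const_mul (hφ x)]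
    simp only [smul_apply, smul_eq_mul]
    ring

theorem bar_zero (τ₀ h : ℝ) (a : E d ⊕ Fin d) :
    S.bar τ₀ h a (fun _ => 0) = fun _ => 0 := by
  have := S.bar_const_mul (φ := fun _ => (0 : ℝ)) (differentiable_const _) τ₀ h 0 a
  simpa using this

theorem barL_add {φ ψ : E d → ℝ} (hφ : SmoothBdd φ) (hψ : SmoothBdd ψ) (τ₀ h : ℝ)
    (I : List (E d ⊕ Fin d)) :
    S.barL τ₀ h I (fun x => φ x + ψ x) = fun x => S.barL τ₀ h I φ x + S.barL τ₀ h I ψ x := by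
  induction I with
  | nil => rfl
  | cons a I ih =>
    rw [barL_cons, ih, bar_add (smooth_differentiable (smoothBdd_barL hφ τ₀ h I).1)
      (smooth_differentiable (smoothBdd_barL hψ τ₀ h I).1)]
    rfl

theorem barL_const_mul {φ : E d → ℝ} (hφ : SmoothBdd φ) (τ₀ h c : ℝ)
    (I : List (E d ⊕ Fin d)) :
    S.barL τ₀ h I (fun x => c * φ x) = fun x => c * S.barL τ₀ h I φ x := by
  induction I with
  | nil => rfl
  | cons a I ih =>
    rw [barL_cons, ih, bar_const_mul (smooth_differentiable (smoothBdd_barL hφ τ₀ h I).1)]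
    rfl

theorem barL_zero (τ₀ h : ℝ) (I : List (E d ⊕ Fin d)) :
    S.barL τ₀ h I (fun _ => 0) = fun _ => 0 := by
  induction I with
  | nil => rfl
  | cons a I ih => rw [barL_cons, ih, bar_zero]

theorem barL_sum {κ : Type*} (s : Finset κ) {φ : κ → E d → ℝ} (hφ : ∀ i ∈ s, SmoothBdd (φ i))
    (τ₀ h : ℝ) (I : List (E d ⊕ Fin d)) :
    S.barL τ₀ h I (fun x => ∑ i ∈ s, φ i x) = fun x => ∑ i ∈ s, S.barL τ₀ h I (φ i) x := by
  classical
  induction s using Finset.induction_on with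
  | empty => simpa using barL_zero τ₀ h I
  | insert i s hi ih =>
    simp only [Finset.sum_insert hi]
    have hs : ∀ j ∈ s, SmoothBdd (φ j) := fun j hj => hφ j (Finset.mem_insert_of_mem hj)
    rw [barL_add (hφ i (Finset.mem_insert_self _ _)) (SmoothBdd.sum s hs), ih hs]

theorem bar_mul {f g : E d → ℝ} (hf : Differentiable ℝ f) (hg : Differentiable ℝ g) (τ₀ h : ℝ)
    (a : E d ⊕ Fin d) :
    S.bar τ₀ h a (fun x => f x * g x)
      = fun x => S.bar τ₀ h a f x * Scheme.T h a g x + f x * S.bar τ₀ h a g x := by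
  cases a with
  | inl l => funext x; simp only [bar, fdiff, Scheme.T]; ring
  | inr i =>
    funext x
    simp only [bar, partialD, Scheme.T]
    rw [fderiv_fun_mul (hf x) (hg x)]
    simp only [add_apply, smul_apply, smul_eq_mul]
    ring

/-- The terms of the Leibniz formula for `∑_I (δ̄_I ψ) δ̄_I (f g)` in which `k` differences fall
on `f`. -/
def leib (S : Scheme d) (τ₀ h : ℝ) (ψ f g : E d → ℝ) (x : E d) (k r : ℕ) : ℝ :=
  ∑ J ∈ lists S.idx k, ∑ I ∈ lists S.idx r,
    S.barL τ₀ h J (S.barL τ₀ h I ψ) x * (S.barL τ₀ h J f x * TL h J (S.barL τ₀ h I g) x)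

theorem sum_leib_bar_right (τ₀ h : ℝ) {ψ f g : E d → ℝ} (hψ : SmoothBdd ψ) (hg : SmoothBdd g)
    (x : E d) (k r : ℕ) :
    ∑ a ∈ S.idx, S.leib τ₀ h (S.bar τ₀ h a ψ) f (S.bar τ₀ h a g) x k r
      = S.leib τ₀ h ψ f g x k (r + 1) := by
  unfold leib
  rw [Finset.sum_comm]
  refine Finset.sum_congr rfl fun J _ => ?_
  rw [sum_lists_succ]
  refine Finset.sum_congr rfl fun a _ => Finset.sum_congr rfl fun I _ => ?_
  rw [barL_bar hψ, barL_bar hg]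
  rfl

theorem sum_leib_bar_left (τ₀ h : ℝ) {ψ f g : E d → ℝ} (hψ : SmoothBdd ψ) (hf : SmoothBdd f)
    (x : E d) (k r : ℕ) :
    ∑ a ∈ S.idx, S.leib τ₀ h (S.bar τ₀ h a ψ) (S.bar τ₀ h a f) (Scheme.T h a g) x k r
      = S.leib τ₀ h ψ f g x (k + 1) r := by
  unfold leib
  rw [sum_lists_succ]
  refine Finset.sum_congr rfl fun a _ => Finset.sum_congr rfl fun J _ =>
    Finset.sum_congr rfl fun I _ => ?_
  rw [barL_bar hψ, barL_bar (smoothBdd_barL hψ τ₀ h I), barL_bar hf, barL_T, TL_T]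
  rfl

theorem leibniz (τ₀ h : ℝ) {ψ f g : E d → ℝ} (hψ : SmoothBdd ψ) (hf : SmoothBdd f)
    (hg : SmoothBdd g) (x : E d) (n : ℕ) :
    ∑ I ∈ lists S.idx n, S.barL τ₀ h I ψ x * S.barL τ₀ h I (fun y => f y * g y) x
      = ∑ p ∈ Finset.HasAntidiagonal.antidiagonal n, (n.choose p.1 : ℝ) * S.leib τ₀ h ψ f g x p.1 p.2 := by
  induction n generalizing ψ f g with
  | zero => simp [leib, sum_lists_zero]
  | succ n ih =>
    rw [sum_lists_succ, Finset.sum_antidiagonal_choose_succ_mul]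
    have h1 : ∀ a ∈ S.idx, ∑ I ∈ lists S.idx n, S.barL τ₀ h (a :: I) ψ x *
        S.barL τ₀ h (a :: I) (fun y => f y * g y) x
        = ∑ p ∈ Finset.HasAntidiagonal.antidiagonal n, (n.choose p.1 : ℝ) *
            S.leib τ₀ h (S.bar τ₀ h a ψ) (S.bar τ₀ h a f) (Scheme.T h a g) x p.1 p.2
          + ∑ p ∈ Finset.HasAntidiagonal.antidiagonal n, (n.choose p.1 : ℝ) *
            S.leib τ₀ h (S.bar τ₀ h a ψ) f (S.bar τ₀ h a g) x p.1 p.2 := by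
      intro a _
      rw [← ih (smoothBdd_bar hψ τ₀ h a) (smoothBdd_bar hf τ₀ h a) (smoothBdd_T hg h a),
        ← ih (smoothBdd_bar hψ τ₀ h a) hf (smoothBdd_bar hg τ₀ h a), ← Finset.sum_add_distrib]
      refine Finset.sum_congr rfl fun I _ => ?_
      rw [barL_cons, ← barL_bar hψ, barL_cons, ← barL_bar (hf.mul hg),
        bar_mul (smooth_differentiable hf.1) (smooth_differentiable hg.1),
        barL_add ((smoothBdd_bar hf τ₀ h a).mul (smoothBdd_T hg h a))
          (hf.mul (smoothBdd_bar hg τ₀ h a))]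
      ring
    rw [Finset.sum_congr rfl h1, Finset.sum_add_distrib, Finset.sum_comm, Finset.sum_comm, add_comm]
    congr 1
    · rw [Finset.sum_comm]
      refine Finset.sum_congr rfl fun p _ => ?_
      rw [← Finset.mul_sum, sum_leib_bar_right τ₀ h hψ hg]
    · rw [Finset.sum_comm]
      refine Finset.sum_congr rfl fun p hp => ?_
      rw [← Finset.mul_sum, sum_leib_bar_left τ₀ h hψ hf,
        ← Nat.choose_symm_of_eq_add (Finset.HasAntidiagonal.mem_antidiagonal.1 hp).symm]

end Scheme

end

end EllipticFD

namespace EllipticFD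

noncomputable section

variable {d : ℕ}

namespace Scheme

variable (S : Scheme d)

/-! ### The difference operator -/

theorem L_eq {h : ℝ} (hh : h ≠ 0) (φ : E d → ℝ) (x : E d) :
    S.L h φ x = h⁻¹ * ∑ l ∈ S.Λ₁, S.χ h l x * fdiff h l φ x - S.c x * φ x := by
  have h1 : ∑ l ∈ S.Λ₁, S.χ h l x * fdiff h l φ x
      = ∑ l ∈ S.Λ₁, S.q l x * fdiff h l φ x + h * ∑ l ∈ S.Λ₁, S.p l x * fdiff h l φ x := by
    rw [Finset.mul_sum, ← Finset.sum_add_distrib]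
    exact Finset.sum_congr rfl fun l _ => by simp only [χ]; ring
  rw [h1, L]
  field_simp

theorem fdiff_add (h : ℝ) (l : E d) (φ ψ : E d → ℝ) (x : E d) :
    fdiff h l (fun y => φ y + ψ y) x = fdiff h l φ x + fdiff h l ψ x := by
  simp only [fdiff]; ring

theorem fdiff_const_mul (h : ℝ) (l : E d) (a : ℝ) (φ : E d → ℝ) (x : E d) :
    fdiff h l (fun y => a * φ y) x = a * fdiff h l φ x := by
  simp only [fdiff]; ring

theorem L_add (h : ℝ) (φ ψ : E d → ℝ) (x : E d) :
    S.L h (fun y => φ y + ψ y) x = S.L h φ x + S.L h ψ x := by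
  simp only [L, fdiff_add, mul_add, Finset.sum_add_distrib]
  ring

theorem L_const_mul (h : ℝ) (a : ℝ) (φ : E d → ℝ) (x : E d) :
    S.L h (fun y => a * φ y) x = a * S.L h φ x := by
  simp only [L, fdiff_const_mul, mul_left_comm _ a, ← Finset.mul_sum]
  ring

theorem L_sub (h : ℝ) (φ ψ : E d → ℝ) (x : E d) :
    S.L h (fun y => φ y - ψ y) x = S.L h φ x - S.L h ψ x := by
  have := S.L_add h φ (fun y => (-1) * ψ y) x
  rw [L_const_mul] at this
  simp only [sub_eq_add_neg]
  simpa using this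

theorem L_zero (h : ℝ) (x : E d) : S.L h (fun _ => 0) x = 0 := by
  simp [L, fdiff]

theorem L_sum {κ : Type*} (s : Finset κ) (h : ℝ) (φ : κ → E d → ℝ) (x : E d) :
    S.L h (fun y => ∑ i ∈ s, φ i y) x = ∑ i ∈ s, S.L h (φ i) x := by
  classical
  induction s using Finset.induction_on with
  | empty => simpa using S.L_zero h x
  | insert i s hi ih => simp only [Finset.sum_insert hi]; rw [L_add, ih]

theorem L_sq {h : ℝ} (hh : h ≠ 0) (φ : E d → ℝ) (x : E d) :
    S.L h (fun y => φ y ^ 2) x = 2 * (φ x * S.L h φ x) + S.𝒬 h φ x + S.c x * φ x ^ 2 := by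
  rw [L_eq S hh, L_eq S hh]
  have : ∀ l ∈ S.Λ₁, h⁻¹ * (S.χ h l x * fdiff h l (fun y => φ y ^ 2) x)
      = 2 * φ x * (h⁻¹ * (S.χ h l x * fdiff h l φ x)) + S.χ h l x * fdiff h l φ x ^ 2 := by
    intro l _
    simp only [fdiff]
    ring
  rw [Finset.mul_sum, Finset.sum_congr rfl this, Finset.sum_add_distrib, ← Finset.mul_sum,
    ← Finset.mul_sum]
  simp only [𝒬]
  ring

/-! ### The maximum principle -/

/-- Ellipticity of the scheme with step `h`. -/
structure Elliptic (c₀ h : ℝ) : Prop where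
  h_pos : 0 < h
  χ_nonneg : ∀ l ∈ S.Λ₁, ∀ x, 0 ≤ S.χ h l x
  χ_bdd : ∃ C, ∀ x, ∑ l ∈ S.Λ₁, S.χ h l x ≤ C
  c₀_pos : 0 < c₀
  le_c : ∀ x, c₀ ≤ S.c x

variable {S}

theorem Elliptic.exists_near_sup {c₀ h : ℝ} (hS : S.Elliptic c₀ h) {W : E d → ℝ}
    (hW : ∃ C, ∀ x, |W x| ≤ C) {ε : ℝ} (hε : 0 < ε) :
    ∃ x, (∀ y, W y ≤ W x + ε) ∧ S.L h W x + S.c x * W x ≤ ε := by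
  obtain ⟨C, hC⟩ := hW
  obtain ⟨D, hD⟩ := hS.χ_bdd
  have hh := hS.h_pos
  have hD0 : 0 ≤ D := (Finset.sum_nonneg fun l hl => hS.χ_nonneg l hl 0).trans (hD 0)
  have hb : BddAbove (range W) := ⟨C, by rintro _ ⟨x, rfl⟩; exact (abs_le.1 (hC x)).2⟩
  set e := min ε (ε * h ^ 2 / (D + 1)) with he
  have he0 : 0 < e := lt_min hε (by positivity)
  obtain ⟨_, ⟨x, rfl⟩, hx⟩ := exists_lt_of_lt_csSup (range_nonempty W)
    (sub_lt_self (sSup (range W)) he0)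
  have hle : ∀ y, W y ≤ W x + e := fun y => by
    have := le_csSup hb (mem_range_self y)
    linarith
  refine ⟨x, fun y => (hle y).trans (by gcongr; exact min_le_left _ _), ?_⟩
  rw [L_eq S hh.ne']
  have h1 : ∑ l ∈ S.Λ₁, S.χ h l x * fdiff h l W x ≤ ∑ l ∈ S.Λ₁, S.χ h l x * (h⁻¹ * e) := by
    refine Finset.sum_le_sum fun l hl => mul_le_mul_of_nonneg_left ?_ (hS.χ_nonneg l hl x)
    simp only [fdiff]
    have := hle (x + h • l)
    gcongr
    linarith
  rw [← Finset.sum_mul] at h1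
  have h2 : (∑ l ∈ S.Λ₁, S.χ h l x) * (h⁻¹ * e) ≤ D * (h⁻¹ * e) := by
    have := hD x
    gcongr
  have h3 : h⁻¹ * (D * (h⁻¹ * e)) ≤ ε := by
    have : e ≤ ε * h ^ 2 / (D + 1) := min_le_right _ _
    rw [le_div_iff₀ (by positivity)] at this
    have h4 : h⁻¹ * (D * (h⁻¹ * e)) = D * e / h ^ 2 := by field_simp
    rw [h4, div_le_iff₀ (by positivity)]
    nlinarith
  have h5 : h⁻¹ * ∑ l ∈ S.Λ₁, S.χ h l x * fdiff h l W x ≤ h⁻¹ * (D * (h⁻¹ * e)) := by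
    gcongr
    exact h1.trans h2
  linarith

theorem Elliptic.le_of_neg_L_le {c₀ h : ℝ} (hS : S.Elliptic c₀ h) {w : E d → ℝ}
    (hw : ∃ C, ∀ x, |w x| ≤ C) {B : ℝ} (hB : 0 ≤ B) (hL : ∀ x, -B ≤ S.L h w x) (y : E d) :
    w y ≤ B / c₀ := by
  refine le_of_forall_pos_le_add fun ε hε => ?_
  have hc := hS.c₀_pos
  set e := ε * c₀ / (1 + c₀) with he
  have he0 : 0 < e := by positivity
  obtain ⟨x, hx, hx2⟩ := hS.exists_near_sup hw he0
  have h1 := hL x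
  have h2 := hx y
  have h3 := hS.le_c x
  have h4 : w x ≤ (B + e) / c₀ := by
    rw [le_div_iff₀ hc]
    rcases le_or_gt (w x) 0 with h | h
    · nlinarith
    · nlinarith
  have h5 : (B + e) / c₀ + e = B / c₀ + ε := by
    rw [he]; field_simp; ring
  linarith

theorem Elliptic.abs_le_of_L {c₀ h : ℝ} (hS : S.Elliptic c₀ h) {w : E d → ℝ}
    (hw : ∃ C, ∀ x, |w x| ≤ C) {B : ℝ} (hL : ∀ x, |S.L h w x| ≤ B) (y : E d) :
    |w y| ≤ B / c₀ := by
  have hB : 0 ≤ B := (abs_nonneg _).trans (hL 0)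
  refine abs_le.2 ⟨?_, hS.le_of_neg_L_le hw hB (fun x => (abs_le.1 (hL x)).1) y⟩
  have := hS.le_of_neg_L_le (w := fun y => (-1) * w y) (by simpa using hw) hB (fun x => by
    rw [L_const_mul]
    have := (abs_le.1 (hL x)).2
    linarith) y
  linarith

theorem Elliptic.unique {c₀ h : ℝ} (hS : S.Elliptic c₀ h) {f v w : E d → ℝ}
    (hv : S.IsDiscreteSol h f v) (hw : S.IsDiscreteSol h f w) : w = v := by
  funext y
  obtain ⟨⟨C, hC⟩, hv⟩ := hv
  obtain ⟨⟨D, hD⟩, hw⟩ := hw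
  have := hS.abs_le_of_L (w := fun y => w y - v y)
    ⟨D + C, fun x => (abs_sub _ _).trans (add_le_add (hD x) (hC x))⟩ (B := 0) (fun x => by
      rw [L_sub]
      have h1 := hv x
      have h2 := hw x
      rw [show S.L h w x - S.L h v x = 0 by linarith]
      simp) y
  have := abs_nonpos_iff.1 (this.trans (by simp))
  linarith

/-! ### Smooth solutions of the difference equation -/

theorem smoothBdd_L {h : ℝ} (hq : ∀ l ∈ S.Λ₁, SmoothBdd (S.q l))
    (hp : ∀ l ∈ S.Λ₁, SmoothBdd (S.p l)) (hc : SmoothBdd S.c) {φ : E d → ℝ} (hφ : SmoothBdd φ) :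
    SmoothBdd (S.L h φ) :=
  (((SmoothBdd.sum S.Λ₁ fun l hl => (hq l hl).mul (hφ.fdiff h l)).const_mul h⁻¹).add
    (SmoothBdd.sum S.Λ₁ fun l hl => (hp l hl).mul (hφ.fdiff h l))).sub (hc.mul hφ)

theorem norm_iteratedFDeriv_mul_le_sup {n : ℕ} {A B : ℕ → ℝ} {a w : E d → ℝ}
    (ha : ContDiff ℝ ∞ a) (hw : ContDiff ℝ ∞ w) (hA : ∀ j, Bd j (A j) a)
    (hB : ∀ j ≤ n, Bd j (B j) w) (x : E d) :
    ‖iteratedFDeriv ℝ n (fun y => a y * w y) x‖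
      ≤ |a x| * B n + ∑ i ∈ Finset.range n, (n.choose (i + 1) : ℝ) * A (i + 1) * B (n - (i + 1)) := by
  refine (norm_iteratedFDeriv_mul_le ha hw x (n := n) (by exact_mod_cast le_top)).trans ?_
  rw [Finset.sum_range_succ', add_comm (|a x| * B n)]
  refine add_le_add (Finset.sum_le_sum fun i _ => ?_) ?_
  rotate_left
  · have := hB n le_rfl x
    simp only [Nat.choose_zero_right, Nat.cast_one, one_mul, norm_iteratedFDeriv_zero, Nat.sub_zero,
      Real.norm_eq_abs]
    gcongr
  · have h0 := hA (i + 1)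
    have := h0 x
    have := h0.nonneg
    have := hB (n - (i + 1)) (Nat.sub_le _ _) x
    gcongr

theorem exists_smooth_solution {c₀ h : ℝ} (hS : S.Elliptic c₀ h)
    (hq : ∀ l ∈ S.Λ₁, SmoothBdd (S.q l)) (hp : ∀ l ∈ S.Λ₁, SmoothBdd (S.p l))
    (hc : SmoothBdd S.c) {f : E d → ℝ} (hf : SmoothBdd f) :
    ∃ u, SmoothBdd u ∧ ∀ x, S.L h u x + f x = 0 := by
  have hh := hS.h_pos
  have hc₀ := hS.c₀_pos
  have hχ : ∀ l ∈ S.Λ₁, SmoothBdd (S.χ h l) := fun l hl => (hq l hl).add ((hp l hl).const_mul h)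
  obtain ⟨D, hD⟩ := hS.χ_bdd
  have hD0 : 0 ≤ D := (Finset.sum_nonneg fun l hl => hS.χ_nonneg l hl 0).trans (hD 0)
  obtain ⟨G, hG⟩ := hc.bdd
  have hG0 : 0 ≤ G := (abs_nonneg _).trans (hG 0)
  set κ := (h⁻¹ * (h⁻¹ * D) + G + 1)⁻¹ with hκ
  have hκ0 : 0 < κ := by positivity
  have hκ1 : κ * (h⁻¹ * (h⁻¹ * D) + G) ≤ 1 := by
    rw [hκ, inv_mul_le_iff₀ (by positivity)]
    linarith
  set P : (E d → ℝ) → E d → ℝ := fun w x => w x + κ * S.L h w x with hP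
  set a₀ : E d → ℝ := fun x => 1 - κ * (h⁻¹ * (h⁻¹ * ∑ l ∈ S.Λ₁, S.χ h l x) + S.c x) with ha₀
  set a : E d → E d → ℝ := fun l x => κ * (h⁻¹ * h⁻¹) * S.χ h l x with ha
  have hone : SmoothBdd (fun _ : E d => (1 : ℝ)) := ⟨contDiff_const, fun n => by
    rcases n with _ | n
    · exact ⟨1, bd_zero_iff.2 fun x => by simp⟩
    · exact ⟨0, fun x => by rw [iteratedFDeriv_const_of_ne (by simp)]; simp⟩⟩
  have ha₀s : SmoothBdd a₀ :=
    hone.sub ((((SmoothBdd.sum S.Λ₁ hχ).const_mul _).const_mul _).add hc |>.const_mul κ)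
  have has : ∀ l ∈ S.Λ₁, SmoothBdd (a l) := fun l hl => (hχ l hl).const_mul _
  have hPeq : ∀ w, P w = fun x => a₀ x * w x + ∑ l ∈ S.Λ₁, a l x * w (x + h • l) := by
    intro w
    funext x
    simp only [hP, L_eq S hh.ne', ha₀, ha, fdiff]
    have h1 : ∑ l ∈ S.Λ₁, S.χ h l x * (h⁻¹ * (w (x + h • l) - w x))
        = h⁻¹ * ∑ l ∈ S.Λ₁, S.χ h l x * w (x + h • l) - h⁻¹ * (∑ l ∈ S.Λ₁, S.χ h l x) * w x := by
      rw [Finset.mul_sum, Finset.mul_sum, Finset.sum_mul, ← Finset.sum_sub_distrib]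
      exact Finset.sum_congr rfl fun l _ => by ring
    have h2 : ∑ l ∈ S.Λ₁, κ * (h⁻¹ * h⁻¹) * S.χ h l x * w (x + h • l)
        = κ * (h⁻¹ * h⁻¹) * ∑ l ∈ S.Λ₁, S.χ h l x * w (x + h • l) := by
      rw [Finset.mul_sum]
      exact Finset.sum_congr rfl fun l _ => by ring
    rw [h1, h2]
    ring
  have ha₀n : ∀ x, 0 ≤ a₀ x := fun x => by
    have h1 : κ * (h⁻¹ * (h⁻¹ * ∑ l ∈ S.Λ₁, S.χ h l x) + S.c x)
        ≤ κ * (h⁻¹ * (h⁻¹ * D) + G) := by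
      have := hD x
      have := (abs_le.1 (hG x)).2
      gcongr
    simp only [ha₀]
    linarith
  have han : ∀ l ∈ S.Λ₁, ∀ x, 0 ≤ a l x := fun l hl x => by
    have := hS.χ_nonneg l hl x
    simp only [ha]
    positivity
  have hasum : ∀ x, a₀ x + ∑ l ∈ S.Λ₁, a l x ≤ 1 - κ * c₀ := fun x => by
    have h1 : ∑ l ∈ S.Λ₁, a l x = κ * (h⁻¹ * h⁻¹) * ∑ l ∈ S.Λ₁, S.χ h l x := by
      rw [Finset.mul_sum]
    have h2 : κ * c₀ ≤ κ * S.c x := by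
      have := hS.le_c x
      gcongr
    rw [h1]
    simp only [ha₀]
    linarith
  set θ := 1 - κ * c₀ with hθ
  set η := 1 - κ * c₀ / 2 with hη
  have hκc : 0 < κ * c₀ := by positivity
  have hθη : θ < η := by rw [hθ, hη]; linarith
  have hθ0 : 0 ≤ θ := by
    refine le_trans ?_ (hasum 0)
    exact add_nonneg (ha₀n 0) (Finset.sum_nonneg fun l hl => han l hl 0)
  have hη0 : 0 < η := hθ0.trans_lt hθη
  have hη1 : η < 1 := by rw [hη]; linarith
  have hPs : ∀ w, SmoothBdd w → SmoothBdd (P w) := fun w hw =>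
    hw.add ((smoothBdd_L hq hp hc hw).const_mul κ)
  set w : ℕ → E d → ℝ := fun k => P^[k] f with hw
  have hws : ∀ k, SmoothBdd (w k) := fun k => by
    induction k with
    | zero => exact hf
    | succ k ih =>
      change SmoothBdd (P^[k + 1] f)
      rw [Function.iterate_succ_apply']
      exact hPs _ ih
  have hwsucc : ∀ k, w (k + 1) = P (w k) := fun k =>
    Function.iterate_succ_apply' P k f
  have hAex : ∃ A : ℕ → ℝ, (∀ j, Bd j (A j) a₀) ∧ ∀ l ∈ S.Λ₁, ∀ j, Bd j (A j) (a l) := by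
    choose A₀ hA₀ using ha₀s.bd
    have : ∀ l, ∀ j, ∃ B, l ∈ S.Λ₁ → Bd j B (a l) := fun l j => by
      by_cases hl : l ∈ S.Λ₁
      · exact ((has l hl).bd j).imp fun B hB _ => hB
      · exact ⟨0, fun h => absurd h hl⟩
    choose A₁ hA₁ using this
    refine ⟨fun j => |A₀ j| + ∑ l ∈ S.Λ₁, |A₁ l j|, fun j => (hA₀ j).mono ?_, fun l hl j =>
      (hA₁ l j hl).mono ?_⟩
    · exact (le_abs_self _).trans (le_add_of_nonneg_right (Finset.sum_nonneg fun _ _ => abs_nonneg _))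
    · refine (le_abs_self _).trans ?_
      have := Finset.single_le_sum (f := fun l => |A₁ l j|) (fun _ _ => abs_nonneg _) hl
      have h2 := abs_nonneg (A₀ j)
      linarith
  obtain ⟨A, hA₀, hA⟩ := hAex
  have hstep : ∀ (n : ℕ) (B : ℕ → ℝ) (φ : E d → ℝ), SmoothBdd φ → (∀ j ≤ n, Bd j (B j) φ) →
      Bd n (θ * B n + (S.Λ₁.card + 1) * ∑ i ∈ Finset.range n,
        (n.choose (i + 1) : ℝ) * A (i + 1) * B (n - (i + 1))) (P φ) := by
    intro n B φ hφ hB x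
    rw [hPeq]
    have hsm : ∀ l ∈ S.Λ₁, SmoothBdd (fun x => a l x * φ (x + h • l)) :=
      fun l hl => (has l hl).mul (hφ.shift _)
    have e1 : iteratedFDeriv ℝ n (fun x => a₀ x * φ x + ∑ l ∈ S.Λ₁, a l x * φ (x + h • l)) x
        = iteratedFDeriv ℝ n (fun x => a₀ x * φ x) x
          + ∑ l ∈ S.Λ₁, iteratedFDeriv ℝ n (fun x => a l x * φ (x + h • l)) x := by
      rw [← iteratedFDeriv_fun_sum_apply fun l hl => (smooth_at (hsm l hl).1 n).contDiffAt]
      exact iteratedFDeriv_add_apply (smooth_at (ha₀s.mul hφ).1 n).contDiffAt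
        (smooth_at (SmoothBdd.sum S.Λ₁ hsm).1 n).contDiffAt
    rw [e1]
    set R := ∑ i ∈ Finset.range n, (n.choose (i + 1) : ℝ) * A (i + 1) * B (n - (i + 1)) with hR
    have b1 := norm_iteratedFDeriv_mul_le_sup ha₀s.1 hφ.1 hA₀ hB x
    have b2 : ∀ l ∈ S.Λ₁, ‖iteratedFDeriv ℝ n (fun x => a l x * φ (x + h • l)) x‖
        ≤ a l x * B n + R := fun l hl => by
      have := norm_iteratedFDeriv_mul_le_sup (has l hl).1 (smooth_shift hφ.1 (h • l)) (hA l hl)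
        (fun j hj => (hB j hj).shift _) x
      rwa [abs_of_nonneg (han l hl x)] at this
    rw [abs_of_nonneg (ha₀n x)] at b1
    refine (norm_add_le _ _).trans ((add_le_add b1 ((norm_sum_le _ _).trans
      (Finset.sum_le_sum b2))).trans ?_)
    rw [Finset.sum_add_distrib, ← Finset.sum_mul, Finset.sum_const, nsmul_eq_mul]
    have := mul_le_mul_of_nonneg_right (hasum x) (hB n le_rfl).nonneg
    nlinarith
  have hdecay : ∀ n, ∃ C, ∀ k, Bd n (C * η ^ k) (w k) := by
    intro n
    induction n using Nat.strong_induction_on with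
    | _ n ih =>
      have : ∀ j, ∃ C, j < n → ∀ k, Bd j (C * η ^ k) (w k) := fun j => by
        by_cases hj : j < n
        · exact (ih j hj).imp fun C hC _ => hC
        · exact ⟨0, fun h => absurd h hj⟩
      choose C hC using this
      obtain ⟨B₀, hB₀⟩ := (hws 0).bd n
      set R := (S.Λ₁.card + 1) * ∑ i ∈ Finset.range n,
        (n.choose (i + 1) : ℝ) * A (i + 1) * C (n - (i + 1)) with hR
      refine ⟨max B₀ (R / (η - θ)), fun k => ?_⟩
      set Cn := max B₀ (R / (η - θ)) with hCn
      have hRC : R ≤ Cn * (η - θ) := by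
        rw [← div_le_iff₀ (by linarith)]
        exact le_max_right _ _
      induction k with
      | zero => simpa using hB₀.mono (le_max_left _ _)
      | succ k ihk =>
        rw [hwsucc]
        have := hstep n (fun j => if j < n then C j * η ^ k else Cn * η ^ k) (w k) (hws k)
          (fun j hj => by
            by_cases hjn : j < n
            · simp only [hjn, if_true]; exact hC j hjn k
            · obtain rfl : j = n := by omega
              simp only [hjn, if_false]
              exact ihk)
        refine this.mono ?_
        have e2 : ∑ i ∈ Finset.range n, (n.choose (i + 1) : ℝ) * A (i + 1) *
            (if n - (i + 1) < n then C (n - (i + 1)) * η ^ k else Cn * η ^ k)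
            = (∑ i ∈ Finset.range n, (n.choose (i + 1) : ℝ) * A (i + 1) * C (n - (i + 1)))
              * η ^ k := by
          rw [Finset.sum_mul]
          refine Finset.sum_congr rfl fun i hi => ?_
          have := Finset.mem_range.1 hi
          rw [if_pos (by omega)]
          ring
        simp only [lt_irrefl, if_false]
        rw [e2, ← mul_assoc ((S.Λ₁.card : ℝ) + 1), ← hR, pow_succ]
        have hηk : 0 ≤ η ^ k := by positivity
        nlinarith [mul_le_mul_of_nonneg_right hRC hηk]
  choose C hC using hdecay
  have hsumm : ∀ n, Summable fun k => C n * η ^ k := fun n =>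
    (summable_geometric_of_lt_one hη0.le hη1).mul_left _
  have hbd : ∀ (n k : ℕ) (x : E d), ‖iteratedFDeriv ℝ n (w k) x‖ ≤ C n * η ^ k :=
    fun n k => hC n k
  set v : E d → ℝ := fun x => ∑' k, w k x with hv
  have hvs : SmoothBdd v := by
    refine ⟨contDiff_tsum (fun k => (hws k).1) (fun n _ => hsumm n) (fun n k x _ => hbd n k x),
      fun n => ⟨∑' k, C n * η ^ k, fun x => ?_⟩⟩
    have h1 := iteratedFDeriv_tsum_apply (𝕜 := ℝ) (N := ⊤) (f := w) (fun k => (hws k).1)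
      (fun n _ => hsumm n) (fun n k x _ => hbd n k x) (k := n) le_top x
    have h2 : iteratedFDeriv ℝ n v x = _ := h1
    rw [h2]
    exact tsum_of_norm_bounded (hsumm n).hasSum fun k => hbd n k x
  have hsum : ∀ x, HasSum (fun k => w k x) (v x) := fun x =>
    (Summable.of_norm_bounded (hsumm 0) fun k => by
      have := (hC 0 k).abs_le x
      rwa [Real.norm_eq_abs]).hasSum
  refine ⟨fun x => κ * v x, hvs.const_mul κ, fun x => ?_⟩
  have hL : HasSum (fun k => S.L h (w k) x) (S.L h v x) := by
    have hfd : ∀ l, HasSum (fun k => fdiff h l (w k) x) (fdiff h l v x) := fun l =>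
      ((hsum _).sub (hsum x)).mul_left h⁻¹
    exact (((hasSum_sum fun l _ => (hfd l).mul_left (S.q l x)).mul_left h⁻¹).add
      (hasSum_sum fun l _ => (hfd l).mul_left (S.p l x))).sub ((hsum x).mul_left (S.c x))
  have h1 : HasSum (fun k => w (k + 1) x) (v x + κ * S.L h v x) := by
    have := (hsum x).add (hL.mul_left κ)
    simpa only [hwsucc] using this
  have h2 : HasSum (fun k => w (k + 1) x) (v x - w 0 x) := by
    have := (hasSum_nat_add_iff (f := fun k => w k x) (g := v x - w 0 x) 1).2 (by simpa using hsum x)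
    exact this
  have h3 := h1.unique h2
  rw [L_const_mul]
  have h4 : w 0 x = f x := rfl
  linarith

end Scheme

end

end EllipticFD

namespace EllipticFD

noncomputable section

variable {d : ℕ}

/-! ### Taylor's formula along a direction -/

theorem taylor_dirD {φ : E d → ℝ} (hφ : SmoothBdd φ) (l x : E d) (r : ℕ) {B : ℝ} (hB : Bd r B φ)
    {t : ℝ} (ht : 0 ≤ t) :
    |φ (x + t • l) - ∑ s ∈ Finset.range r, t ^ s / (s.factorial : ℝ) * (dirD l)^[s] φ x|
      ≤ t ^ r * (‖l‖ ^ r * B) := by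
  induction r generalizing φ B t with
  | zero => simpa using hB.abs_le (x + t • l)
  | succ r ih =>
    have hφd := smooth_differentiable hφ.1
    set g : ℝ → ℝ := fun t => φ (x + t • l)
      - ∑ s ∈ Finset.range (r + 1), t ^ s / (s.factorial : ℝ) * (dirD l)^[s] φ x with hg
    set g' : ℝ → ℝ := fun t => dirD l φ (x + t • l)
      - ∑ s ∈ Finset.range r, t ^ s / (s.factorial : ℝ) * (dirD l)^[s] (dirD l φ) x with hg'
    have hder : ∀ t, HasDerivAt g (g' t) t := by
      intro t
      have h1 : HasDerivAt (fun t : ℝ => φ (x + t • l)) (dirD l φ (x + t • l)) t := by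
        have hl : HasDerivAt (fun t : ℝ => x + t • l) l t := by
          simpa using ((hasDerivAt_id t).smul_const l).const_add x
        exact (hφd _).hasFDerivAt.comp_hasDerivAt t hl
      have h2 : HasDerivAt (fun t : ℝ => ∑ s ∈ Finset.range (r + 1),
          t ^ s / (s.factorial : ℝ) * (dirD l)^[s] φ x)
          (∑ s ∈ Finset.range r, t ^ s / (s.factorial : ℝ) * (dirD l)^[s] (dirD l φ) x) t := by
        have h3 : HasDerivAt (fun t : ℝ => ∑ s ∈ Finset.range (r + 1),
          t ^ s / (s.factorial : ℝ) * (dirD l)^[s] φ x)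
          (∑ s ∈ Finset.range (r + 1),
            ((s : ℝ) * t ^ (s - 1)) / (s.factorial : ℝ) * (dirD l)^[s] φ x) t := by
          refine HasDerivAt.fun_sum fun s _ => ?_
          exact ((hasDerivAt_pow s t).div_const _).mul_const _
        convert h3 using 1
        rw [Finset.sum_range_succ']
        simp only [Nat.cast_zero, zero_mul, zero_div, add_zero, Nat.add_sub_cancel]
        refine Finset.sum_congr rfl fun s _ => ?_
        rw [Nat.factorial_succ, Function.iterate_succ_apply]
        push_cast
        have : (s.factorial : ℝ) ≠ 0 := by positivity
        have : (s : ℝ) + 1 ≠ 0 := by positivity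
        field_simp
      exact h1.sub h2
    have hg0 : g 0 = 0 := by
      simp only [hg]
      rw [Finset.sum_range_succ']
      simp
    have hbd : ∀ s ∈ Icc (0 : ℝ) t, |g' s| ≤ t ^ r * (‖l‖ ^ (r + 1) * B) := by
      intro s hs
      have h1 := ih (hφ.dirD l) (hB.dirD hφ.1 l) hs.1
      refine h1.trans ?_
      have : s ^ r ≤ t ^ r := pow_le_pow_left₀ hs.1 hs.2 r
      rw [← mul_assoc (‖l‖ ^ r), ← pow_succ]
      have := hB.nonneg
      gcongr
    have := Convex.norm_image_sub_le_of_norm_hasDerivWithin_le (f := g) (f' := g')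
      (s := Icc (0 : ℝ) t) (C := t ^ r * (‖l‖ ^ (r + 1) * B)) (x := 0) (y := t)
      (fun s _ => (hder s).hasDerivWithinAt) (fun s hs => by
        rw [Real.norm_eq_abs]; exact hbd s hs) (convex_Icc _ _)
      (left_mem_Icc.2 ht) (right_mem_Icc.2 ht)
    rw [hg0, sub_zero, sub_zero, Real.norm_eq_abs, Real.norm_eq_abs, abs_of_nonneg ht] at this
    refine this.trans (le_of_eq ?_)
    ring

theorem abs_fdiff_sub_dirD_le {φ : E d → ℝ} (hφ : SmoothBdd φ) (l x : E d) {B : ℝ} (hB : Bd 2 B φ)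
    {h : ℝ} (hh : 0 < h) : |h⁻¹ * (fdiff h l φ x - dirD l φ x)| ≤ ‖l‖ ^ 2 * B := by
  have h1 := taylor_dirD hφ l x 2 hB hh.le
  simp only [Finset.sum_range_succ, Finset.sum_range_zero, pow_zero, Nat.factorial, Nat.cast_one,
    div_one, one_mul, Function.iterate_zero, id_eq, pow_one, zero_add, mul_one,
    Function.iterate_one] at h1
  have h2 : h⁻¹ * (fdiff h l φ x - dirD l φ x)
      = (h ^ 2)⁻¹ * (φ (x + h • l) - (φ x + h * dirD l φ x)) := by
    simp only [fdiff]
    field_simp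
    ring
  rw [h2, abs_mul, abs_of_pos (by positivity : (0 : ℝ) < (h ^ 2)⁻¹), inv_mul_le_iff₀ (by positivity)]
  exact h1

theorem bd_of_barL_le {S : Scheme d} {n : ℕ} {τ₀ h Q : ℝ} (hτ₀ : 0 < τ₀) {u : E d → ℝ}
    (hu : SmoothBdd u) (hQ : ∀ I ∈ lists S.idx n, ∀ x, |S.barL τ₀ h I u x| ≤ Q) :
    Bd n ((d / τ₀) ^ n * Q) u := by
  induction n generalizing u Q with
  | zero => 
    refine bd_zero_iff.2 fun x => ?_
    simpa using hQ [] (by simp [lists]) x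
  | succ n ih =>
    have := bd_succ_of_partialD hu.1 (n := n) (B := (d / τ₀) ^ n * (Q / τ₀)) fun i => by
      refine ih (hu.partialD i) fun I hI x => ?_
      have h1 := hQ (.inr i :: I) (mem_lists_succ.2 ⟨_, by simp [Scheme.idx], I, hI, rfl⟩) x
      rw [Scheme.barL_cons, ← Scheme.barL_bar hu] at h1
      have h2 : S.bar τ₀ h (.inr i) u = fun x => τ₀ * partialD i u x := rfl
      rw [h2, Scheme.barL_const_mul (hu.partialD i), abs_mul, abs_of_pos hτ₀] at h1
      rwa [le_div_iff₀ hτ₀, mul_comm]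
    refine this.mono (le_of_eq ?_)
    rw [pow_succ]
    field_simp

namespace Scheme

/-- The assumptions on a smooth scheme with step `h`, with the structural conditions stated for
finite families of functions and with suprema instead of the operators of class `𝔎`. -/
structure Smooth (S : Scheme d) (m : ℕ) (δ c₀ τ₀ K a b M h : ℝ) : Prop where
  ell : S.Elliptic c₀ h
  size_eq : S.size = a
  wsize_eq : S.wsize = b
  q_smooth : ∀ l ∈ S.Λ₁, SmoothBdd (S.q l)
  p_smooth : ∀ l ∈ S.Λ₁, SmoothBdd (S.p l)
  c_smooth : SmoothBdd S.c
  q_bd : ∀ k ≤ m, ∀ l ∈ S.Λ₁, Bd k M (S.q l)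
  p_bd : ∀ k ≤ m, ∀ β : E d → ℝ,
    Bd k (M * Real.sqrt (∑ l ∈ S.Λ₁, β l ^ 2)) (fun x => ∑ l ∈ S.Λ₁, β l * S.p l x)
  c_bd : ∀ k ≤ m, Bd k M S.c
  balanced : S.Balanced
  structural₁ : ∀ φ, SmoothBdd φ → ∀ B, (∀ y, S.sqBar τ₀ h φ y ≤ B) → ∀ x,
    (m : ℝ) * S.A τ₀ h φ x ≤
      (1 - δ) * ∑ μ ∈ S.idx, S.𝒬 h (S.bar τ₀ h μ φ) x + K * S.𝒬 h φ x
        + 2 * (1 - δ) * S.c x * B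
  structural₂ : ∀ n : ℕ, 1 ≤ n → n ≤ m → ∀ (s : Finset (List (E d ⊕ Fin d)))
    (φ : List (E d ⊕ Fin d) → E d → ℝ), (∀ i ∈ s, SmoothBdd (φ i)) → ∀ B₁ B₂,
    (∀ y, ∑ i ∈ s, S.sqBar τ₀ h (φ i) y ≤ B₁) → (∀ y, ∑ i ∈ s, S.sqBar₂ τ₀ h (φ i) y ≤ B₂) →
    ∀ x, ∑ i ∈ s, ((n : ℝ) * ∑ ν ∈ S.idx, S.A τ₀ h (S.bar τ₀ h ν (φ i)) x
          + (n : ℝ) * ((n : ℝ) - 1) * ∑ μ ∈ S.idx, ∑ ν ∈ S.idx,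
              S.bar τ₀ h μ (S.bar τ₀ h ν (φ i)) x *
                S.Qμ h (fun ψ => S.bar τ₀ h μ (S.bar τ₀ h ν ψ)) (T h μ (T h ν (φ i))) x) ≤
        ∑ i ∈ s, ((1 - δ) * ∑ μ ∈ S.idx, ∑ ν ∈ S.idx,
            S.𝒬 h (S.bar τ₀ h μ (S.bar τ₀ h ν (φ i))) x
          + K * ∑ μ ∈ S.idx, S.𝒬 h (S.bar τ₀ h μ (φ i)) x)
          + 2 * (1 - δ) * S.c x * B₂ + K * B₁

variable {S : Scheme d} {m : ℕ} {δ c₀ τ₀ K a b M h : ℝ}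

theorem Smooth.M_nonneg (hS : S.Smooth m δ c₀ τ₀ K a b M h) : 0 ≤ M :=
  (hS.c_bd 0 (Nat.zero_le _)).nonneg

theorem Smooth.a_nonneg (hS : S.Smooth m δ c₀ τ₀ K a b M h) : 0 ≤ a := by
  rw [← hS.size_eq]; exact Real.sqrt_nonneg _

theorem Smooth.sum_norm_sq (hS : S.Smooth m δ c₀ τ₀ K a b M h) :
    ∑ l ∈ S.Λ₁, ‖l‖ ^ 2 = a ^ 2 := by
  rw [← hS.size_eq, size, Real.sq_sqrt (Finset.sum_nonneg fun _ _ => by positivity)]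

theorem Smooth.abs_Qμ_le (hS : S.Smooth m δ c₀ τ₀ K a b M h) {k : ℕ} (hk : k ≤ m)
    {J : List (E d ⊕ Fin d)} (hJ : J ∈ lists S.idx k) {φ : E d → ℝ} (hφ : SmoothBdd φ) {B : ℝ}
    (hB : Bd 2 B φ) (x : E d) :
    |S.Qμ h (S.barL τ₀ h J) φ x| ≤ S.wtL τ₀ J * (M * a ^ 2 * B) := by
  have hh := hS.ell.h_pos
  have h0 : ∑ l ∈ S.Λ₁, S.barL τ₀ h J (S.q l) x * dirD l φ x = 0 := by
    have h1 : (fun y => ∑ l ∈ S.Λ₁, dirD l φ x * S.q l y) = fun _ => 0 := by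
      funext y
      have := congrArg (fderiv ℝ φ x) (hS.balanced y)
      simp only [map_sum, map_smul, smul_eq_mul, map_zero] at this
      rw [← this]
      exact Finset.sum_congr rfl fun l _ => mul_comm _ _
    have h2 := barL_sum (S := S) S.Λ₁ (fun l hl => (hS.q_smooth l hl).const_mul (dirD l φ x)) τ₀ h J
    rw [h1, barL_zero] at h2
    have h3 := congrFun h2 x
    rw [h3]
    refine Finset.sum_congr rfl fun l hl => ?_
    rw [barL_const_mul (hS.q_smooth l hl), mul_comm]
  have h1 : S.Qμ h (S.barL τ₀ h J) φ x
      = ∑ l ∈ S.Λ₁, S.barL τ₀ h J (S.q l) x * (h⁻¹ * (fdiff h l φ x - dirD l φ x)) := by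
    have : ∑ l ∈ S.Λ₁, S.barL τ₀ h J (S.q l) x * (h⁻¹ * (fdiff h l φ x - dirD l φ x))
        = h⁻¹ * ∑ l ∈ S.Λ₁, S.barL τ₀ h J (S.q l) x * fdiff h l φ x
          - h⁻¹ * ∑ l ∈ S.Λ₁, S.barL τ₀ h J (S.q l) x * dirD l φ x := by
      rw [Finset.mul_sum, Finset.mul_sum, ← Finset.sum_sub_distrib]
      exact Finset.sum_congr rfl fun l _ => by ring
    rw [this, h0, mul_zero, sub_zero, Qμ]
  rw [h1]
  refine (Finset.abs_sum_le_sum_abs _ _).trans ?_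
  have h2 : ∀ l ∈ S.Λ₁, |S.barL τ₀ h J (S.q l) x * (h⁻¹ * (fdiff h l φ x - dirD l φ x))|
      ≤ (S.wtL τ₀ J * M) * (‖l‖ ^ 2 * B) := by
    intro l hl
    rw [abs_mul]
    have e1 := (bd_barL (S := S) (n := 0) (hS.q_smooth l hl) (by simpa using hS.q_bd k hk l hl) τ₀ hh
      hJ).abs_le x
    have e2 := abs_fdiff_sub_dirD_le hφ l x hB hh
    exact mul_le_mul e1 e2 (abs_nonneg _) (mul_nonneg (S.wtL_nonneg τ₀ J) hS.M_nonneg)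
  refine (Finset.sum_le_sum h2).trans (le_of_eq ?_)
  rw [← Finset.mul_sum, ← Finset.sum_mul, hS.sum_norm_sq]
  ring

theorem Smooth.abs_sum_p_le (hS : S.Smooth m δ c₀ τ₀ K a b M h) {k : ℕ} (hk : k ≤ m)
    {J : List (E d ⊕ Fin d)} (hJ : J ∈ lists S.idx k) {φ : E d → ℝ} (hφ : SmoothBdd φ) {B : ℝ}
    (hB : Bd 1 B φ) (x : E d) :
    |∑ l ∈ S.Λ₁, S.barL τ₀ h J (S.p l) x * fdiff h l φ x| ≤ S.wtL τ₀ J * (M * a * B) := by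
  have hh := hS.ell.h_pos
  have h1 : ∑ l ∈ S.Λ₁, S.barL τ₀ h J (S.p l) x * fdiff h l φ x
      = S.barL τ₀ h J (fun y => ∑ l ∈ S.Λ₁, fdiff h l φ x * S.p l y) x := by
    rw [barL_sum S.Λ₁ (fun l hl => (hS.p_smooth l hl).const_mul (fdiff h l φ x))]
    refine Finset.sum_congr rfl fun l hl => ?_
    rw [barL_const_mul (hS.p_smooth l hl), mul_comm]
  have h2 := (bd_barL (S := S) (n := 0)
    (SmoothBdd.sum S.Λ₁ fun l hl => (hS.p_smooth l hl).const_mul (fdiff h l φ x))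
    (by simpa using hS.p_bd k hk (fun l => fdiff h l φ x)) τ₀ hh hJ).abs_le x
  rw [h1]
  refine h2.trans (mul_le_mul_of_nonneg_left ?_ (S.wtL_nonneg τ₀ J))
  rw [mul_assoc]
  refine mul_le_mul_of_nonneg_left ?_ hS.M_nonneg
  have hB0 := hB.nonneg
  refine Real.sqrt_le_iff.2 ⟨mul_nonneg hS.a_nonneg hB0, ?_⟩
  rw [mul_pow, ← hS.sum_norm_sq, Finset.sum_mul]
  refine Finset.sum_le_sum fun l _ => ?_
  have := (hB.fdiff hφ.1 hh l).abs_le x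
  rw [← mul_pow, ← sq_abs]
  gcongr

/-- The operator with coefficients `δ̄_J q`, `δ̄_J p`, `δ̄_J c`. -/
def Com (S : Scheme d) (τ₀ h : ℝ) (J : List (E d ⊕ Fin d)) (φ : E d → ℝ) (x : E d) : ℝ :=
  S.L₀μ h (S.barL τ₀ h J) φ x - S.barL τ₀ h J S.c x * φ x

/-- The principal part of `Com`. -/
def Pri (S : Scheme d) (τ₀ h : ℝ) (k : ℕ) (J : List (E d ⊕ Fin d)) (φ : E d → ℝ) (x : E d) : ℝ :=
  if k = 1 then S.L₀μ h (S.barL τ₀ h J) φ x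
  else if k = 2 then S.Qμ h (S.barL τ₀ h J) φ x else 0

theorem Smooth.abs_Com_sub_Pri_le (hS : S.Smooth m δ c₀ τ₀ K a b M h) {k n r : ℕ} (hk0 : 1 ≤ k)
    (hk : k ≤ m) (hkn : k + r = n)
    {J : List (E d ⊕ Fin d)} (hJ : J ∈ lists S.idx k) {φ : E d → ℝ} (hφ : SmoothBdd φ) {B : ℝ}
    (hB : ∀ j, j + r + 1 ≤ n → Bd j B φ) (x : E d) :
    |S.Com τ₀ h J φ x - S.Pri τ₀ h k J φ x| ≤ S.wtL τ₀ J * (M * (a ^ 2 + a + 1) * B) := by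
  have hM := hS.M_nonneg
  have ha := hS.a_nonneg
  have hB0 := (hB 0 (by omega)).nonneg
  have hw := S.wtL_nonneg τ₀ J
  have hc : |S.barL τ₀ h J S.c x * φ x| ≤ S.wtL τ₀ J * (M * B) := by
    rw [abs_mul, ← mul_assoc]
    have e1 := (bd_barL (S := S) (n := 0) hS.c_smooth (by simpa using hS.c_bd k hk) τ₀ hS.ell.h_pos
      hJ).abs_le x
    exact mul_le_mul e1 ((hB 0 (by omega)).abs_le x) (abs_nonneg _) (mul_nonneg hw hM)
  by_cases h1 : k = 1
  · simp only [Com, Pri, h1, if_true]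
    have e : S.L₀μ h (S.barL τ₀ h J) φ x - S.barL τ₀ h J S.c x * φ x
      - S.L₀μ h (S.barL τ₀ h J) φ x = -(S.barL τ₀ h J S.c x * φ x) := by ring
    rw [e, abs_neg]
    refine hc.trans (mul_le_mul_of_nonneg_left ?_ hw)
    have : M * (a ^ 2 + a + 1) * B = M * B + M * B * (a ^ 2 + a) := by ring
    rw [this]
    have : 0 ≤ M * B * (a ^ 2 + a) := by positivity
    linarith
  have hp := hS.abs_sum_p_le hk hJ hφ (hB 1 (by omega)) x
  by_cases h2 : k = 2
  · simp only [Com, Pri, h2, L₀μ]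
    norm_num
    have e : S.Qμ h (S.barL τ₀ h J) φ x + ∑ l ∈ S.Λ₁, S.barL τ₀ h J (S.p l) x * fdiff h l φ x
        - S.barL τ₀ h J S.c x * φ x - S.Qμ h (S.barL τ₀ h J) φ x
        = ∑ l ∈ S.Λ₁, S.barL τ₀ h J (S.p l) x * fdiff h l φ x - S.barL τ₀ h J S.c x * φ x := by ring
    rw [e]
    refine (abs_sub _ _).trans ((add_le_add hp hc).trans ?_)
    rw [← mul_add]
    refine mul_le_mul_of_nonneg_left ?_ hw
    have : M * (a ^ 2 + a + 1) * B = M * a * B + M * B + M * B * a ^ 2 := by ring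
    rw [this]
    have : 0 ≤ M * B * a ^ 2 := by positivity
    linarith
  · simp only [Com, Pri, h1, h2, L₀μ, if_false, sub_zero]
    have hq := hS.abs_Qμ_le hk hJ hφ (hB 2 (by omega)) x
    refine (abs_sub _ _).trans ((add_le_add ((abs_add_le _ _).trans (add_le_add hq hp)) hc).trans
      (le_of_eq ?_))
    ring

/-- Terms of the Leibniz formula for `∑_I (δ̄_I u) δ̄_I (L_h u)`. -/
def comX (S : Scheme d) (τ₀ h : ℝ) (G : List (E d ⊕ Fin d) → (E d → ℝ) → E d → ℝ) (u : E d → ℝ)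
    (x : E d) (k r : ℕ) : ℝ :=
  ∑ J ∈ lists S.idx k, ∑ I ∈ lists S.idx r,
    S.barL τ₀ h J (S.barL τ₀ h I u) x * G J (TL h J (S.barL τ₀ h I u)) x

theorem Smooth.leibniz_L (hS : S.Smooth m δ c₀ τ₀ K a b M h) {u : E d → ℝ} (hu : SmoothBdd u)
    (x : E d) (n : ℕ) :
    ∑ I ∈ lists S.idx n, S.barL τ₀ h I u x * S.barL τ₀ h I (S.L h u) x
      = ∑ k ∈ Finset.range (n + 1), (n.choose k : ℝ) * S.comX τ₀ h (S.Com τ₀ h) u x k (n - k) := by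
  have hqs : ∀ l ∈ S.Λ₁, SmoothBdd fun y => S.q l y * fdiff h l u y :=
    fun l hl => (hS.q_smooth l hl).mul (hu.fdiff h l)
  have hps : ∀ l ∈ S.Λ₁, SmoothBdd fun y => S.p l y * fdiff h l u y :=
    fun l hl => (hS.p_smooth l hl).mul (hu.fdiff h l)
  have hcs : SmoothBdd fun y => S.c y * u y := hS.c_smooth.mul hu
  have h1 : ∀ I, S.barL τ₀ h I (S.L h u) x
      = h⁻¹ * ∑ l ∈ S.Λ₁, S.barL τ₀ h I (fun y => S.q l y * fdiff h l u y) x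
        + ∑ l ∈ S.Λ₁, S.barL τ₀ h I (fun y => S.p l y * fdiff h l u y) x
        - S.barL τ₀ h I (fun y => S.c y * u y) x := by
    intro I
    have e : S.L h u = fun y => (h⁻¹ * ∑ l ∈ S.Λ₁, S.q l y * fdiff h l u y
        + ∑ l ∈ S.Λ₁, S.p l y * fdiff h l u y) + (-1) * (S.c y * u y) := by
      funext y; simp only [L]; ring
    rw [e, barL_add (((SmoothBdd.sum _ hqs).const_mul h⁻¹).add (SmoothBdd.sum _ hps))
      (hcs.const_mul (-1)), barL_add ((SmoothBdd.sum _ hqs).const_mul h⁻¹) (SmoothBdd.sum _ hps),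
      barL_const_mul (SmoothBdd.sum _ hqs), barL_const_mul hcs, barL_sum _ hqs, barL_sum _ hps]
    ring
  have h2 : ∑ I ∈ lists S.idx n, S.barL τ₀ h I u x * S.barL τ₀ h I (S.L h u) x
      = h⁻¹ * ∑ l ∈ S.Λ₁, ∑ I ∈ lists S.idx n, S.barL τ₀ h I u x *
          S.barL τ₀ h I (fun y => S.q l y * fdiff h l u y) x
        + ∑ l ∈ S.Λ₁, ∑ I ∈ lists S.idx n, S.barL τ₀ h I u x *
          S.barL τ₀ h I (fun y => S.p l y * fdiff h l u y) x
        - ∑ I ∈ lists S.idx n, S.barL τ₀ h I u x * S.barL τ₀ h I (fun y => S.c y * u y) x := by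
    rw [Finset.sum_comm, Finset.mul_sum, Finset.sum_comm (s := S.Λ₁), ← Finset.sum_add_distrib,
      ← Finset.sum_sub_distrib]
    refine Finset.sum_congr rfl fun I _ => ?_
    rw [h1, ← Finset.mul_sum, ← Finset.mul_sum]
    ring
  rw [h2, Finset.sum_congr rfl fun l hl => leibniz τ₀ h hu (hS.q_smooth l hl) (hu.fdiff h l) x n,
    Finset.sum_congr rfl fun l hl => leibniz τ₀ h hu (hS.p_smooth l hl) (hu.fdiff h l) x n,
    leibniz τ₀ h hu hS.c_smooth hu x n, Finset.sum_comm, Finset.mul_sum,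
    Finset.sum_comm (s := S.Λ₁), ← Finset.sum_add_distrib, ← Finset.sum_sub_distrib,
    ← Finset.Nat.sum_antidiagonal_eq_sum_range_succ
      (fun k r => (n.choose k : ℝ) * S.comX τ₀ h (S.Com τ₀ h) u x k r)]
  refine Finset.sum_congr rfl fun p _ => ?_
  rw [← Finset.mul_sum, ← Finset.mul_sum]
  have h3 : S.comX τ₀ h (S.Com τ₀ h) u x p.1 p.2
      = h⁻¹ * ∑ l ∈ S.Λ₁, S.leib τ₀ h u (S.q l) (fdiff h l u) x p.1 p.2
        + ∑ l ∈ S.Λ₁, S.leib τ₀ h u (S.p l) (fdiff h l u) x p.1 p.2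
        - S.leib τ₀ h u S.c u x p.1 p.2 := by
    unfold comX leib
    rw [Finset.sum_comm (s := S.Λ₁), Finset.mul_sum, Finset.sum_comm (s := S.Λ₁),
      ← Finset.sum_add_distrib, ← Finset.sum_sub_distrib]
    refine Finset.sum_congr rfl fun J _ => ?_
    rw [Finset.sum_comm (s := S.Λ₁), Finset.mul_sum, Finset.sum_comm (s := S.Λ₁),
      ← Finset.sum_add_distrib, ← Finset.sum_sub_distrib]
    refine Finset.sum_congr rfl fun I _ => ?_
    simp only [Com, L₀μ, Qμ, fdiff_TL, fdiff_barL hu]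
    rw [← Finset.mul_sum, ← Finset.mul_sum]
    ring
  rw [h3]
  ring

/-- `∑_{I ∈ Λ^n} |δ̄_I u|²`. -/
def U (S : Scheme d) (τ₀ h : ℝ) (n : ℕ) (u : E d → ℝ) : E d → ℝ := fun x =>
  ∑ I ∈ lists S.idx n, S.barL τ₀ h I u x ^ 2

/-- `∑_{I ∈ Λ^n} 𝒬_h(δ̄_I u)`. -/
def 𝒬U (S : Scheme d) (τ₀ h : ℝ) (n : ℕ) (u : E d → ℝ) : E d → ℝ := fun x =>
  ∑ I ∈ lists S.idx n, S.𝒬 h (S.barL τ₀ h I u) x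

theorem Elliptic.𝒬_nonneg (hS : S.Elliptic c₀ h) (φ : E d → ℝ) (x : E d) : 0 ≤ S.𝒬 h φ x :=
  Finset.sum_nonneg fun l hl => mul_nonneg (hS.χ_nonneg l hl x) (sq_nonneg _)

theorem sum_barL_mul_L (u : E d → ℝ) (x : E d) (n : ℕ) :
    ∑ I ∈ lists S.idx n, S.barL τ₀ h I u x * S.L h (S.barL τ₀ h I u) x
      = S.comX τ₀ h (S.Com τ₀ h) u x 0 n := by
  simp only [comX, sum_lists_zero, barL_nil, TL_nil]
  rfl

theorem Smooth.principal_le (hS : S.Smooth m δ c₀ τ₀ K a b M h) (hδ1 : δ ≤ 1) (hK : 0 ≤ K)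
    {u : E d → ℝ} (hu : SmoothBdd u) {n : ℕ} (hn : n + 1 ≤ m) {B₁ B : ℝ}
    (hB₁ : ∀ y, S.U τ₀ h n u y ≤ B₁) (hB : ∀ y, S.U τ₀ h (n + 1) u y ≤ B) (x : E d) :
    2 * ∑ k ∈ Finset.range (n + 1), ((n + 1).choose (k + 1) : ℝ) *
        S.comX τ₀ h (S.Pri τ₀ h (k + 1)) u x (k + 1) (n - k)
      ≤ (1 - δ) * S.𝒬U τ₀ h (n + 1) u x + K * S.𝒬U τ₀ h n u x + 2 * (1 - δ) * S.c x * B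
        + K * B₁ := by
  have hB0 : 0 ≤ B := (Finset.sum_nonneg fun _ _ => sq_nonneg _).trans (hB x)
  have hB10 : 0 ≤ B₁ := (Finset.sum_nonneg fun _ _ => sq_nonneg _).trans (hB₁ x)
  have hc0 : 0 ≤ S.c x := hS.ell.c₀_pos.le.trans (hS.ell.le_c x)
  have hd0 : 0 ≤ 1 - δ := by linarith
  rcases n with _ | n
  · have h1 : 2 * ∑ k ∈ Finset.range (0 + 1), ((0 + 1).choose (k + 1) : ℝ) *
        S.comX τ₀ h (S.Pri τ₀ h (k + 1)) u x (k + 1) (0 - k) = S.A τ₀ h u x := by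
      simp [comX, sum_lists_succ, sum_lists_zero, Pri, A]
      rfl
    have hU : ∀ y, S.sqBar τ₀ h u y ≤ B := fun y => by
      simpa [U, sum_lists_succ, sum_lists_zero, sqBar] using hB y
    have h2 := hS.structural₁ u hu B hU x
    have e1 : S.𝒬U τ₀ h (0 + 1) u x = ∑ μ ∈ S.idx, S.𝒬 h (S.bar τ₀ h μ u) x := by
      simp [𝒬U, sum_lists_succ, sum_lists_zero]
    have e2 : S.𝒬U τ₀ h 0 u x = S.𝒬 h u x := by simp [𝒬U, sum_lists_zero]
    rw [h1, e1, e2]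
    have p1 : 0 ≤ ∑ μ ∈ S.idx, S.𝒬 h (S.bar τ₀ h μ u) x :=
      Finset.sum_nonneg fun _ _ => hS.ell.𝒬_nonneg _ _
    have p2 := hS.ell.𝒬_nonneg u x
    have hm1 : (1 : ℝ) ≤ m := by exact_mod_cast (by omega : 1 ≤ m)
    have p3 : 0 ≤ 2 * (1 - δ) * S.c x * B := by positivity
    have p4 : 0 ≤ (1 - δ) * ∑ μ ∈ S.idx, S.𝒬 h (S.bar τ₀ h μ u) x := mul_nonneg hd0 p1
    have p5 : 0 ≤ K * S.𝒬 h u x := mul_nonneg hK p2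
    have p6 : 0 ≤ K * B₁ := mul_nonneg hK hB10
    rcases le_or_gt (S.A τ₀ h u x) 0 with hA | hA
    · linarith
    · have : S.A τ₀ h u x ≤ m * S.A τ₀ h u x := le_mul_of_one_le_left hA.le hm1
      linarith
  · have h2 := hS.structural₂ (n + 2) (by omega) hn (lists S.idx n) (fun I => S.barL τ₀ h I u)
      (fun I _ => smoothBdd_barL hu τ₀ h I) B₁ B (fun y => by
        refine le_trans (le_of_eq ?_) (hB₁ y)
        simp only [U, sum_lists_succ, sqBar]
        rw [Finset.sum_comm]
        rfl) (fun y => by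
        refine le_trans (le_of_eq ?_) (hB y)
        simp only [U, sum_lists_succ, sqBar₂]
        rw [Finset.sum_comm]
        refine Finset.sum_congr rfl fun μ _ => ?_
        rw [Finset.sum_comm]
        rfl) x
    have e1 : S.𝒬U τ₀ h (n + 1 + 1) u x = ∑ I ∈ lists S.idx n, ∑ μ ∈ S.idx, ∑ ν ∈ S.idx,
        S.𝒬 h (S.bar τ₀ h μ (S.bar τ₀ h ν (S.barL τ₀ h I u))) x := by
      simp only [𝒬U, sum_lists_succ]
      rw [Finset.sum_comm (s := lists S.idx n)]
      refine Finset.sum_congr rfl fun μ _ => ?_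
      rw [Finset.sum_comm]
      rfl
    have e2 : S.𝒬U τ₀ h (n + 1) u x = ∑ I ∈ lists S.idx n, ∑ μ ∈ S.idx,
        S.𝒬 h (S.bar τ₀ h μ (S.barL τ₀ h I u)) x := by
      simp only [𝒬U, sum_lists_succ]
      rw [Finset.sum_comm (s := lists S.idx n)]
      rfl
    have e3 : 2 * S.comX τ₀ h (S.Pri τ₀ h 1) u x 1 (n + 1)
        = ∑ I ∈ lists S.idx n, ∑ ν ∈ S.idx, S.A τ₀ h (S.bar τ₀ h ν (S.barL τ₀ h I u)) x := by
      rw [Finset.sum_comm]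
      have : S.comX τ₀ h (S.Pri τ₀ h 1) u x 1 (n + 1) = ∑ a ∈ S.idx, ∑ ν ∈ S.idx,
          ∑ I ∈ lists S.idx n, S.bar τ₀ h a (S.bar τ₀ h ν (S.barL τ₀ h I u)) x *
            S.L₀μ h (S.bar τ₀ h a) (T h a (S.bar τ₀ h ν (S.barL τ₀ h I u))) x := by
        simp only [comX, sum_lists_succ, sum_lists_zero, Pri, if_true]
        rfl
      rw [this, Finset.sum_comm, Finset.mul_sum]
      refine Finset.sum_congr rfl fun ν _ => ?_
      simp only [A]
      rw [← Finset.mul_sum, Finset.sum_comm]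
    have e4 : S.comX τ₀ h (S.Pri τ₀ h 2) u x 2 n
        = ∑ I ∈ lists S.idx n, ∑ μ ∈ S.idx, ∑ ν ∈ S.idx,
              S.bar τ₀ h μ (S.bar τ₀ h ν (S.barL τ₀ h I u)) x *
                S.Qμ h (fun ψ => S.bar τ₀ h μ (S.bar τ₀ h ν ψ))
                  (T h μ (T h ν (S.barL τ₀ h I u))) x := by
      rw [Finset.sum_comm]
      simp only [comX, sum_lists_succ, sum_lists_zero, Pri]
      refine Finset.sum_congr rfl fun μ _ => ?_
      rw [Finset.sum_comm]
      rfl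
    have e5 : ∀ k ∈ Finset.range n, ((n + 1 + 1).choose (k + 1 + 1 + 1) : ℝ) *
        S.comX τ₀ h (S.Pri τ₀ h (k + 1 + 1 + 1)) u x (k + 1 + 1 + 1) (n + 1 - (k + 1 + 1)) = 0 := by
      intro k _
      have : S.comX τ₀ h (S.Pri τ₀ h (k + 1 + 1 + 1)) u x (k + 1 + 1 + 1) (n + 1 - (k + 1 + 1))
          = 0 := by
        unfold comX
        refine Finset.sum_eq_zero fun J _ => Finset.sum_eq_zero fun I _ => ?_
        simp [Pri]
      rw [this, mul_zero]
    rw [Finset.sum_range_succ', Finset.sum_range_succ', Finset.sum_eq_zero e5]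
    simp only [zero_add, Nat.choose_one_right, Nat.sub_zero, Nat.add_sub_cancel, Nat.reduceAdd]
    rw [e4, e1, e2]
    have hch : ((n + 1 + 1).choose 2 : ℝ) * 2 = (n + 2 : ℝ) * (n + 1) := by
      rw [Nat.cast_choose_two]
      push_cast
      ring
    simp only [Finset.sum_add_distrib, ← Finset.mul_sum] at h2
    rw [← e3] at h2
    push_cast at h2 ⊢
    refine le_trans (le_of_eq ?_) h2
    rw [show ∀ s t : ℝ, 2 * (((n + 1 + 1).choose 2 : ℝ) * s + t)
      = ((n + 1 + 1).choose 2 : ℝ) * 2 * s + 2 * t from fun s t => by ring, hch]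
    ring

end Scheme

end

end EllipticFD

namespace EllipticFD

noncomputable section

variable {d : ℕ}

namespace Scheme

variable {S : Scheme d} {m : ℕ} {δ c₀ τ₀ K a b M h : ℝ}

theorem Smooth.abs_comX_sub_le (hS : S.Smooth m δ c₀ τ₀ K a b M h) {u : E d → ℝ}
    (hu : SmoothBdd u) {k r n : ℕ} (hk : 1 ≤ k) (hkm : k ≤ m) (hkr : k + r = n) {G : ℝ}
    (hG : ∀ j, j + 1 ≤ n → Bd j G u) (x : E d) :
    |S.comX τ₀ h (S.Com τ₀ h) u x k r - S.comX τ₀ h (S.Pri τ₀ h k) u x k r|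
      ≤ ∑ I ∈ lists S.idx n, |S.barL τ₀ h I u x| * (S.wtL τ₀ I * (M * (a ^ 2 + a + 1) * G)) := by
  subst hkr
  rw [sum_lists_append]
  unfold comX
  rw [← Finset.sum_sub_distrib]
  refine (Finset.abs_sum_le_sum_abs _ _).trans (Finset.sum_le_sum fun J hJ => ?_)
  rw [← Finset.sum_sub_distrib]
  refine (Finset.abs_sum_le_sum_abs _ _).trans (Finset.sum_le_sum fun I hI => ?_)
  rw [← mul_sub, abs_mul, barL_append, wtL_append]
  refine mul_le_mul_of_nonneg_left ?_ (abs_nonneg _)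
  have h1 := hS.abs_Com_sub_Pri_le hk hkm rfl hJ (φ := TL h J (S.barL τ₀ h I u)) (r := r)
    (smoothBdd_TL (smoothBdd_barL hu τ₀ h I) h J) (B := S.wtL τ₀ I * G)
    (fun j hj => bd_TL (bd_barL hu (hG (j + r) hj) τ₀ hS.ell.h_pos hI) h J) x
  refine h1.trans (le_of_eq ?_)
  ring

theorem two_mul_le_add_div {η y w : ℝ} (hη : 0 < η) : 2 * (y * w) ≤ η * y ^ 2 + w ^ 2 / η := by
  have h : 0 ≤ (η * y - w) ^ 2 / η := by positivity
  have e : (η * y - w) ^ 2 / η = η * y ^ 2 + w ^ 2 / η - 2 * (y * w) := by field_simp; ring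
  linarith

theorem sum_choose_succ_le (n : ℕ) :
    ∑ k ∈ Finset.range (n + 1), ((n + 1).choose (k + 1) : ℝ) ≤ 2 ^ (n + 1) := by
  have h : ∑ k ∈ Finset.range (n + 1 + 1), ((n + 1).choose k : ℝ) = 2 ^ (n + 1) := by
    exact_mod_cast Nat.sum_range_choose (n + 1)
  rw [Finset.sum_range_succ'] at h
  have : (0 : ℝ) ≤ ((n + 1).choose 0 : ℝ) := by positivity
  linarith

/-- The basic differential inequality for the sum of squares of the differences of order `n + 1`. -/
theorem Smooth.le_L_U (hS : S.Smooth m δ c₀ τ₀ K a b M h) (hδ : 0 < δ) (hδ1 : δ ≤ 1) (hK : 0 ≤ K)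
    {u f : E d → ℝ} (hu : SmoothBdd u) (hf : SmoothBdd f) (hsol : ∀ x, S.L h u x + f x = 0)
    {n : ℕ} (hn : n + 1 ≤ m) {G F B : ℝ} (hG : ∀ j ≤ n, Bd j G u) (hF : Bd (n + 1) F f)
    (hB : ∀ y, S.U τ₀ h (n + 1) u y ≤ B) (x : E d) :
    S.c x * S.U τ₀ h (n + 1) u x + δ * S.𝒬U τ₀ h (n + 1) u x - K * S.𝒬U τ₀ h n u x
        - 2 * (1 - δ) * S.c x * B - δ * c₀ * S.U τ₀ h (n + 1) u x
        - (K * ((b ^ 2 + d * τ₀ ^ 2) ^ n * G ^ 2) + (b ^ 2 + d * τ₀ ^ 2) ^ (n + 1) *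
          (2 ^ (n + 1) * (M * (a ^ 2 + a + 1) * G) + F) ^ 2 / (δ * c₀))
      ≤ S.L h (S.U τ₀ h (n + 1) u) x := by
  have hh := hS.ell.h_pos
  have hM := hS.M_nonneg
  have ha := hS.a_nonneg
  have hG0 := (hG 0 (Nat.zero_le _)).nonneg
  have hF0 := hF.nonneg
  have hη : 0 < δ * c₀ := mul_pos hδ hS.ell.c₀_pos
  set D := M * (a ^ 2 + a + 1) * G with hD
  have hD0 : 0 ≤ D := by positivity
  have hΩ : S.wsize ^ 2 + d * τ₀ ^ 2 = b ^ 2 + d * τ₀ ^ 2 := by rw [hS.wsize_eq]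
  set Ω := b ^ 2 + d * τ₀ ^ 2 with hΩdef
  have hU₁ : ∀ y, S.U τ₀ h n u y ≤ Ω ^ n * G ^ 2 := by
    intro y
    rw [← hΩ, ← sum_wtL_sq, Finset.sum_mul]
    refine Finset.sum_le_sum fun I hI => ?_
    have := (bd_barL (S := S) (n := 0) hu (by simpa using hG n le_rfl) τ₀ hh hI).abs_le y
    rw [← mul_pow, ← sq_abs]
    gcongr
  set Y := ∑ I ∈ lists S.idx (n + 1), |S.barL τ₀ h I u x| * S.wtL τ₀ I with hY
  have hY0 : 0 ≤ Y := Finset.sum_nonneg fun I _ => mul_nonneg (abs_nonneg _) (S.wtL_nonneg _ _)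
  have hYsq : ∀ H, 2 * (Y * H) ≤ δ * c₀ * S.U τ₀ h (n + 1) u x + Ω ^ (n + 1) * H ^ 2 / (δ * c₀) := by
    intro H
    have : ∀ I ∈ lists S.idx (n + 1), 2 * (|S.barL τ₀ h I u x| * (S.wtL τ₀ I * H))
        ≤ δ * c₀ * S.barL τ₀ h I u x ^ 2 + (S.wtL τ₀ I ^ 2 * (H ^ 2 / (δ * c₀))) := by
      intro I _
      refine (two_mul_le_add_div hη).trans (le_of_eq ?_)
      rw [sq_abs]
      ring
    have h2 := Finset.sum_le_sum this
    rw [Finset.sum_add_distrib, ← Finset.mul_sum, ← Finset.mul_sum, ← Finset.sum_mul, sum_wtL_sq,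
      hΩ] at h2
    have e : Y * H = ∑ I ∈ lists S.idx (n + 1), |S.barL τ₀ h I u x| * (S.wtL τ₀ I * H) := by
      rw [hY, Finset.sum_mul]
      exact Finset.sum_congr rfl fun I _ => by ring
    rw [e, mul_div_assoc]
    exact h2
  have hL : S.L h (S.U τ₀ h (n + 1) u) x
      = 2 * S.comX τ₀ h (S.Com τ₀ h) u x 0 (n + 1) + S.𝒬U τ₀ h (n + 1) u x
        + S.c x * S.U τ₀ h (n + 1) u x := by
    unfold U 𝒬U
    rw [L_sum, ← sum_barL_mul_L, Finset.mul_sum, Finset.mul_sum, ← Finset.sum_add_distrib,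
      ← Finset.sum_add_distrib]
    exact Finset.sum_congr rfl fun I _ => S.L_sq hh.ne' _ x
  have hlb := hS.leibniz_L hu x (n + 1)
  rw [Finset.sum_range_succ'] at hlb
  simp only [Nat.choose_zero_right, Nat.cast_one, one_mul, Nat.sub_zero,
    Nat.add_sub_add_right] at hlb
  have hLf : S.L h u = fun y => (-1) * f y := by
    funext y
    have := hsol y
    linarith
  have hfterm : |∑ I ∈ lists S.idx (n + 1), S.barL τ₀ h I u x * S.barL τ₀ h I (S.L h u) x|
      ≤ Y * F := by
    rw [hY, Finset.sum_mul]
    refine (Finset.abs_sum_le_sum_abs _ _).trans (Finset.sum_le_sum fun I hI => ?_)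
    rw [abs_mul, mul_assoc]
    refine mul_le_mul_of_nonneg_left ?_ (abs_nonneg _)
    rw [hLf, barL_const_mul hf]
    have := (bd_barL (S := S) (n := 0) hf (by simpa using hF) τ₀ hh hI).abs_le x
    simpa using this
  have hrem : |∑ k ∈ Finset.range (n + 1), ((n + 1).choose (k + 1) : ℝ) *
          S.comX τ₀ h (S.Com τ₀ h) u x (k + 1) (n - k)
        - ∑ k ∈ Finset.range (n + 1), ((n + 1).choose (k + 1) : ℝ) *
          S.comX τ₀ h (S.Pri τ₀ h (k + 1)) u x (k + 1) (n - k)| ≤ 2 ^ (n + 1) * (Y * D) := by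
    rw [← Finset.sum_sub_distrib]
    refine (Finset.abs_sum_le_sum_abs _ _).trans ?_
    have : ∀ k ∈ Finset.range (n + 1), |((n + 1).choose (k + 1) : ℝ) *
          S.comX τ₀ h (S.Com τ₀ h) u x (k + 1) (n - k) - ((n + 1).choose (k + 1) : ℝ) *
          S.comX τ₀ h (S.Pri τ₀ h (k + 1)) u x (k + 1) (n - k)|
        ≤ ((n + 1).choose (k + 1) : ℝ) * (Y * D) := by
      intro k hk
      have hk' := Finset.mem_range.1 hk
      rw [← mul_sub, abs_mul, Nat.abs_cast]
      refine mul_le_mul_of_nonneg_left ?_ (Nat.cast_nonneg _)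
      refine (hS.abs_comX_sub_le hu (n := n + 1) (by omega) (by omega) (by omega)
        (fun j hj => hG j (by omega)) x).trans (le_of_eq ?_)
      rw [hY, Finset.sum_mul]
      exact Finset.sum_congr rfl fun I _ => by ring
    refine (Finset.sum_le_sum this).trans ?_
    rw [← Finset.sum_mul]
    exact mul_le_mul_of_nonneg_right (sum_choose_succ_le n) (mul_nonneg hY0 hD0)
  have hpri := hS.principal_le hδ1 hK hu hn hU₁ hB x
  have hfin := hYsq (2 ^ (n + 1) * D + F)
  have h1 := (abs_le.1 hfterm).1
  have h2 := (abs_le.1 hrem).2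
  have e : 2 * (Y * (2 ^ (n + 1) * D + F)) = 2 * (2 ^ (n + 1) * (Y * D)) + 2 * (Y * F) := by ring
  rw [hL]
  linarith

theorem absorb {δ c₀ c M B X ε V Y C L : ℝ} (hδ : 0 < δ) (hδ1 : δ ≤ 1) (hc₀ : 0 < c₀)
    (hc : c₀ ≤ c) (hcM : c ≤ M) (hB : 0 ≤ B) (hX : 0 ≤ X) (hε : 0 < ε)
    (h₁ : c * V - 2 * (1 - δ) * c * B - δ * c₀ * V - C ≤ L) (h₂ : L + c * (V + Y) ≤ ε)
    (hY : -X ≤ Y) (hV : B - 2 * X - ε ≤ V) :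
    δ * c₀ * B ≤ C + 5 * (M * X) + (2 * M + 1) * ε := by
  have hc0 : 0 ≤ c := hc₀.le.trans hc
  have e1 : δ * c₀ ≤ c := (mul_le_of_le_one_left hc₀.le hδ1).trans hc
  have e2 : c * -X ≤ c * Y := mul_le_mul_of_nonneg_left hY hc0
  have e3 : c * X ≤ M * X := mul_le_mul_of_nonneg_right hcM hX
  have e4 : (2 * c - δ * c₀) * (B - 2 * X - ε) ≤ (2 * c - δ * c₀) * V :=
    mul_le_mul_of_nonneg_left hV (by linarith)
  have e5 : (2 * c - δ * c₀) * (2 * X + ε) ≤ 2 * M * (2 * X + ε) := by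
    refine mul_le_mul_of_nonneg_right ?_ (by positivity)
    have : 0 < δ * c₀ := mul_pos hδ hc₀
    linarith
  have e6 : δ * c₀ * B ≤ δ * c * B :=
    mul_le_mul_of_nonneg_right (mul_le_mul_of_nonneg_left hc hδ.le) hB
  linarith

set_option maxHeartbeats 1000000 in
/-- A priori estimates for the derivatives of solutions of the difference equation, uniform in
the step, together with the auxiliary function needed for the next order. -/
theorem apriori_aux (d m : ℕ) {δ c₀ τ₀ K : ℝ} (a b M : ℝ) (hδ : 0 < δ) (hδ1 : δ ≤ 1) (hc₀ : 0 < c₀)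
    (hτ₀ : 0 < τ₀) (hK : 0 ≤ K) (n : ℕ) (hn : n ≤ m) :
    ∃ N : ℝ, 0 ≤ N ∧ ∀ (S : Scheme d) (h : ℝ) (u f : E d → ℝ) (F : ℝ),
      S.Smooth m δ c₀ τ₀ K a b M h → SmoothBdd u → SmoothBdd f → (∀ x, S.L h u x + f x = 0) →
      (∀ j ≤ n, Bd j F f) →
      (∀ j ≤ n, Bd j (N * F) u) ∧ ∃ W : E d → ℝ, (∀ x, |W x| ≤ N * F ^ 2) ∧
        ∀ x, S.𝒬U τ₀ h n u x - N * F ^ 2 ≤ S.L h W x := by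
  induction n with
  | zero =>
    refine ⟨1 / c₀ + (1 / c₀) ^ 2 + 2 / c₀, by positivity, ?_⟩
    intro S h u f F hS hu hf hsol hF
    have hF0 := (hF 0 le_rfl).nonneg
    have hu1 : ∀ x, |u x| ≤ F / c₀ := by
      refine hS.ell.abs_le_of_L hu.bdd fun x => ?_
      have := hsol x
      rw [show S.L h u x = -f x by linarith, abs_neg]
      exact (hF 0 le_rfl).abs_le x
    have p1 : 0 ≤ 1 / c₀ := by positivity
    have p2 : 0 ≤ 2 / c₀ := by positivity
    have p3 : 0 ≤ (1 / c₀) ^ 2 := by positivity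
    refine ⟨fun j hj => ?_, fun x => u x ^ 2, fun x => ?_, fun x => ?_⟩
    · obtain rfl : j = 0 := by omega
      refine bd_zero_iff.2 fun x => (hu1 x).trans ?_
      rw [div_eq_mul_one_div, mul_comm]
      gcongr
      linarith
    · have h1 : u x ^ 2 ≤ (F / c₀) ^ 2 := by
        rw [← sq_abs]
        exact pow_le_pow_left₀ (abs_nonneg _) (hu1 x) 2
      rw [abs_of_nonneg (sq_nonneg _)]
      refine h1.trans ?_
      rw [div_eq_mul_one_div, mul_pow, mul_comm]
      gcongr
      linarith
    · rw [S.L_sq hS.ell.h_pos.ne']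
      have h1 : |u x * f x| ≤ F / c₀ * F := by
        rw [abs_mul]
        exact mul_le_mul (hu1 x) ((hF 0 le_rfl).abs_le x) (abs_nonneg _) (by positivity)
      have h2 := hsol x
      have h3 : u x * S.L h u x = -(u x * f x) := by
        rw [show S.L h u x = -f x by linarith]; ring
      have h4 : 0 ≤ S.c x * u x ^ 2 := mul_nonneg (hc₀.le.trans (hS.ell.le_c x)) (sq_nonneg _)
      have h5 : S.𝒬U τ₀ h 0 u x = S.𝒬 h u x := by simp [𝒬U, sum_lists_zero]
      have h6 : 2 * (F / c₀ * F) ≤ (1 / c₀ + (1 / c₀) ^ 2 + 2 / c₀) * F ^ 2 := by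
        have : 2 * (F / c₀ * F) = 2 / c₀ * F ^ 2 := by ring
        rw [this]
        gcongr
        linarith
      have h7 := (abs_le.1 h1).2
      rw [h3, h5]
      linarith
  | succ n ih =>
    obtain ⟨N, hN, ih⟩ := ih (by omega)
    set Ω := b ^ 2 + d * τ₀ ^ 2 with hΩ
    have hΩ0 : 0 ≤ Ω := by positivity
    have hη : 0 < δ * c₀ := mul_pos hδ hc₀
    set C₁ := K * (Ω ^ n * N ^ 2) + Ω ^ (n + 1) *
          (2 ^ (n + 1) * (M * (a ^ 2 + a + 1) * N) + 1) ^ 2 / (δ * c₀) with hC₁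
    have hC₁0 : 0 ≤ C₁ := by positivity
    set C₂ := 4 * (|M| * (K * N)) + C₁ + K * N + |M| * (K * N) with hC₂
    have hC₂0 : 0 ≤ C₂ := by positivity
    set C₃ := C₂ / (δ * c₀) with hC₃
    have hC₃0 : 0 ≤ C₃ := by positivity
    set N' := N + (d / τ₀) ^ (n + 1) * Real.sqrt C₃ + δ⁻¹ * (C₃ + K * N)
      + δ⁻¹ * (2 * |M| * C₃ + δ * c₀ * C₃ + C₁ + K * N) with hN'
    have q1 : 0 ≤ (d / τ₀) ^ (n + 1) * Real.sqrt C₃ := by positivity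
    have q2 : 0 ≤ δ⁻¹ * (C₃ + K * N) := by positivity
    have q3 : 0 ≤ δ⁻¹ * (2 * |M| * C₃ + δ * c₀ * C₃ + C₁ + K * N) := by positivity
    refine ⟨N', by positivity, ?_⟩
    intro S h u f F hS hu hf hsol hF
    have hh := hS.ell.h_pos
    have hM := hS.M_nonneg
    have hMa : |M| = M := abs_of_nonneg hM
    have hF0 := (hF 0 (Nat.zero_le _)).nonneg
    obtain ⟨hG, W, hW, hLW⟩ := ih S h u f F hS hu hf hsol fun j hj => hF j (by omega)
    set V := S.U τ₀ h (n + 1) u with hV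
    have hV0 : ∀ x, 0 ≤ V x := fun x => Finset.sum_nonneg fun _ _ => sq_nonneg _
    have hVb : ∃ C, ∀ x, |V x| ≤ C :=
      (SmoothBdd.sum (lists S.idx (n + 1)) (φ := fun I x => S.barL τ₀ h I u x ^ 2) fun I _ => by
        have := (smoothBdd_barL (S := S) hu τ₀ h I).mul (smoothBdd_barL (S := S) hu τ₀ h I)
        simpa only [← sq] using this).bdd
    have hbdd : BddAbove (range V) := by
      obtain ⟨C, hC⟩ := hVb
      exact ⟨C, by rintro _ ⟨x, rfl⟩; exact (abs_le.1 (hC x)).2⟩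
    set B := sSup (range V) with hB
    have hVB : ∀ y, V y ≤ B := fun y => le_csSup hbdd (mem_range_self y)
    have hB0 : 0 ≤ B := (hV0 0).trans (hVB 0)
    have hmain : ∀ x, S.c x * V x + δ * S.𝒬U τ₀ h (n + 1) u x - K * S.𝒬U τ₀ h n u x
        - 2 * (1 - δ) * S.c x * B - δ * c₀ * V x - C₁ * F ^ 2 ≤ S.L h V x := by
      intro x
      have := hS.le_L_U hδ hδ1 hK hu hf hsol hn hG (hF (n + 1) le_rfl) hVB x
      refine le_trans (le_of_eq ?_) this
      rw [hC₁]
      ring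
    have hLVW : ∀ x, S.c x * V x + δ * S.𝒬U τ₀ h (n + 1) u x
        - 2 * (1 - δ) * S.c x * B - δ * c₀ * V x - (C₁ + K * N) * F ^ 2
        ≤ S.L h (fun y => V y + K * W y) x := by
      intro x
      rw [L_add, L_const_mul]
      have h1 := hmain x
      have h2 := mul_le_mul_of_nonneg_left (hLW x) hK
      linarith
    have hcM : ∀ x, S.c x ≤ M := fun x =>
      (abs_le.1 ((hS.c_bd 0 (Nat.zero_le _)).abs_le x)).2
    have hBle : B ≤ C₃ * F ^ 2 := by
      rw [hC₃, div_mul_eq_mul_div, le_div_iff₀ hη, mul_comm]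
      have key : ∀ ε > 0, δ * c₀ * B ≤ C₂ * F ^ 2 + (2 * M + 1) * ε := by
        intro ε hε
        have hVWb : ∃ C, ∀ x, |V x + K * W x| ≤ C := by
          obtain ⟨C, hC⟩ := hVb
          refine ⟨C + K * (N * F ^ 2), fun x => (abs_add_le _ _).trans (add_le_add (hC x) ?_)⟩
          rw [abs_mul, abs_of_nonneg hK]
          exact mul_le_mul_of_nonneg_left (hW x) hK
        obtain ⟨x, hx1, hx2⟩ := hS.ell.exists_near_sup hVWb hε
        have h1 := hLVW x
        have hc0 := hS.ell.le_c x
        have hq : 0 ≤ δ * S.𝒬U τ₀ h (n + 1) u x :=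
          mul_nonneg hδ.le (Finset.sum_nonneg fun _ _ => hS.ell.𝒬_nonneg _ _)
        have hVx : B - 2 * (K * N) * F ^ 2 - ε ≤ V x := by
          have : B ≤ V x + 2 * (K * N) * F ^ 2 + ε := by
            refine csSup_le (range_nonempty _) ?_
            rintro _ ⟨y, rfl⟩
            have h2 := hx1 y
            have h3 := mul_le_mul_of_nonneg_left (abs_le.1 (hW x)).2 hK
            have h4 := mul_le_mul_of_nonneg_left (abs_le.1 (hW y)).1 hK
            linarith only [h2, h3, h4]
          linarith only [this]
        have hY : -(K * N * F ^ 2) ≤ K * W x := by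
          have h4 := mul_le_mul_of_nonneg_left (abs_le.1 (hW x)).1 hK
          linarith only [h4]
        have := absorb hδ hδ1 hc₀ hc0 (hcM x) hB0 (X := K * N * F ^ 2) (by positivity) hε
          (V := V x) (C := (C₁ + K * N) * F ^ 2) (by linarith only [h1, hq]) hx2 hY
          (by linarith only [hVx])
        rw [hC₂, hMa]
        linarith only [this]
      refine le_of_forall_pos_le_add fun ε hε => ?_
      have := key (ε / (2 * M + 1)) (by positivity)
      rwa [mul_div_cancel₀ _ (by positivity)] at this
    refine ⟨fun j hj => ?_, fun x => δ⁻¹ * (V x + K * W x), fun x => ?_, fun x => ?_⟩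
    · rcases Nat.lt_or_ge j (n + 1) with hj' | hj'
      · refine (hG j (by omega)).mono (mul_le_mul_of_nonneg_right ?_ hF0)
        linarith only [hN', q1, q2, q3]
      · obtain rfl : j = n + 1 := by omega
        have := bd_of_barL_le (S := S) (n := n + 1) (h := h) (Q := Real.sqrt C₃ * F) hτ₀ hu
          fun I hI x => by
            rw [← Real.sqrt_sq hF0, ← Real.sqrt_mul hC₃0]
            refine Real.abs_le_sqrt (le_trans ?_ ((hVB x).trans hBle))
            exact Finset.single_le_sum (f := fun I => S.barL τ₀ h I u x ^ 2)
              (fun _ _ => sq_nonneg _) hI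
        refine this.mono ?_
        rw [← mul_assoc]
        refine mul_le_mul_of_nonneg_right ?_ hF0
        linarith only [hN', hN, q2, q3]
    · rw [abs_mul, abs_of_pos (inv_pos.2 hδ)]
      have h1 : |V x + K * W x| ≤ (C₃ + K * N) * F ^ 2 := by
        refine (abs_add_le _ _).trans ?_
        rw [abs_of_nonneg (hV0 x), abs_mul, abs_of_nonneg hK]
        have h2 := mul_le_mul_of_nonneg_left (hW x) hK
        have h3 := (hVB x).trans hBle
        linarith only [h2, h3]
      calc δ⁻¹ * |V x + K * W x| ≤ δ⁻¹ * ((C₃ + K * N) * F ^ 2) := by gcongr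
        _ = δ⁻¹ * (C₃ + K * N) * F ^ 2 := by ring
        _ ≤ N' * F ^ 2 := by
          refine mul_le_mul_of_nonneg_right ?_ (sq_nonneg _)
          linarith only [hN', hN, q1, q3]
    · rw [L_const_mul]
      have h1 := hLVW x
      have hc0 : 0 ≤ S.c x := hc₀.le.trans (hS.ell.le_c x)
      have h2 : 0 ≤ S.c x * V x := mul_nonneg hc0 (hV0 x)
      have h3 : 2 * (1 - δ) * S.c x * B ≤ 2 * |M| * C₃ * F ^ 2 := by
        rw [hMa]
        have e1 : 2 * (1 - δ) * S.c x ≤ 2 * M := by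
          have := hcM x
          nlinarith
        calc 2 * (1 - δ) * S.c x * B ≤ 2 * M * (C₃ * F ^ 2) :=
              mul_le_mul e1 hBle hB0 (by positivity)
          _ = _ := by ring
      have h4 : δ * c₀ * V x ≤ δ * c₀ * C₃ * F ^ 2 := by
        rw [mul_assoc _ C₃]
        exact mul_le_mul_of_nonneg_left ((hVB x).trans hBle) hη.le
      have h5 : δ * S.𝒬U τ₀ h (n + 1) u x - (2 * |M| * C₃ + δ * c₀ * C₃ + C₁ + K * N) * F ^ 2
          ≤ S.L h (fun y => V y + K * W y) x := by linarith only [h1, h2, h3, h4]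
      have h6 := mul_le_mul_of_nonneg_left h5 (inv_pos.2 hδ).le
      have h7 : δ⁻¹ * (δ * S.𝒬U τ₀ h (n + 1) u x
          - (2 * |M| * C₃ + δ * c₀ * C₃ + C₁ + K * N) * F ^ 2)
          = S.𝒬U τ₀ h (n + 1) u x
            - δ⁻¹ * (2 * |M| * C₃ + δ * c₀ * C₃ + C₁ + K * N) * F ^ 2 := by
        field_simp
      have h8 : δ⁻¹ * (2 * |M| * C₃ + δ * c₀ * C₃ + C₁ + K * N) * F ^ 2 ≤ N' * F ^ 2 := by
        refine mul_le_mul_of_nonneg_right ?_ (sq_nonneg _)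
        linarith only [hN', hN, q1, q2]
      linarith only [h6, h7, h8]

/-- A priori estimates for solutions of the difference equation, uniform in the step. -/
theorem apriori (d m : ℕ) {δ c₀ τ₀ K : ℝ} (a b M : ℝ) (hδ : 0 < δ) (hδ1 : δ ≤ 1) (hc₀ : 0 < c₀)
    (hτ₀ : 0 < τ₀) (hK : 0 ≤ K) :
    ∃ N : ℝ, 0 ≤ N ∧ ∀ (S : Scheme d) (h : ℝ) (u f : E d → ℝ) (F : ℝ) (n : ℕ), n ≤ m →
      S.Smooth m δ c₀ τ₀ K a b M h → SmoothBdd u → SmoothBdd f → (∀ x, S.L h u x + f x = 0) →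
      (∀ j ≤ n, Bd j F f) → ∀ j ≤ n, Bd j (N * F) u := by
  have : ∀ n, ∃ N : ℝ, 0 ≤ N ∧ (n ≤ m → ∀ (S : Scheme d) (h : ℝ) (u f : E d → ℝ) (F : ℝ),
      S.Smooth m δ c₀ τ₀ K a b M h → SmoothBdd u → SmoothBdd f → (∀ x, S.L h u x + f x = 0) →
      (∀ j ≤ n, Bd j F f) → ∀ j ≤ n, Bd j (N * F) u) := by
    intro n
    by_cases hn : n ≤ m
    · obtain ⟨N, hN, H⟩ := apriori_aux d m a b M hδ hδ1 hc₀ hτ₀ hK n hn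
      exact ⟨N, hN, fun _ S h u f F h1 h2 h3 h4 h5 => (H S h u f F h1 h2 h3 h4 h5).1⟩
    · exact ⟨0, le_rfl, fun h => absurd h hn⟩
  choose N hN H using this
  refine ⟨∑ n ∈ Finset.range (m + 1), N n, Finset.sum_nonneg fun n _ => hN n, ?_⟩
  intro S h u f F n hn h1 h2 h3 h4 h5 j hj
  refine (H n hn S h u f F h1 h2 h3 h4 h5 j hj).mono (mul_le_mul_of_nonneg_right ?_ (h5 0
    (Nat.zero_le _)).nonneg)
  exact Finset.single_le_sum (fun n _ => hN n) (Finset.mem_range.2 (by omega))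

end Scheme

end

end EllipticFD

namespace EllipticFD

noncomputable section

variable {d : ℕ}

theorem dirD_const_mul {φ : E d → ℝ} (hφ : Differentiable ℝ φ) (l : E d) (a : ℝ) :
    dirD l (fun x => a * φ x) = fun x => a * dirD l φ x := by
  funext x
  simp only [dirD]
  rw [fderiv_const_mul (hφ x)]
  rfl

theorem dirD_neg_iterate {φ : E d → ℝ} (hφ : SmoothBdd φ) (l : E d) (n : ℕ) :
    (dirD (-l))^[n] φ = fun x => (-1) ^ n * (dirD l)^[n] φ x := by
  induction n with
  | zero => simp
  | succ n ih =>
    rw [Function.iterate_succ_apply', Function.iterate_succ_apply', ih,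
      dirD_const_mul (smooth_differentiable (hφ.dirD_iterate l n).1)]
    funext x
    simp only [dirD, map_neg, pow_succ]
    ring

theorem dirD_zero_iterate (l : E d) (n : ℕ) :
    (dirD l)^[n] (fun _ => (0 : ℝ)) = fun _ => 0 := by
  induction n with
  | zero => rfl
  | succ n ih =>
    rw [Function.iterate_succ_apply', ih]
    funext x
    simp [dirD]

namespace Scheme

/-- The coefficient of `h^i / i!` in the formal expansion of the difference operator (up to the
zero order term). -/
def Li (S : Scheme d) (i : ℕ) (φ : E d → ℝ) (x : E d) : ℝ :=
  1 / (((i : ℝ) + 1) * (i + 2)) * ∑ l ∈ S.Λ₁, S.q l x * (dirD l)^[i + 2] φ x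
    + 1 / ((i : ℝ) + 1) * ∑ l ∈ S.Λ₁, S.p l x * (dirD l)^[i + 1] φ x

variable {S : Scheme d} {m : ℕ} {δ c₀ τ₀ K a b M h : ℝ}

theorem Smooth.norm_le (hS : S.Smooth m δ c₀ τ₀ K a b M h) {l : E d} (hl : l ∈ S.Λ₁) : ‖l‖ ≤ a := by
  refine le_of_sq_le_sq ?_ hS.a_nonneg
  rw [← hS.sum_norm_sq]
  exact Finset.single_le_sum (f := fun l => ‖l‖ ^ 2) (fun _ _ => sq_nonneg _) hl

theorem Smooth.sum_norm_pow_le (hS : S.Smooth m δ c₀ τ₀ K a b M h) (r : ℕ) :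
    ∑ l ∈ S.Λ₁, ‖l‖ ^ (r + 2) ≤ a ^ (r + 2) := by
  have h1 : ∀ l ∈ S.Λ₁, ‖l‖ ^ (r + 2) ≤ a ^ r * ‖l‖ ^ 2 := fun l hl => by
    rw [pow_add]
    have := pow_le_pow_left₀ (norm_nonneg l) (hS.norm_le hl) r
    gcongr
  refine (Finset.sum_le_sum h1).trans (le_of_eq ?_)
  rw [← Finset.mul_sum, hS.sum_norm_sq, pow_add]

theorem Smooth.p_bd_single (hS : S.Smooth m δ c₀ τ₀ K a b M h) {k : ℕ} (hk : k ≤ m) {l : E d}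
    (hl : l ∈ S.Λ₁) : Bd k M (S.p l) := by
  classical
  have h1 := hS.p_bd k hk (Pi.single l 1)
  have h2 : ∑ k ∈ S.Λ₁, (Pi.single l (1 : ℝ) : E d → ℝ) k ^ 2 = 1 := by
    rw [Finset.sum_eq_single l]
    · simp
    · intro k _ hk
      simp [hk]
    · exact fun h => absurd hl h
  have h3 : (fun x => ∑ k ∈ S.Λ₁, (Pi.single l (1 : ℝ) : E d → ℝ) k * S.p k x) = S.p l := by
    funext x
    rw [Finset.sum_eq_single l]
    · simp
    · intro k _ hk
      simp [hk]
    · exact fun h => absurd hl h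
  rw [h2, h3] at h1
  simpa using h1

theorem Smooth.smoothBdd_Li (hS : S.Smooth m δ c₀ τ₀ K a b M h) (i : ℕ) {φ : E d → ℝ}
    (hφ : SmoothBdd φ) : SmoothBdd (S.Li i φ) :=
  ((SmoothBdd.sum S.Λ₁ fun l hl => (hS.q_smooth l hl).mul (hφ.dirD_iterate l _)).const_mul _).add
    ((SmoothBdd.sum S.Λ₁ fun l hl => (hS.p_smooth l hl).mul (hφ.dirD_iterate l _)).const_mul _)

/-- Taylor expansion of the difference operator in the step. -/
theorem Smooth.taylor_L (hS : S.Smooth m δ c₀ τ₀ K a b M h) {φ : E d → ℝ} (hφ : SmoothBdd φ)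
    (s : ℕ) {B : ℝ} (hB2 : Bd (s + 2) B φ) (hB3 : Bd (s + 3) B φ) (x : E d) :
    |S.L h φ x - (∑ i ∈ Finset.range (s + 1), h ^ i / (i.factorial : ℝ) * S.Li i φ x
        - S.c x * φ x)| ≤ h ^ (s + 1) * (M * (a ^ (s + 3) + a ^ (s + 2)) * B) := by
  have hh := hS.ell.h_pos
  have hM := hS.M_nonneg
  have hB0 := hB2.nonneg
  have hbal : ∑ l ∈ S.Λ₁, S.q l x * dirD l φ x = 0 := by
    have := congrArg (fderiv ℝ φ x) (hS.balanced x)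
    simp only [map_sum, map_smul, smul_eq_mul, map_zero] at this
    exact this
  set eq : E d → ℝ := fun l => φ (x + h • l)
    - ∑ j ∈ Finset.range (s + 3), h ^ j / (j.factorial : ℝ) * (dirD l)^[j] φ x with heq
  set ep : E d → ℝ := fun l => φ (x + h • l)
    - ∑ j ∈ Finset.range (s + 2), h ^ j / (j.factorial : ℝ) * (dirD l)^[j] φ x with hep
  have e1 : ∀ l, h⁻¹ * fdiff h l φ x = h⁻¹ * dirD l φ x
      + ∑ i ∈ Finset.range (s + 1), h ^ i / (i.factorial : ℝ) *
        (1 / (((i : ℝ) + 1) * (i + 2)) * (dirD l)^[i + 2] φ x) + (h ^ 2)⁻¹ * eq l := by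
    intro l
    simp only [heq, fdiff]
    rw [Finset.sum_range_succ' _ (s + 2), Finset.sum_range_succ' _ (s + 1)]
    have : ∑ k ∈ Finset.range (s + 1), h ^ (k + 1 + 1) / ((k + 1 + 1).factorial : ℝ) *
        (dirD l)^[k + 1 + 1] φ x = h ^ 2 * ∑ i ∈ Finset.range (s + 1), h ^ i / (i.factorial : ℝ) *
        (1 / (((i : ℝ) + 1) * (i + 2)) * (dirD l)^[i + 2] φ x) := by
      rw [Finset.mul_sum]
      refine Finset.sum_congr rfl fun i _ => ?_
      rw [Nat.factorial_succ, Nat.factorial_succ]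
      push_cast
      have : (i.factorial : ℝ) ≠ 0 := by positivity
      have : (i : ℝ) + 1 ≠ 0 := by positivity
      have : (i : ℝ) + 2 ≠ 0 := by positivity
      have : (i : ℝ) + 1 + 1 ≠ 0 := by positivity
      field_simp
      ring
    rw [this]
    generalize ∑ i ∈ Finset.range (s + 1), h ^ i / (i.factorial : ℝ) *
        (1 / (((i : ℝ) + 1) * (i + 2)) * (dirD l)^[i + 2] φ x) = Z
    simp
    field_simp
    ring
  have e2 : ∀ l, fdiff h l φ x = ∑ i ∈ Finset.range (s + 1), h ^ i / (i.factorial : ℝ) *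
        (1 / ((i : ℝ) + 1) * (dirD l)^[i + 1] φ x) + h⁻¹ * ep l := by
    intro l
    simp only [hep, fdiff]
    rw [Finset.sum_range_succ' _ (s + 1)]
    have : ∑ k ∈ Finset.range (s + 1), h ^ (k + 1) / ((k + 1).factorial : ℝ) *
        (dirD l)^[k + 1] φ x = h * ∑ i ∈ Finset.range (s + 1), h ^ i / (i.factorial : ℝ) *
        (1 / ((i : ℝ) + 1) * (dirD l)^[i + 1] φ x) := by
      rw [Finset.mul_sum]
      refine Finset.sum_congr rfl fun i _ => ?_
      rw [Nat.factorial_succ]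
      push_cast
      have : (i.factorial : ℝ) ≠ 0 := by positivity
      have : (i : ℝ) + 1 ≠ 0 := by positivity
      field_simp
      ring
    rw [this]
    generalize ∑ i ∈ Finset.range (s + 1), h ^ i / (i.factorial : ℝ) *
        (1 / ((i : ℝ) + 1) * (dirD l)^[i + 1] φ x) = Z
    simp
    field_simp
    ring
  have e3 : S.L h φ x - (∑ i ∈ Finset.range (s + 1), h ^ i / (i.factorial : ℝ) * S.Li i φ x
        - S.c x * φ x)
      = ∑ l ∈ S.Λ₁, S.q l x * ((h ^ 2)⁻¹ * eq l) + ∑ l ∈ S.Λ₁, S.p l x * (h⁻¹ * ep l) := by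
    have f1 : h⁻¹ * ∑ l ∈ S.Λ₁, S.q l x * fdiff h l φ x
        = ∑ i ∈ Finset.range (s + 1), h ^ i / (i.factorial : ℝ) *
          (1 / (((i : ℝ) + 1) * (i + 2)) * ∑ l ∈ S.Λ₁, S.q l x * (dirD l)^[i + 2] φ x)
          + ∑ l ∈ S.Λ₁, S.q l x * ((h ^ 2)⁻¹ * eq l) := by
      have g1 : ∀ l ∈ S.Λ₁, h⁻¹ * (S.q l x * fdiff h l φ x)
          = h⁻¹ * (S.q l x * dirD l φ x)
            + ∑ i ∈ Finset.range (s + 1), h ^ i / (i.factorial : ℝ) *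
              (1 / (((i : ℝ) + 1) * (i + 2)) * (S.q l x * (dirD l)^[i + 2] φ x))
            + S.q l x * ((h ^ 2)⁻¹ * eq l) := by
        intro l _
        rw [mul_left_comm, e1, mul_add, mul_add, Finset.mul_sum]
        congr 2
        · ring
        · exact Finset.sum_congr rfl fun i _ => by ring
      rw [Finset.mul_sum, Finset.sum_congr rfl g1, Finset.sum_add_distrib, Finset.sum_add_distrib,
        ← Finset.mul_sum, hbal, mul_zero, zero_add, Finset.sum_comm]
      simp only [← Finset.mul_sum]
    have f2 : ∑ l ∈ S.Λ₁, S.p l x * fdiff h l φ x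
        = ∑ i ∈ Finset.range (s + 1), h ^ i / (i.factorial : ℝ) *
          (1 / ((i : ℝ) + 1) * ∑ l ∈ S.Λ₁, S.p l x * (dirD l)^[i + 1] φ x)
          + ∑ l ∈ S.Λ₁, S.p l x * (h⁻¹ * ep l) := by
      have g1 : ∀ l ∈ S.Λ₁, S.p l x * fdiff h l φ x
          = ∑ i ∈ Finset.range (s + 1), h ^ i / (i.factorial : ℝ) *
              (1 / ((i : ℝ) + 1) * (S.p l x * (dirD l)^[i + 1] φ x))
            + S.p l x * (h⁻¹ * ep l) := by
        intro l _
        rw [e2, mul_add, Finset.mul_sum]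
        congr 1
        exact Finset.sum_congr rfl fun i _ => by ring
      rw [Finset.sum_congr rfl g1, Finset.sum_add_distrib, Finset.sum_comm]
      simp only [← Finset.mul_sum]
    simp only [L, f1, f2, Li, mul_add, Finset.sum_add_distrib]
    ring
  rw [e3]
  have b1 : ∀ l ∈ S.Λ₁, |S.q l x * ((h ^ 2)⁻¹ * eq l)| ≤ M * (h ^ (s + 1) * B) * ‖l‖ ^ (s + 1 + 2) := by
    intro l hl
    have t := taylor_dirD hφ l x (s + 3) hB3 hh.le
    have t2 : |(h ^ 2)⁻¹ * eq l| ≤ h ^ (s + 1) * B * ‖l‖ ^ (s + 1 + 2) := by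
      rw [abs_mul, abs_of_pos (by positivity), inv_mul_le_iff₀ (by positivity)]
      refine t.trans (le_of_eq ?_)
      ring
    rw [abs_mul, mul_assoc]
    exact mul_le_mul ((hS.q_bd 0 (Nat.zero_le _) l hl).abs_le x) t2 (abs_nonneg _) hM
  have b2 : ∀ l ∈ S.Λ₁, |S.p l x * (h⁻¹ * ep l)| ≤ M * (h ^ (s + 1) * B) * ‖l‖ ^ (s + 2) := by
    intro l hl
    have t := taylor_dirD hφ l x (s + 2) hB2 hh.le
    have t2 : |h⁻¹ * ep l| ≤ h ^ (s + 1) * B * ‖l‖ ^ (s + 2) := by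
      rw [abs_mul, abs_of_pos (by positivity), inv_mul_le_iff₀ (by positivity)]
      refine t.trans (le_of_eq ?_)
      ring
    rw [abs_mul, mul_assoc]
    exact mul_le_mul ((hS.p_bd_single (Nat.zero_le _) hl).abs_le x) t2 (abs_nonneg _) hM
  have c1 := (Finset.abs_sum_le_sum_abs _ _).trans (Finset.sum_le_sum b1)
  have c2 := (Finset.abs_sum_le_sum_abs _ _).trans (Finset.sum_le_sum b2)
  rw [← Finset.mul_sum] at c1 c2
  have d1 := mul_le_mul_of_nonneg_left (hS.sum_norm_pow_le (s + 1))
    (by positivity : 0 ≤ M * (h ^ (s + 1) * B))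
  have d2 := mul_le_mul_of_nonneg_left (hS.sum_norm_pow_le s)
    (by positivity : 0 ≤ M * (h ^ (s + 1) * B))
  refine (abs_add_le _ _).trans ((add_le_add (c1.trans d1) (c2.trans d2)).trans (le_of_eq ?_))
  ring

/-! ### Symmetric schemes -/

theorem sum_neg_eq (hsym : S.Symm) (F : E d → ℝ) :
    ∑ l ∈ S.Λ₁, F (-l) = ∑ l ∈ S.Λ₁, F l :=
  Finset.sum_nbij' (fun l => -l) (fun l => -l) (fun l hl => (hsym l hl).1)
    (fun l hl => (hsym l hl).1) (fun _ _ => neg_neg _) (fun _ _ => neg_neg _) (fun _ _ => rfl)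

theorem sum_q_odd (hsym : S.Symm) {φ : E d → ℝ} (hφ : SmoothBdd φ) {i : ℕ} (hi : Odd i) (x : E d) :
    ∑ l ∈ S.Λ₁, S.q l x * (dirD l)^[i] φ x = 0 := by
  have h1 := sum_neg_eq hsym (fun l => S.q l x * (dirD l)^[i] φ x)
  have h2 : ∑ l ∈ S.Λ₁, S.q (-l) x * (dirD (-l))^[i] φ x
      = -∑ l ∈ S.Λ₁, S.q l x * (dirD l)^[i] φ x := by
    rw [← Finset.sum_neg_distrib]
    refine Finset.sum_congr rfl fun l hl => ?_
    rw [← (hsym l hl).2 x, dirD_neg_iterate hφ, hi.neg_one_pow]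
    ring
  linarith

theorem sum_p_even (hsym : S.Symm) (hp : S.AntisymmP) {φ : E d → ℝ} (hφ : SmoothBdd φ) {i : ℕ}
    (hi : Even i) (x : E d) :
    ∑ l ∈ S.Λ₁, S.p l x * (dirD l)^[i] φ x = 0 := by
  have h1 := sum_neg_eq hsym (fun l => S.p l x * (dirD l)^[i] φ x)
  have h2 : ∑ l ∈ S.Λ₁, S.p (-l) x * (dirD (-l))^[i] φ x
      = -∑ l ∈ S.Λ₁, S.p l x * (dirD l)^[i] φ x := by
    rw [← Finset.sum_neg_distrib]
    refine Finset.sum_congr rfl fun l hl => ?_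
    rw [hp l hl x, dirD_neg_iterate hφ, hi.neg_one_pow]
    ring
  linarith

theorem Li_odd (hsym : S.Symm) (hp : S.AntisymmP) {φ : E d → ℝ} (hφ : SmoothBdd φ) {i : ℕ}
    (hi : Odd i) (x : E d) : S.Li i φ x = 0 := by
  rw [Li, sum_q_odd hsym hφ (by simpa [Nat.odd_add] using hi), sum_p_even hsym hp hφ hi.add_one]
  simp

theorem Li_zero (S : Scheme d) (i : ℕ) (x : E d) : S.Li i (fun _ => 0) x = 0 := by
  simp [Li, dirD_zero_iterate]

/-! ### Bounds for the operators in the expansion -/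

theorem Smooth.bd_sum_mul (hS : S.Smooth m δ c₀ τ₀ K a b M h) {g : E d → E d → ℝ}
    (hgs : ∀ l ∈ S.Λ₁, SmoothBdd (g l)) (hg : ∀ k ≤ m, ∀ l ∈ S.Λ₁, Bd k M (g l))
    {φ : E d → ℝ} (hφ : SmoothBdd φ) {i r : ℕ} (hr : r ≤ m) {B : ℝ}
    (hB : ∀ j ≤ r + (i + 2), Bd j B φ) :
    Bd r (2 ^ r * M * a ^ (i + 2) * B) (fun x => ∑ l ∈ S.Λ₁, g l x * (dirD l)^[i + 2] φ x) := by
  have hM := hS.M_nonneg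
  have hB0 := (hB 0 (Nat.zero_le _)).nonneg
  have h1 : ∀ l ∈ S.Λ₁, Bd r (2 ^ r * M * B * ‖l‖ ^ (i + 2))
      (fun x => g l x * (dirD l)^[i + 2] φ x) := by
    intro l hl
    have := Bd.mul (n := r) (B := fun _ => M) (C := fun _ => ‖l‖ ^ (i + 2) * B) (hgs l hl).1
      (hφ.dirD_iterate l (i + 2)).1 (fun j hj => hg j (hj.trans hr) l hl)
      (fun j hj => (hB (j + (i + 2)) (by omega)).dirD_iterate hφ.1 l)
    refine this.mono (le_of_eq ?_)
    have h2 : ∑ i ∈ Finset.range (r + 1), (r.choose i : ℝ) = 2 ^ r := by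
      exact_mod_cast Nat.sum_range_choose r
    rw [← Finset.sum_mul, ← Finset.sum_mul, h2]
    ring
  refine (Bd.sum S.Λ₁ (fun l hl => ((hgs l hl).mul (hφ.dirD_iterate l (i + 2))).1) h1).mono ?_
  rw [← Finset.mul_sum]
  have := mul_le_mul_of_nonneg_left (hS.sum_norm_pow_le i) (by positivity : 0 ≤ 2 ^ r * M * B)
  linarith

/-- The number of derivatives lost per power of the step. -/
def Loss (S : Scheme d) (ℓ : ℕ) : Prop := ℓ = 3 ∨ (ℓ = 2 ∧ S.Symm)

theorem Smooth.bd_Li (hS : S.Smooth m δ c₀ τ₀ K a b M h) {ℓ : ℕ} (hℓ : S.Loss ℓ)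
    {φ : E d → ℝ} (hφ : SmoothBdd φ) {i r : ℕ} (hr : r ≤ m) {B : ℝ}
    (hB : ∀ j ≤ r + ℓ * (i + 1), Bd j B φ) :
    Bd r (2 ^ r * M * (a ^ (i + 3) + a ^ (i + 2)) * B) (S.Li (i + 1) φ) := by
  have hM := hS.M_nonneg
  have ha := hS.a_nonneg
  have hB0 := (hB 0 (Nat.zero_le _)).nonneg
  have hq : Bd r (2 ^ r * M * a ^ (i + 3) * B)
      (fun x => ∑ l ∈ S.Λ₁, S.q l x * (dirD l)^[i + 1 + 2] φ x) := by
    rcases hℓ with rfl | ⟨rfl, hsym⟩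
    · exact hS.bd_sum_mul hS.q_smooth hS.q_bd hφ hr fun j hj => hB j (by omega)
    · rcases Nat.eq_zero_or_pos i with rfl | hi
      · have : (fun x => ∑ l ∈ S.Λ₁, S.q l x * (dirD l)^[0 + 1 + 2] φ x) = fun _ => 0 :=
          funext fun x => sum_q_odd hsym hφ (by decide) x
        rw [this]
        exact (bd_zero_fun r).mono (by positivity)
      · exact hS.bd_sum_mul hS.q_smooth hS.q_bd hφ hr fun j hj => hB j (by omega)
  have hp : Bd r (2 ^ r * M * a ^ (i + 2) * B)
      (fun x => ∑ l ∈ S.Λ₁, S.p l x * (dirD l)^[i + 2] φ x) :=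
    hS.bd_sum_mul hS.p_smooth (fun k hk l hl => hS.p_bd_single hk hl) hφ hr fun j hj => hB j (by
      rcases hℓ with rfl | ⟨rfl, -⟩ <;> omega)
  have sq : SmoothBdd (fun x => ∑ l ∈ S.Λ₁, S.q l x * (dirD l)^[i + 1 + 2] φ x) :=
    SmoothBdd.sum S.Λ₁ fun l hl => (hS.q_smooth l hl).mul (hφ.dirD_iterate l _)
  have sp : SmoothBdd (fun x => ∑ l ∈ S.Λ₁, S.p l x * (dirD l)^[i + 2] φ x) :=
    SmoothBdd.sum S.Λ₁ fun l hl => (hS.p_smooth l hl).mul (hφ.dirD_iterate l _)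
  have := (hq.const_mul sq.1 (1 / ((((i + 1 : ℕ) : ℝ) + 1) * ((i + 1 : ℕ) + 2)))).add
    (sq.const_mul _).1 (sp.const_mul _).1 (hp.const_mul sp.1 (1 / (((i + 1 : ℕ) : ℝ) + 1)))
  refine Bd.mono this ?_
  have a1 : |1 / ((((i + 1 : ℕ) : ℝ) + 1) * ((i + 1 : ℕ) + 2))| ≤ 1 := by
    rw [abs_of_nonneg (by positivity)]
    refine div_le_one_of_le₀ ?_ (by positivity)
    have : (0 : ℝ) ≤ ((i + 1 : ℕ) : ℝ) := Nat.cast_nonneg _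
    nlinarith
  have a2 : |1 / (((i + 1 : ℕ) : ℝ) + 1)| ≤ 1 := by
    rw [abs_of_nonneg (by positivity)]
    refine div_le_one_of_le₀ ?_ (by positivity)
    have : (0 : ℝ) ≤ ((i + 1 : ℕ) : ℝ) := Nat.cast_nonneg _
    linarith
  have e1 := mul_le_mul_of_nonneg_right a1 hq.nonneg
  have e2 := mul_le_mul_of_nonneg_right a2 hp.nonneg
  linarith

/-! ### The correctors -/

open scoped Classical in
/-- A smooth bounded solution of the difference equation, if there is one. -/
def sol (S : Scheme d) (h : ℝ) (f : E d → ℝ) : E d → ℝ :=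
  if H : ∃ u, SmoothBdd u ∧ ∀ x, S.L h u x + f x = 0 then H.choose else 0

theorem Smooth.sol_spec (hS : S.Smooth m δ c₀ τ₀ K a b M h) {f : E d → ℝ} (hf : SmoothBdd f) :
    SmoothBdd (S.sol h f) ∧ ∀ x, S.L h (S.sol h f) x + f x = 0 := by
  have H := exists_smooth_solution hS.ell hS.q_smooth hS.p_smooth hS.c_smooth hf
  rw [sol, dif_pos H]
  exact H.choose_spec

/-- Approximate coefficients of the expansion in powers of the step. -/
def corr (S : Scheme d) (h : ℝ) (f : E d → ℝ) : ℕ → E d → ℝ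
  | 0 => S.sol h f
  | s + 1 => S.sol h (fun x => ∑ j : Fin (s + 1),
      ((s + 1).choose j : ℝ) * S.Li (s + 1 - j) (S.corr h f j) x)
termination_by s => s
decreasing_by exact j.2

theorem corr_zero (S : Scheme d) (h : ℝ) (f : E d → ℝ) : S.corr h f 0 = S.sol h f := by
  rw [corr]

theorem corr_succ (S : Scheme d) (h : ℝ) (f : E d → ℝ) (s : ℕ) :
    S.corr h f (s + 1) = S.sol h (fun x => ∑ j ∈ Finset.range (s + 1),
      ((s + 1).choose j : ℝ) * S.Li (s + 1 - j) (S.corr h f j) x) := by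
  rw [corr]
  congr 1
  funext x
  exact Fin.sum_univ_eq_sum_range
    (fun j => ((s + 1).choose j : ℝ) * S.Li (s + 1 - j) (S.corr h f j) x) (s + 1)

theorem Smooth.smoothBdd_corr (hS : S.Smooth m δ c₀ τ₀ K a b M h) {f : E d → ℝ} (hf : SmoothBdd f)
    (s : ℕ) : SmoothBdd (S.corr h f s) := by
  induction s using Nat.strong_induction_on with
  | _ s ih =>
    rcases s with _ | s
    · rw [corr_zero]; exact (hS.sol_spec hf).1
    · rw [corr_succ]
      exact (hS.sol_spec (SmoothBdd.sum _ fun j hj => (hS.smoothBdd_Li _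
        (ih j (Finset.mem_range.1 hj))).const_mul _)).1

theorem Smooth.L_corr_zero (hS : S.Smooth m δ c₀ τ₀ K a b M h) {f : E d → ℝ} (hf : SmoothBdd f)
    (x : E d) : S.L h (S.corr h f 0) x + f x = 0 := by
  rw [corr_zero]; exact (hS.sol_spec hf).2 x

theorem Smooth.L_corr_succ (hS : S.Smooth m δ c₀ τ₀ K a b M h) {f : E d → ℝ} (hf : SmoothBdd f)
    (s : ℕ) (x : E d) : S.L h (S.corr h f (s + 1)) x + ∑ j ∈ Finset.range (s + 1),
      ((s + 1).choose j : ℝ) * S.Li (s + 1 - j) (S.corr h f j) x = 0 := by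
  rw [corr_succ]
  exact (hS.sol_spec (SmoothBdd.sum _ fun j _ => (hS.smoothBdd_Li _
        (hS.smoothBdd_corr hf j)).const_mul _)).2 x

theorem Smooth.corr_odd (hS : S.Smooth m δ c₀ τ₀ K a b M h) (hsym : S.Symm) (hp : S.AntisymmP)
    {f : E d → ℝ} (hf : SmoothBdd f) (s : ℕ) (hs : Odd s) : S.corr h f s = fun _ => 0 := by
  induction s using Nat.strong_induction_on with
  | _ s ih =>
    rcases s with _ | s
    · exact absurd hs (by decide)
    · refine hS.ell.unique (f := fun _ => 0) ⟨⟨0, fun x => by simp⟩, fun x => by rw [L_zero]; simp⟩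
        ⟨(hS.smoothBdd_corr hf _).bdd, fun x => ?_⟩
      have h1 := hS.L_corr_succ hf s x
      rw [Finset.sum_eq_zero] at h1
      · exact h1
      · intro j hj
        have hj' := Finset.mem_range.1 hj
        rcases Nat.even_or_odd j with he | ho
        · rw [Li_odd hsym hp (hS.smoothBdd_corr hf j), mul_zero]
          exact Nat.Odd.sub_even hj'.le hs he
        · rw [ih j hj' ho, Li_zero, mul_zero]

theorem bd_corr (d m : ℕ) {δ c₀ τ₀ K : ℝ} (a b M : ℝ) (hδ : 0 < δ) (hδ1 : δ ≤ 1) (hc₀ : 0 < c₀)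
    (hτ₀ : 0 < τ₀) (hK : 0 ≤ K) (s : ℕ) :
    ∃ N : ℝ, 0 ≤ N ∧ ∀ (S : Scheme d) (h : ℝ) (f : E d → ℝ) (F : ℝ) (ℓ : ℕ), S.Loss ℓ → ℓ * s ≤ m →
      S.Smooth m δ c₀ τ₀ K a b M h → SmoothBdd f → (∀ j ≤ m, Bd j F f) →
      ∀ r, r + ℓ * s ≤ m → Bd r (N * F) (S.corr h f s) := by
  obtain ⟨N₀, hN₀, hap⟩ := apriori d m a b M hδ hδ1 hc₀ hτ₀ hK
  induction s using Nat.strong_induction_on with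
  | _ s ih =>
    rcases s with _ | s
    · refine ⟨N₀, hN₀, fun S h f F ℓ hℓ _ hS hf hF r hr => ?_⟩
      rw [mul_zero, add_zero] at hr
      exact hap S h _ f F m le_rfl hS (hS.smoothBdd_corr hf 0) hf (hS.L_corr_zero hf) hF r hr
    · have : ∀ j, ∃ N : ℝ, 0 ≤ N ∧ (j < s + 1 → ∀ (S : Scheme d) (h : ℝ) (f : E d → ℝ) (F : ℝ)
          (ℓ : ℕ), S.Loss ℓ → ℓ * j ≤ m →
          S.Smooth m δ c₀ τ₀ K a b M h → SmoothBdd f → (∀ j ≤ m, Bd j F f) →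
          ∀ r, r + ℓ * j ≤ m → Bd r (N * F) (S.corr h f j)) := fun j => by
        by_cases hj : j < s + 1
        · obtain ⟨N, hN, H⟩ := ih j hj
          exact ⟨N, hN, fun _ => H⟩
        · exact ⟨0, le_rfl, fun h => absurd h hj⟩
      choose N hN H using this
      set D := ∑ j ∈ Finset.range (s + 1), |((s + 1).choose j : ℝ)| *
        (2 ^ m * |M| * (|a| ^ (s - j + 3) + |a| ^ (s - j + 2)) * N j) with hD
      have hD0 : 0 ≤ D := Finset.sum_nonneg fun j _ => by
        have := hN j
        positivity
      refine ⟨N₀ * D, by positivity, fun S h f F ℓ hℓ hsm hS hf hF r hr => ?_⟩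
      have hF0 := (hF 0 (Nat.zero_le _)).nonneg
      have hM := hS.M_nonneg
      have ha := hS.a_nonneg
      have hcs := hS.smoothBdd_corr hf
      rw [mul_assoc]
      refine hap S h _ _ (D * F) (m - ℓ * (s + 1)) (Nat.sub_le _ _) hS (hcs (s + 1))
        (SmoothBdd.sum _ fun j _ => (hS.smoothBdd_Li _ (hcs j)).const_mul _)
        (hS.L_corr_succ hf s) (fun r hr => ?_) r (by omega)
      have h1 : ∀ j ∈ Finset.range (s + 1), Bd r (|((s + 1).choose j : ℝ)| *
          (2 ^ m * |M| * (|a| ^ (s - j + 3) + |a| ^ (s - j + 2)) * N j) * F)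
          (fun x => ((s + 1).choose j : ℝ) * S.Li (s + 1 - j) (S.corr h f j) x) := by
        intro j hj
        have hj' := Finset.mem_range.1 hj
        have hmul : ℓ * (s - j + 1) + ℓ * j = ℓ * (s + 1) := by
          rw [← mul_add]; congr 1; omega
        have e := hS.bd_Li hℓ (hcs j) (i := s - j) (r := r) (by omega) (B := N j * F)
          (fun t ht => H j hj' S h f F ℓ hℓ (by omega) hS hf hF t (by omega))
        rw [show s - j + 1 = s + 1 - j by omega] at e
        refine (e.const_mul (hS.smoothBdd_Li _ (hcs j)).1 _).mono ?_
        rw [mul_assoc |((s + 1).choose j : ℝ)|]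
        refine mul_le_mul_of_nonneg_left ?_ (abs_nonneg _)
        rw [abs_of_nonneg hM, abs_of_nonneg ha]
        have h2 : (2 : ℝ) ^ r ≤ 2 ^ m := pow_le_pow_right₀ (by norm_num) (by omega)
        have := hN j
        calc 2 ^ r * M * (a ^ (s - j + 3) + a ^ (s - j + 2)) * (N j * F)
            = 2 ^ r * (M * (a ^ (s - j + 3) + a ^ (s - j + 2)) * (N j * F)) := by ring
          _ ≤ 2 ^ m * (M * (a ^ (s - j + 3) + a ^ (s - j + 2)) * (N j * F)) := by gcongr
          _ = _ := by ring
      have := Bd.sum (Finset.range (s + 1)) (fun j _ => ((hS.smoothBdd_Li _ (hcs j)).const_mul _).1)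
        h1
      rwa [← Finset.sum_mul] at this

/-- The error of the expansion in powers of the step. -/
theorem Smooth.expansion {h' : ℝ} (hS : S.Smooth m δ c₀ τ₀ K a b M h)
    (hS' : S.Smooth m δ c₀ τ₀ K a b M h') {f v : E d → ℝ} (hf : SmoothBdd f)
    (hv : S.IsDiscreteSol h f v) {k : ℕ} {G : ℝ}
    (hG : ∀ j ≤ k, ∀ r ≤ k - j + 3, Bd r G (S.corr h' f j)) (x : E d) :
    |v x - ∑ j ∈ Finset.range (k + 1), h ^ j / (j.factorial : ℝ) * S.corr h' f j x|
      ≤ ((∑ j ∈ Finset.range (k + 1), M * (a ^ (k - j + 3) + a ^ (k - j + 2))) / c₀) * G * h ^ (k + 1)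
        + h' * ((M * (a ^ 3 + a ^ 2) / c₀ * G) * ∑ j ∈ Finset.range (k + 1), h ^ j) := by
  have hh := hS.ell.h_pos
  have hM := hS.M_nonneg
  have ha := hS.a_nonneg
  have hG0 := (hG 0 (Nat.zero_le _) 0 (Nat.zero_le _)).nonneg
  have hcs := hS'.smoothBdd_corr hf
  set w : E d → ℝ := fun x => v x - ∑ j ∈ Finset.range (k + 1),
    h ^ j / (j.factorial : ℝ) * S.corr h' f j x with hw
  have hsum : SmoothBdd (fun x => ∑ j ∈ Finset.range (k + 1),
    h ^ j / (j.factorial : ℝ) * S.corr h' f j x) := SmoothBdd.sum _ fun j _ => (hcs j).const_mul _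
  have hwb : ∃ C, ∀ x, |w x| ≤ C := by
    obtain ⟨C, hC⟩ := hv.1
    obtain ⟨D, hD⟩ := hsum.bdd
    exact ⟨C + D, fun x => (abs_sub _ _).trans (add_le_add (hC x) (hD x))⟩
  set T : ℕ → ℝ := fun s => M * (a ^ (s + 3) + a ^ (s + 2)) with hT
  have hT0 : ∀ s, 0 ≤ T s := fun s => by simp only [hT]; positivity
  have key : ∀ x, |S.L h w x| ≤ (∑ j ∈ Finset.range (k + 1), T (k - j)) * G * h ^ (k + 1)
      + h' * ((T 0 * G) * ∑ j ∈ Finset.range (k + 1), h ^ j) := by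
    intro x
    set ρ : ℕ → ℝ := fun j => S.L h (S.corr h' f j) x
      - (∑ i ∈ Finset.range (k - j + 1), h ^ i / (i.factorial : ℝ) * S.Li i (S.corr h' f j) x
        - S.c x * S.corr h' f j x) with hρ
    set σ : ℕ → ℝ := fun j => S.L h' (S.corr h' f j) x
      - (S.Li 0 (S.corr h' f j) x - S.c x * S.corr h' f j x) with hσ
    have hρb : ∀ j ≤ k, |ρ j| ≤ h ^ (k - j + 1) * (T (k - j) * G) := fun j hj =>
      hS.taylor_L (hcs j) (k - j) (hG j hj _ (by omega)) (hG j hj _ (by omega)) x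
    have hσb : ∀ j ≤ k, |σ j| ≤ h' * (T 0 * G) := fun j hj => by
      have := hS'.taylor_L (hcs j) 0 (hG j hj _ (by omega)) (hG j hj _ (by omega)) x
      simpa [hσ, hT] using this
    have hL : S.L h w x = -(∑ j ∈ Finset.range (k + 1), h ^ j / (j.factorial : ℝ) * ρ j)
        + ∑ j ∈ Finset.range (k + 1), h ^ j / (j.factorial : ℝ) * σ j := by
      have e1 : S.L h w x = S.L h v x - ∑ j ∈ Finset.range (k + 1),
          h ^ j / (j.factorial : ℝ) * S.L h (S.corr h' f j) x := by
        rw [hw, L_sub, L_sum]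
        congr 1
        exact Finset.sum_congr rfl fun j _ => S.L_const_mul h _ _ x
      have e2 : ∀ j ∈ Finset.range (k + 1), h ^ j / (j.factorial : ℝ) * S.L h (S.corr h' f j) x
          = h ^ j / (j.factorial : ℝ) * ρ j
            + ∑ i ∈ Finset.range (k + 1 - j), h ^ j / (j.factorial : ℝ) *
              (h ^ i / (i.factorial : ℝ) * S.Li i (S.corr h' f j) x)
            - h ^ j / (j.factorial : ℝ) * (S.c x * S.corr h' f j x) := by
        intro j hj
        have hj' := Finset.mem_range.1 hj
        rw [show k + 1 - j = k - j + 1 by omega, ← Finset.mul_sum]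
        simp only [hρ]
        ring
      have e3 : ∀ s ∈ Finset.range (k + 1), ∑ j ∈ Finset.range (s + 1), h ^ j / (j.factorial : ℝ) *
          (h ^ (s - j) / ((s - j).factorial : ℝ) * S.Li (s - j) (S.corr h' f j) x)
          = h ^ s / (s.factorial : ℝ) * (S.c x * S.corr h' f s x - σ s - if s = 0 then f x else 0) := by
        intro s _
        have g1 : ∀ j ∈ Finset.range (s + 1), h ^ j / (j.factorial : ℝ) *
          (h ^ (s - j) / ((s - j).factorial : ℝ) * S.Li (s - j) (S.corr h' f j) x)
          = h ^ s / (s.factorial : ℝ) * ((s.choose j : ℝ) * S.Li (s - j) (S.corr h' f j) x) := by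
          intro j hj
          have hj' : j ≤ s := Nat.lt_succ_iff.1 (Finset.mem_range.1 hj)
          rw [Nat.cast_choose ℝ hj']
          have p1 : h ^ s = h ^ j * h ^ (s - j) := by rw [← pow_add]; congr 1; omega
          rw [p1]
          have : (s.factorial : ℝ) ≠ 0 := by positivity
          have : (j.factorial : ℝ) ≠ 0 := by positivity
          have : ((s - j).factorial : ℝ) ≠ 0 := by positivity
          field_simp
        rw [Finset.sum_congr rfl g1, ← Finset.mul_sum, Finset.sum_range_succ]
        congr 1
        simp only [Nat.choose_self, Nat.cast_one, one_mul, Nat.sub_self, hσ]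
        rcases s with _ | s
        · have := hS'.L_corr_zero hf x
          simp only [Finset.range_zero, Finset.sum_empty, if_true]
          linarith
        · have := hS'.L_corr_succ hf s x
          simp only [Nat.succ_ne_zero, if_false]
          linarith
      have e4 := Finset.sum_range_diag_flip (k + 1) (fun j i => h ^ j / (j.factorial : ℝ) *
          (h ^ i / (i.factorial : ℝ) * S.Li i (S.corr h' f j) x))
      rw [Finset.sum_congr rfl e3] at e4
      rw [e1, Finset.sum_congr rfl e2, Finset.sum_sub_distrib, Finset.sum_add_distrib, ← e4]
      have e5 : ∑ s ∈ Finset.range (k + 1), h ^ s / (s.factorial : ℝ) *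
          (S.c x * S.corr h' f s x - σ s - if s = 0 then f x else 0)
          = ∑ s ∈ Finset.range (k + 1), h ^ s / (s.factorial : ℝ) * (S.c x * S.corr h' f s x)
            - ∑ s ∈ Finset.range (k + 1), h ^ s / (s.factorial : ℝ) * σ s - f x := by
        simp only [mul_sub, Finset.sum_sub_distrib]
        congr 1
        rw [Finset.sum_eq_single 0]
        · simp
        · intro s _ hs
          simp [hs]
        · intro h0
          simp at h0
      rw [e5]
      have := hv.2 x
      linarith
    have hfac : ∀ j : ℕ, h ^ j / (j.factorial : ℝ) ≤ h ^ j := fun j =>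
      div_le_self (by positivity) (by exact_mod_cast Nat.succ_le_of_lt (Nat.factorial_pos j))
    rw [hL]
    refine (abs_add_le _ _).trans (add_le_add ?_ ?_)
    · rw [abs_neg, Finset.sum_mul, Finset.sum_mul]
      refine (Finset.abs_sum_le_sum_abs _ _).trans (Finset.sum_le_sum fun j hj => ?_)
      have hj' : j ≤ k := Nat.lt_succ_iff.1 (Finset.mem_range.1 hj)
      rw [abs_mul, abs_of_nonneg (by positivity : 0 ≤ h ^ j / (j.factorial : ℝ))]
      refine (mul_le_mul (hfac j) (hρb j hj') (abs_nonneg _) (by positivity)).trans (le_of_eq ?_)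
      rw [← mul_assoc, ← pow_add, show j + (k - j + 1) = k + 1 by omega]
      ring
    · rw [Finset.mul_sum, Finset.mul_sum]
      refine (Finset.abs_sum_le_sum_abs _ _).trans (Finset.sum_le_sum fun j hj => ?_)
      have hj' : j ≤ k := Nat.lt_succ_iff.1 (Finset.mem_range.1 hj)
      rw [abs_mul, abs_of_nonneg (by positivity : 0 ≤ h ^ j / (j.factorial : ℝ))]
      refine (mul_le_mul (hfac j) (hσb j hj') (abs_nonneg _) (by positivity)).trans (le_of_eq ?_)
      ring
  refine (hS.ell.abs_le_of_L hwb key x).trans (le_of_eq ?_)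
  simp only [hT, zero_add]
  have := hS.ell.c₀_pos.ne'
  field_simp

end Scheme

end

end EllipticFD

namespace EllipticFD

noncomputable section

open Filter Topology

variable {d : ℕ}

/-! ### Iterated partial derivatives along lists of indices -/

/-- `D_{i₁} ⋯ D_{iₙ} φ` for `I = [i₁, …, iₙ]`. -/
def DL (I : List (Fin d)) (φ : E d → ℝ) : E d → ℝ := I.foldr partialD φ

@[simp] theorem DL_nil (φ : E d → ℝ) : DL [] φ = φ := rfl

@[simp] theorem DL_cons (i : Fin d) (I : List (Fin d)) (φ : E d → ℝ) :
    DL (i :: I) φ = partialD i (DL I φ) := rfl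

theorem DL_append (J I : List (Fin d)) (φ : E d → ℝ) : DL (J ++ I) φ = DL J (DL I φ) := by
  simp [DL, List.foldr_append]

theorem smooth_DL {φ : E d → ℝ} (hφ : ContDiff ℝ ∞ φ) (I : List (Fin d)) :
    ContDiff ℝ ∞ (DL I φ) := by
  induction I with
  | nil => exact hφ
  | cons i I ih => exact smooth_partialD ih i

theorem SmoothBdd.DL {φ : E d → ℝ} (hφ : SmoothBdd φ) (I : List (Fin d)) :
    SmoothBdd (DL I φ) := by
  induction I with
  | nil => exact hφ
  | cons i I ih => exact ih.partialD i

theorem Bd.DL {φ : E d → ℝ} (hφ : SmoothBdd φ) {B : ℝ} (I : List (Fin d)) {k : ℕ}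
    (h : Bd (k + I.length) B φ) : Bd k B (EllipticFD.DL I φ) := by
  induction I generalizing k with
  | nil => exact h
  | cons i I ih =>
    refine Bd.partialD (hφ.DL I).1 (ih ?_) i
    rwa [List.length_cons, add_comm I.length, ← add_assoc] at h

theorem bd_of_DL {φ : E d → ℝ} (hφ : ContDiff ℝ ∞ φ) {B : ℝ} {k : ℕ}
    (h : ∀ I : List (Fin d), I.length = k → ∀ x, |DL I φ x| ≤ B) : Bd k (d ^ k * B) φ := by
  induction k generalizing φ with
  | zero => simpa using bd_zero_iff.2 (h [] rfl)
  | succ k ih =>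
    have := bd_succ_of_partialD hφ fun i => ih (smooth_partialD hφ i) fun I hI x => by
      have := h (I ++ [i]) (by simp [hI]) x
      rwa [DL_append] at this
    refine this.mono (le_of_eq ?_)
    ring

theorem DL_perm {φ : E d → ℝ} (hφ : ContDiff ℝ ∞ φ) {I J : List (Fin d)} (h : I.Perm J) :
    DL I φ = DL J φ := by
  induction h with
  | nil => rfl
  | cons i _ ih => rw [DL_cons, DL_cons, ih]
  | swap i j I =>
    simp only [DL_cons, partialD_eq_dirD]
    exact dirD_comm (smooth_DL hφ I) _ _
  | trans _ _ h₁ h₂ => exact h₁.trans h₂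

/-- The nondecreasing list of indices in which `i` occurs `α i` times. -/
def multiList (α : Fin d → ℕ) : List (Fin d) :=
  (List.finRange d).flatMap fun i => List.replicate (α i) i

theorem DL_replicate (n : ℕ) (i : Fin d) (φ : E d → ℝ) :
    DL (List.replicate n i) φ = (partialD i)^[n] φ := by
  induction n with
  | zero => rfl
  | succ n ih => rw [List.replicate_succ, DL_cons, ih, Function.iterate_succ_apply']

theorem multiD_eq_DL_multiList (α : Fin d → ℕ) (φ : E d → ℝ) :
    multiD α φ = DL (multiList α) φ := by
  have : ∀ L : List (Fin d), L.foldr (fun i g => (partialD i)^[α i] g) φ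
      = DL (L.flatMap fun i => List.replicate (α i) i) φ := by
    intro L
    induction L with
    | nil => rfl
    | cons i L ih => rw [List.foldr_cons, ih, List.flatMap_cons, DL_append, DL_replicate]
  exact this _

theorem count_multiList (α : Fin d → ℕ) (i : Fin d) : (multiList α).count i = α i := by
  rw [multiList, List.count_flatMap]
  have : (List.count i ∘ fun j => List.replicate (α j) j) = fun j => if j = i then α j else 0 := by
    funext j
    simp [List.count_replicate]
  rw [this, ← Fin.sum_univ_def]
  simp

theorem sum_count (I : List (Fin d)) : ∑ i, I.count i = I.length := by
  induction I with
  | nil => simp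
  | cons j I ih =>
    simp only [List.count_cons, Finset.sum_add_distrib, ih, List.length_cons]
    simp

theorem multiList_count_perm (I : List (Fin d)) : (multiList fun i => I.count i).Perm I :=
  List.perm_iff_count.2 fun i => count_multiList _ i

theorem multiD_count {φ : E d → ℝ} (hφ : ContDiff ℝ ∞ φ) (I : List (Fin d)) :
    multiD (fun i => I.count i) φ = DL I φ := by
  rw [multiD_eq_DL_multiList, DL_perm hφ (multiList_count_perm I)]

theorem exists_list_count (α : Fin d → ℕ) :
    ∃ I : List (Fin d), (fun i => I.count i) = α ∧ I.length = ∑ i, α i := by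
  have h : (fun i => (multiList α).count i) = α := funext (count_multiList α)
  exact ⟨multiList α, h, by rw [← sum_count]; exact Finset.sum_congr rfl fun i _ => congrFun h i⟩

theorem hasCompactSupport_DL {φ : E d → ℝ} (hφ : HasCompactSupport φ) (I : List (Fin d)) :
    HasCompactSupport (DL I φ) := by
  induction I with
  | nil => exact hφ
  | cons i I ih => exact ih.fderiv_apply (𝕜 := ℝ) _

/-! ### Limits along an ultrafilter -/

/-- The limit of a bounded sequence along a fixed nonprincipal ultrafilter. -/
def ulim (u : ℕ → ℝ) : ℝ := limUnder (hyperfilter ℕ : Filter ℕ) u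

theorem tendsto_ulim {u : ℕ → ℝ} {C : ℝ} (h : ∀ n, |u n| ≤ C) :
    Tendsto u (hyperfilter ℕ : Filter ℕ) (𝓝 (ulim u)) := by
  refine tendsto_nhds_limUnder ?_
  obtain ⟨x, -, hx⟩ := (isCompact_Icc (a := -C) (b := C)).ultrafilter_le_nhds
    ((hyperfilter ℕ).map u) (by
      rw [Ultrafilter.coe_map, Filter.le_principal_iff]
      exact Filter.mem_map.2 (Filter.univ_mem' fun n => abs_le.1 (h n)))
  exact ⟨x, hx⟩

theorem tendsto_hyperfilter {X : Type*} {u : ℕ → X} {l : Filter X} (h : Tendsto u atTop l) :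
    Tendsto u (hyperfilter ℕ : Filter ℕ) l := h.mono_left Nat.hyperfilter_le_atTop

theorem tendsto_hyperfilter_inv (a : ℝ) :
    Tendsto (fun n : ℕ => a / ((n : ℝ) + 1)) (hyperfilter ℕ : Filter ℕ) (𝓝 0) :=
  tendsto_hyperfilter (by
    simpa [div_eq_mul_inv] using
      (tendsto_one_div_add_atTop_nhds_zero_nat (𝕜 := ℝ)).const_mul a)

theorem abs_ulim_le {u : ℕ → ℝ} {C : ℝ} (h : ∀ n, |u n| ≤ C) : |ulim u| ≤ C :=
  le_of_tendsto (tendsto_ulim h).abs (Eventually.of_forall h)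

/-- The pointwise limits of `D_I (u n)`. -/
def ulimD (u : ℕ → E d → ℝ) (I : List (Fin d)) (x : E d) : ℝ := ulim fun n => DL I (u n) x

section ulimD

variable {u : ℕ → E d → ℝ} {m : ℕ} {C : ℝ}

theorem abs_DL_le (hu : ∀ n, SmoothBdd (u n)) (hb : ∀ n, ∀ j ≤ m, Bd j C (u n))
    {I : List (Fin d)} (hI : I.length ≤ m) (n : ℕ) (x : E d) : |DL I (u n) x| ≤ C :=
  (Bd.DL (hu n) I (by simpa using hb n _ hI)).abs_le x

theorem tendsto_ulimD (hu : ∀ n, SmoothBdd (u n)) (hb : ∀ n, ∀ j ≤ m, Bd j C (u n))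
    {I : List (Fin d)} (hI : I.length ≤ m) (x : E d) :
    Tendsto (fun n => DL I (u n) x) (hyperfilter ℕ : Filter ℕ) (𝓝 (ulimD u I x)) :=
  tendsto_ulim fun n => abs_DL_le hu hb hI n x

theorem abs_ulimD_le (hu : ∀ n, SmoothBdd (u n)) (hb : ∀ n, ∀ j ≤ m, Bd j C (u n))
    {I : List (Fin d)} (hI : I.length ≤ m) (x : E d) : |ulimD u I x| ≤ C :=
  abs_ulim_le fun n => abs_DL_le hu hb hI n x

theorem lipschitz_ulimD (hu : ∀ n, SmoothBdd (u n)) (hb : ∀ n, ∀ j ≤ m, Bd j C (u n))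
    {I : List (Fin d)} (hI : I.length + 1 ≤ m) : LipschitzWith C.toNNReal (ulimD u I) := by
  have hC : 0 ≤ C := (hb 0 0 (Nat.zero_le _)).nonneg
  refine LipschitzWith.of_dist_le_mul fun y x => ?_
  rw [Real.dist_eq, dist_eq_norm, Real.coe_toNNReal C hC]
  refine le_of_tendsto ((tendsto_ulimD hu hb (by omega) y).sub
    (tendsto_ulimD hu hb (by omega) x)).abs (Eventually.of_forall fun n => ?_)
  have h1 : Bd 1 C (DL I (u n)) := Bd.DL (hu n) I (hb n _ (by omega))
  have h2 := taylor_dirD ((hu n).DL I) (y - x) x 1 h1 zero_le_one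
  simp only [one_smul, add_sub_cancel, Finset.range_one, Finset.sum_singleton, pow_zero, pow_one,
    Nat.factorial, Nat.cast_one, div_one, one_mul, Function.iterate_zero, id_eq] at h2
  linarith

theorem hasFDerivAt_of_sq {g : E d → ℝ} {D : Fin d → ℝ} {C : ℝ} {x : E d}
    (h : ∀ v, |g (x + v) - g x - ∑ i, v i * D i| ≤ C * ‖v‖ ^ 2) :
    DifferentiableAt ℝ g x ∧ ∀ i, partialD i g x = D i := by
  set A : E d →L[ℝ] ℝ := ∑ i, D i • (EuclideanSpace.proj i : E d →L[ℝ] ℝ) with hA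
  have hAv : ∀ v : E d, A v = ∑ i, v i * D i := fun v => by
    simp [hA, mul_comm]
  have hd : HasFDerivAt g A x := by
    rw [hasFDerivAt_iff_isLittleO_nhds_zero]
    refine Asymptotics.IsBigO.trans_isLittleO (g := fun v : E d => ‖v‖ ^ 2) ?_
      (Asymptotics.isLittleO_norm_pow_id one_lt_two)
    refine Asymptotics.IsBigO.of_bound C (Eventually.of_forall fun v => ?_)
    rw [hAv, Real.norm_eq_abs, norm_pow, norm_norm]
    exact h v
  refine ⟨hd.differentiableAt, fun i => ?_⟩
  rw [partialD, hd.fderiv, hAv]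
  simp

theorem differentiable_ulimD (hu : ∀ n, SmoothBdd (u n)) (hb : ∀ n, ∀ j ≤ m, Bd j C (u n))
    {I : List (Fin d)} (hI : I.length + 2 ≤ m) (x : E d) :
    DifferentiableAt ℝ (ulimD u I) x ∧ ∀ i, partialD i (ulimD u I) x = ulimD u (i :: I) x := by
  refine hasFDerivAt_of_sq (C := C) fun v => ?_
  refine le_of_tendsto (((tendsto_ulimD hu hb (by omega) (x + v)).sub
    (tendsto_ulimD hu hb (by omega) x)).sub (tendsto_finsetSum _ fun i _ =>
      (tendsto_ulimD hu hb (by simp; omega) x).const_mul (v i))).abs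
        (Eventually.of_forall fun n => ?_)
  have h1 : Bd 2 C (DL I (u n)) := Bd.DL (hu n) I (hb n _ (by omega))
  have h2 := taylor_dirD ((hu n).DL I) v x 2 h1 zero_le_one
  simp only [one_smul, Finset.sum_range_succ, Finset.sum_range_zero, zero_add, one_pow,
    Nat.factorial, Nat.cast_one, div_one, one_mul, Function.iterate_zero, id_eq, mul_one,
    Function.iterate_one] at h2
  rw [dirD, fderiv_eq_sum_partialD, ← sub_sub] at h2
  rw [mul_comm C]
  exact h2

theorem continuous_ulimD (hu : ∀ n, SmoothBdd (u n)) (hb : ∀ n, ∀ j ≤ m, Bd j C (u n))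
    {I : List (Fin d)} (hI : I.length + 1 ≤ m) : Continuous (ulimD u I) :=
  (lipschitz_ulimD hu hb hI).continuous

/-! ### Generalized derivatives of the limits -/

/-- Versions of the generalized derivatives of `ulimD u []`. -/
def ulimW (u : ℕ → E d → ℝ) : List (Fin d) → E d → ℝ
  | [] => ulimD u []
  | i :: I => fun x => lineDeriv ℝ (ulimD u I) x (EuclideanSpace.single i 1)

theorem ulimW_eq (hu : ∀ n, SmoothBdd (u n)) (hb : ∀ n, ∀ j ≤ m, Bd j C (u n))
    {I : List (Fin d)} (hI : I.length + 1 ≤ m) : ulimW u I = ulimD u I := by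
  cases I with
  | nil => rfl
  | cons i I =>
    funext x
    obtain ⟨h1, h2⟩ := differentiable_ulimD hu hb (I := I) (by simp at hI; omega) x
    rw [← h2 i]
    exact h1.lineDeriv_eq_fderiv

theorem integral_ulimW_mul_partialD (hu : ∀ n, SmoothBdd (u n)) (hb : ∀ n, ∀ j ≤ m, Bd j C (u n))
    {I : List (Fin d)} (hI : I.length + 1 ≤ m) (j : Fin d) {φ : E d → ℝ} (hφ : ContDiff ℝ ∞ φ)
    (hc : HasCompactSupport φ) :
    ∫ x, ulimW u I x * partialD j φ x = -∫ x, ulimW u (j :: I) x * φ x := by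
  obtain ⟨D, hD⟩ := hφ.lipschitzWith_of_hasCompactSupport hc (by simp)
  have h := (lipschitz_ulimD hu hb hI).integral_lineDeriv_mul_eq (μ := volume) hD hc
    (EuclideanSpace.single j 1)
  rw [ulimW_eq hu hb hI]
  simp only [ulimW]
  rw [h, ← integral_neg]
  congr 1 with x
  rw [((smooth_differentiable hφ) x).lineDeriv_eq_fderiv, map_neg, partialD]
  ring

theorem integral_ulimW_mul_DL (hu : ∀ n, SmoothBdd (u n)) (hb : ∀ n, ∀ j ≤ m, Bd j C (u n))
    (J : List (Fin d)) {I : List (Fin d)} (hI : I.length + J.length ≤ m) {φ : E d → ℝ}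
    (hφ : ContDiff ℝ ∞ φ) (hc : HasCompactSupport φ) :
    ∫ x, ulimW u I x * DL J φ x = (-1) ^ J.length * ∫ x, ulimW u (J.reverse ++ I) x * φ x := by
  induction J generalizing I with
  | nil => simp
  | cons j J ih =>
    rw [DL_cons, integral_ulimW_mul_partialD hu hb (by simp at hI; omega) j (smooth_DL hφ J)
      (hasCompactSupport_DL hc J), ih (by simp at hI ⊢; omega)]
    simp only [List.reverse_cons, List.append_assoc, List.cons_append, List.nil_append,
      List.length_cons, pow_succ]
    ring

theorem abs_ulimW_le (hu : ∀ n, SmoothBdd (u n)) (hb : ∀ n, ∀ j ≤ m, Bd j C (u n))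
    {I : List (Fin d)} (hI : I.length ≤ m) (x : E d) : |ulimW u I x| ≤ C := by
  have hC : 0 ≤ C := (hb 0 0 (Nat.zero_le _)).nonneg
  cases I with
  | nil => exact abs_ulimD_le hu hb hI x
  | cons i I =>
    have := norm_lineDeriv_le_of_lipschitz ℝ (v := EuclideanSpace.single i (1 : ℝ)) (x₀ := x)
      (lipschitz_ulimD hu hb (I := I) (by simpa using hI))
    simpa [ulimW, Real.coe_toNNReal C hC] using this

theorem measurable_ulimW (hu : ∀ n, SmoothBdd (u n)) (hb : ∀ n, ∀ j ≤ m, Bd j C (u n)) (hm : 1 ≤ m)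
    {I : List (Fin d)} (hI : I.length ≤ m) : Measurable (ulimW u I) := by
  cases I with
  | nil => exact (continuous_ulimD hu hb (by simpa using hm)).measurable
  | cons i I => exact measurable_lineDeriv (continuous_ulimD hu hb (I := I) (by simpa using hI))

theorem isBddWeakDeriv_ulimW (hu : ∀ n, SmoothBdd (u n)) (hb : ∀ n, ∀ j ≤ m, Bd j C (u n))
    (hm : 1 ≤ m) {I : List (Fin d)} (hI : I.length ≤ m) :
    IsBddWeakDeriv (fun i => I.count i) (ulimD u []) (ulimW u I) := by
  refine ⟨measurable_ulimW hu hb hm hI, ⟨C, abs_ulimW_le hu hb hI⟩, fun φ hφ hc => ?_⟩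
  have h := integral_ulimW_mul_DL hu hb I.reverse (I := []) (by simpa using hI) hφ hc
  rw [multiD_count hφ, DL_perm hφ I.reverse_perm.symm, sum_count]
  rw [List.reverse_reverse, List.append_nil, List.length_reverse] at h
  exact h

theorem memB_ulimD (hu : ∀ n, SmoothBdd (u n)) (hb : ∀ n, ∀ j ≤ m, Bd j C (u n)) (hm : 1 ≤ m) :
    MemB m (ulimD u []) := by
  refine ⟨continuous_ulimD hu hb (by simpa using hm), ⟨C, abs_ulimD_le hu hb (by simp)⟩,
    fun α hα => ?_⟩
  obtain ⟨I, rfl, hI⟩ := exists_list_count α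
  exact ⟨_, isBddWeakDeriv_ulimW hu hb hm (hI.trans_le hα)⟩

end ulimD

theorem locallyIntegrable_of_bdd {g : E d → ℝ} (hg : Measurable g) {C : ℝ} (h : ∀ x, |g x| ≤ C) :
    LocallyIntegrable g := by
  refine (locallyIntegrable_const C).mono hg.aestronglyMeasurable (Eventually.of_forall fun x => ?_)
  rw [Real.norm_eq_abs]
  exact (h x).trans (le_abs_self C)

theorem IsBddWeakDeriv.ae_eq {α : Fin d → ℕ} {u g g' : E d → ℝ} (h : IsBddWeakDeriv α u g)
    (h' : IsBddWeakDeriv α u g') : ∀ᵐ x, g x = g' x := by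
  obtain ⟨hm, ⟨C, hC⟩, hw⟩ := h
  obtain ⟨hm', ⟨C', hC'⟩, hw'⟩ := h'
  refine ae_eq_of_integral_contDiff_smul_eq (locallyIntegrable_of_bdd hm hC)
    (locallyIntegrable_of_bdd hm' hC') fun φ hφ hc => ?_
  have h1 := (hw φ hφ hc).symm.trans (hw' φ hφ hc)
  have h2 := mul_left_cancel₀ (pow_ne_zero _ (by norm_num)) h1
  simpa only [smul_eq_mul, mul_comm] using h2

theorem isBddWeakDeriv_weakD {α : Fin d → ℕ} {u : E d → ℝ} (h : ∃ g, IsBddWeakDeriv α u g) :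
    IsBddWeakDeriv α u (weakD α u) := by
  rw [weakD, dif_pos h]
  exact h.choose_spec

theorem MemB.weakD {m : ℕ} {u : E d → ℝ} (h : MemB m u) {α : Fin d → ℕ} (hα : ∑ i, α i ≤ m) :
    IsBddWeakDeriv α u (EllipticFD.weakD α u) := isBddWeakDeriv_weakD (h.2.2 α hα)

theorem MemB.mono {m n : ℕ} {u : E d → ℝ} (h : MemB m u) (hn : n ≤ m) : MemB n u :=
  ⟨h.1, h.2.1, fun α hα => h.2.2 α (hα.trans hn)⟩

end

end EllipticFD

namespace EllipticFD

noncomputable section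

open Filter Topology

variable {d : ℕ}

/-! ### Weighted averages -/

/-- `v` is the integral of the integrable function `k F`. -/
def HasAvg (k F : E d → ℝ) (v : ℝ) : Prop := Integrable (fun t => k t * F t) ∧ ∫ t, k t * F t = v

section HasAvg

variable {k F G : E d → ℝ} {v w : ℝ}

theorem HasAvg.add (h₁ : HasAvg k F v) (h₂ : HasAvg k G w) :
    HasAvg k (fun t => F t + G t) (v + w) := by
  simp only [HasAvg, mul_add]
  exact ⟨h₁.1.add h₂.1, by rw [integral_add h₁.1 h₂.1, h₁.2, h₂.2]⟩

theorem HasAvg.const_mul (h₁ : HasAvg k F v) (a : ℝ) : HasAvg k (fun t => a * F t) (a * v) := by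
  simp only [HasAvg, mul_left_comm _ a]
  exact ⟨h₁.1.const_mul a, by rw [integral_const_mul, h₁.2]⟩

theorem HasAvg.mul_const (h₁ : HasAvg k F v) (a : ℝ) : HasAvg k (fun t => F t * a) (v * a) := by
  simpa only [mul_comm a] using h₁.const_mul a

theorem HasAvg.sub (h₁ : HasAvg k F v) (h₂ : HasAvg k G w) :
    HasAvg k (fun t => F t - G t) (v - w) := by
  simpa only [neg_one_mul, ← sub_eq_add_neg] using h₁.add (h₂.const_mul (-1))

theorem HasAvg.sum {κ : Type*} (s : Finset κ) {F : κ → E d → ℝ} {v : κ → ℝ}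
    (h : ∀ i ∈ s, HasAvg k (F i) (v i)) : HasAvg k (fun t => ∑ i ∈ s, F i t) (∑ i ∈ s, v i) := by
  simp only [HasAvg, Finset.mul_sum]
  exact ⟨integrable_finsetSum _ fun i hi => (h i hi).1, by
    rw [integral_finsetSum _ fun i hi => (h i hi).1]
    exact Finset.sum_congr rfl fun i hi => (h i hi).2⟩

theorem HasAvg.unique (h₁ : HasAvg k F v) (h₂ : HasAvg k F w) : v = w := h₁.2.symm.trans h₂.2

end HasAvg

/-! ### Convolution with smooth compactly supported kernels -/

/-- `k * g`. -/
def conv (k g : E d → ℝ) : E d → ℝ := fun x => ∫ t, k t * g (x - t)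

theorem conv_eq_convolution (k g : E d → ℝ) :
    conv k g = convolution k g (ContinuousLinearMap.lsmul ℝ ℝ) volume := rfl

theorem BddBorel.locallyIntegrable {g : E d → ℝ} (hg : BddBorel g) : LocallyIntegrable g := by
  obtain ⟨h, C, hC⟩ := hg
  exact locallyIntegrable_of_bdd h hC

section conv

variable {k g : E d → ℝ}

theorem BddBorel.comp_sub (hg : BddBorel g) (x : E d) : BddBorel fun t => g (x - t) :=
  ⟨hg.1.comp (measurable_const.sub measurable_id), hg.2.imp fun _ h _ => h _⟩

theorem BddBorel.integrable_mul (hg : BddBorel g) (hk : Continuous k) (hc : HasCompactSupport k) :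
    Integrable fun t => k t * g t :=
  hg.locallyIntegrable.integrable_smul_left_of_hasCompactSupport hk hc

theorem hasAvg_conv (hk : Continuous k) (hc : HasCompactSupport k) (hg : BddBorel g) (x : E d) :
    HasAvg k (fun t => g (x - t)) (conv k g x) :=
  ⟨(hg.comp_sub x).integrable_mul hk hc, rfl⟩

theorem smooth_conv (hk : ContDiff ℝ ∞ k) (hc : HasCompactSupport k) (hg : BddBorel g) :
    ContDiff ℝ ∞ (conv k g) := by
  rw [conv_eq_convolution]
  exact hc.contDiff_convolution_left _ hk hg.locallyIntegrable

theorem partialD_conv (hk : ContDiff ℝ ∞ k) (hc : HasCompactSupport k) (hg : BddBorel g)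
    (i : Fin d) : partialD i (conv k g) = conv (partialD i k) g := by
  funext x
  have hk1 : ContDiff ℝ 1 k := smooth_at hk 1
  have h := hc.hasFDerivAt_convolution_left (ContinuousLinearMap.lsmul ℝ ℝ) hk1
    hg.locallyIntegrable x
  have hi := (hc.fderiv (𝕜 := ℝ)).convolutionExists_left
    (ContinuousLinearMap.precompL (E d) (ContinuousLinearMap.lsmul ℝ ℝ))
    (hk1.continuous_fderiv (by simp)) hg.locallyIntegrable x
  rw [ConvolutionExistsAt] at hi
  rw [partialD, conv_eq_convolution, h.fderiv]
  unfold convolution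
  rw [ContinuousLinearMap.integral_apply hi]
  simp only [ContinuousLinearMap.precompL_apply, ContinuousLinearMap.lsmul_apply, smul_eq_mul]
  rfl

theorem DL_conv (hk : ContDiff ℝ ∞ k) (hc : HasCompactSupport k) (hg : BddBorel g)
    (I : List (Fin d)) : DL I (conv k g) = conv (DL I k) g := by
  induction I with
  | nil => rfl
  | cons i I ih =>
    rw [DL_cons, ih, partialD_conv (smooth_DL hk I) (hasCompactSupport_DL hc I) hg, DL_cons]

theorem abs_integral_le_of_ae {F : E d → ℝ} {B : ℝ} (hk : Continuous k) (hc : HasCompactSupport k)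
    (h : ∀ᵐ t, k t ≠ 0 → |F t| ≤ B) : |∫ t, k t * F t| ≤ (∫ t, |k t|) * B := by
  rw [← integral_mul_const]
  change ‖∫ t, k t * F t‖ ≤ _
  refine norm_integral_le_of_norm_le ?_ ?_
  · exact ((hk.integrable_of_hasCompactSupport (μ := volume) hc).abs).mul_const B
  · filter_upwards [h] with t ht
    rw [norm_mul, Real.norm_eq_abs, Real.norm_eq_abs]
    by_cases h0 : k t = 0
    · simp [h0]
    · exact mul_le_mul_of_nonneg_left (ht h0) (abs_nonneg _)

theorem smoothBdd_conv (hk : ContDiff ℝ ∞ k) (hc : HasCompactSupport k) (hg : BddBorel g) :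
    SmoothBdd (conv k g) := by
  refine ⟨smooth_conv hk hc hg, fun n => ?_⟩
  obtain ⟨C, hC⟩ := hg.2
  refine ⟨_, bd_of_DL (smooth_conv hk hc hg)
    (B := ∑ I ∈ lists (Finset.univ : Finset (Fin d)) n, (∫ t, |DL I k t|) * |C|)
    fun I hI x => ?_⟩
  rw [DL_conv hk hc hg]
  have h1 : |conv (DL I k) g x| ≤ (∫ t, |DL I k t|) * |C| :=
    abs_integral_le_of_ae (smooth_DL hk I).continuous (hasCompactSupport_DL hc I)
      (Eventually.of_forall fun t _ => (hC _).trans (le_abs_self C))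
  refine h1.trans (Finset.single_le_sum (f := fun I => (∫ t, |DL I k t|) * |C|)
    (fun J _ => mul_nonneg (integral_nonneg fun _ => abs_nonneg _) (abs_nonneg C)) ?_)
  subst hI
  induction I with
  | nil => simp [lists]
  | cons i I ih => exact mem_lists_succ.2 ⟨i, Finset.mem_univ _, I, ih (by
      exact abs_integral_le_of_ae (smooth_DL hk I).continuous (hasCompactSupport_DL hc I)
        (Eventually.of_forall fun t _ => (hC _).trans (le_abs_self C))), rfl⟩

theorem DL_reflect (hk : ContDiff ℝ ∞ k) (x : E d) (I : List (Fin d)) :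
    DL I (fun y => k (x - y)) = fun y => (-1) ^ I.length * DL I k (x - y) := by
  induction I with
  | nil => simp
  | cons i I ih =>
    rw [DL_cons, ih]
    funext y
    have h1 : HasFDerivAt (fun y => DL I k (x - y))
        ((fderiv ℝ (DL I k) (x - y)).comp (-ContinuousLinearMap.id ℝ (E d))) y :=
      (smooth_differentiable (smooth_DL hk I) (x - y)).hasFDerivAt.comp y
        ((hasFDerivAt_id y).const_sub x)
    rw [partialD, (h1.const_mul _).fderiv]
    simp [partialD, pow_succ]

theorem DL_conv_of_weak (hk : ContDiff ℝ ∞ k) (hc : HasCompactSupport k) (hg : BddBorel g)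
    {I : List (Fin d)} {g' : E d → ℝ} (h : IsBddWeakDeriv (fun i => I.count i) g g') :
    DL I (conv k g) = conv k g' := by
  rw [DL_conv hk hc hg]
  funext x
  have hφ : ContDiff ℝ ∞ fun y => k (x - y) := hk.comp (contDiff_const.sub contDiff_id)
  have hφc : HasCompactSupport fun y => k (x - y) :=
    hc.comp_homeomorph (Homeomorph.subLeft x)
  have h1 := h.2.2 _ hφ hφc
  rw [multiD_count hφ, sum_count, DL_reflect hk x I] at h1
  simp only [mul_left_comm _ ((-1 : ℝ) ^ I.length), integral_const_mul] at h1
  have h2 := mul_left_cancel₀ (pow_ne_zero _ (by norm_num)) h1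
  simp only [conv]
  rw [← integral_sub_left_eq_self _ volume x, ← integral_sub_left_eq_self (fun t => k t * _) volume x]
  simp only [sub_sub_cancel]
  simpa only [mul_comm] using h2

end conv

/-! ### Generalized derivatives of linear combinations and of differentiable functions -/

theorem isBddWeakDeriv_sum {κ : Type*} (s : Finset κ) (β : κ → ℝ) {α : Fin d → ℕ}
    {u g : κ → E d → ℝ} (hu : ∀ i ∈ s, BddBorel (u i)) (h : ∀ i ∈ s, IsBddWeakDeriv α (u i) (g i)) :
    IsBddWeakDeriv α (fun x => ∑ i ∈ s, β i * u i x) (fun x => ∑ i ∈ s, β i * g i x) := by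
  refine ⟨Finset.measurable_sum _ fun i hi => (h i hi).1.const_mul _, ?_, fun φ hφ hc => ?_⟩
  · choose! C hC using fun i hi => (h i hi).2.1
    refine ⟨∑ i ∈ s, |β i| * C i, fun x => (Finset.abs_sum_le_sum_abs _ _).trans
      (Finset.sum_le_sum fun i hi => ?_)⟩
    rw [abs_mul]
    exact mul_le_mul_of_nonneg_left (hC i hi x) (abs_nonneg _)
  · have key : ∀ (ψ : E d → ℝ) (w : κ → E d → ℝ), Continuous ψ → HasCompactSupport ψ →
        (∀ i ∈ s, BddBorel (w i)) → ∫ x, (∑ i ∈ s, β i * w i x) * ψ x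
          = ∑ i ∈ s, β i * ∫ x, w i x * ψ x := by
      intro ψ w hψ hψc hw
      simp only [mul_comm _ (ψ _)]
      exact (HasAvg.sum (k := ψ) (F := fun i x => β i * w i x) s fun i hi =>
        HasAvg.const_mul ⟨(hw i hi).integrable_mul hψ hψc, rfl⟩ (β i)).2
    rw [key _ _ (by rw [multiD_eq_DL_multiList]; exact (smooth_DL hφ _).continuous)
      (by rw [multiD_eq_DL_multiList]; exact hasCompactSupport_DL hc _) hu,
      key _ _ hφ.continuous hc fun i hi => ⟨(h i hi).1, (h i hi).2.1⟩, Finset.mul_sum]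
    refine Finset.sum_congr rfl fun i hi => ?_
    rw [(h i hi).2.2 φ hφ hc]
    ring

theorem isBddWeakDeriv_partialD {g : E d → ℝ} {C : NNReal} (hg : LipschitzWith C g)
    (hd : Differentiable ℝ g) (i : Fin d) :
    IsBddWeakDeriv (fun j => [i].count j) g (partialD i g) := by
  have he : partialD i g = fun x => lineDeriv ℝ g x (EuclideanSpace.single i 1) := by
    funext x
    exact (hd x).lineDeriv_eq_fderiv.symm
  refine ⟨?_, ⟨C, fun x => ?_⟩, fun φ hφ hc => ?_⟩
  · rw [he]
    exact measurable_lineDeriv hg.continuous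
  · rw [he]
    simpa using norm_lineDeriv_le_of_lipschitz ℝ (v := EuclideanSpace.single i (1 : ℝ)) (x₀ := x) hg
  · obtain ⟨D, hD⟩ := hφ.lipschitzWith_of_hasCompactSupport hc (by simp)
    have h := hg.integral_lineDeriv_mul_eq (μ := volume) hD hc (EuclideanSpace.single i 1)
    rw [multiD_count hφ, sum_count, he, h]
    simp only [List.length_singleton, pow_one, neg_one_mul, ← integral_neg, DL_cons, DL_nil]
    congr 1 with x
    rw [((smooth_differentiable hφ) x).lineDeriv_eq_fderiv, map_neg, partialD]
    ring

end

end EllipticFD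

namespace EllipticFD

noncomputable section

open Filter Topology

variable {d : ℕ}

/-! ### Mollification -/

/-- `ρ` is a smooth probability density supported in the ball of radius `r`. -/
structure Mollifier (ρ : E d → ℝ) (r : ℝ) : Prop where
  smooth : ContDiff ℝ ∞ ρ
  supp : HasCompactSupport ρ
  nonneg : ∀ t, 0 ≤ ρ t
  integral_eq : ∫ t, ρ t = 1
  small : ∀ t, ρ t ≠ 0 → ‖t‖ ≤ r

/-- The bump functions generating `bump`. -/
def bumpData (d n : ℕ) : ContDiffBump (0 : E d) where
  rIn := 1 / ((n : ℝ) + 1) / 2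
  rOut := 1 / ((n : ℝ) + 1)
  rIn_pos := by positivity
  rIn_lt_rOut := half_lt_self (by positivity)

/-- A standard sequence of mollifiers. -/
def bump (n : ℕ) : E d → ℝ := (bumpData d n).normed volume

theorem mollifier_bump (n : ℕ) : Mollifier (bump n : E d → ℝ) (1 / ((n : ℝ) + 1)) where
  smooth := (bumpData d n).contDiff_normed
  supp := (bumpData d n).hasCompactSupport_normed
  nonneg := (bumpData d n).nonneg_normed
  integral_eq := (bumpData d n).integral_normed
  small t ht := by
    have : t ∈ Function.support (bump n : E d → ℝ) := ht
    rw [bump, (bumpData d n).support_normed_eq, mem_ball_zero_iff] at this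
    exact this.le

theorem tendsto_conv_bump {g : E d → ℝ} (hg : Continuous g) (x : E d) :
    Tendsto (fun n => conv (bump n) g x) (hyperfilter ℕ : Filter ℕ) (𝓝 (g x)) :=
  tendsto_hyperfilter (ContDiffBump.convolution_tendsto_right_of_continuous
    (φ := fun n => bumpData d n) (tendsto_one_div_add_atTop_nhds_zero_nat (𝕜 := ℝ)) hg x)

theorem MemB.bddBorel {m : ℕ} {u : E d → ℝ} (h : MemB m u) : BddBorel u := ⟨h.1.measurable, h.2.1⟩

section Mollifier

variable {ρ : E d → ℝ} {r : ℝ}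

theorem Mollifier.hasAvg_conv (hρ : Mollifier ρ r) {g : E d → ℝ} (hg : BddBorel g) (x : E d) :
    HasAvg ρ (fun t => g (x - t)) (conv ρ g x) :=
  EllipticFD.hasAvg_conv hρ.smooth.continuous hρ.supp hg x

theorem Mollifier.hasAvg_const (hρ : Mollifier ρ r) (c : ℝ) : HasAvg ρ (fun _ => c) c :=
  ⟨(hρ.smooth.continuous.integrable_of_hasCompactSupport hρ.supp).mul_const c, by
    rw [integral_mul_const, hρ.integral_eq, one_mul]⟩

theorem Mollifier.avg_mono (hρ : Mollifier ρ r) {F G : E d → ℝ} {v w : ℝ} (hF : HasAvg ρ F v)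
    (hG : HasAvg ρ G w) (h : ∀ t, F t ≤ G t) : v ≤ w := by
  rw [← hF.2, ← hG.2]
  exact integral_mono hF.1 hG.1 fun t => mul_le_mul_of_nonneg_left (h t) (hρ.nonneg t)

theorem Mollifier.abs_avg_le (hρ : Mollifier ρ r) {F : E d → ℝ} {B v : ℝ} (hF : HasAvg ρ F v)
    (h : ∀ᵐ t, ‖t‖ ≤ r → |F t| ≤ B) : |v| ≤ B := by
  have h1 := abs_integral_le_of_ae hρ.smooth.continuous hρ.supp (F := F) (B := B) (by
    filter_upwards [h] with t ht h0
    exact ht (hρ.small t h0))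
  simp only [abs_of_nonneg (hρ.nonneg _), hρ.integral_eq, one_mul, hF.2] at h1
  exact h1

theorem ae_comp_sub {p : E d → Prop} (h : ∀ᵐ y, p y) (x : E d) : ∀ᵐ t, p (x - t) :=
  (quasiMeasurePreserving_sub_left volume x).ae h

theorem Mollifier.smoothBdd (hρ : Mollifier ρ r) {g : E d → ℝ} (hg : BddBorel g) :
    SmoothBdd (conv ρ g) := smoothBdd_conv hρ.smooth hρ.supp hg

theorem Mollifier.abs_conv_sub_le (hρ : Mollifier ρ r) {g : E d → ℝ} (hg : BddBorel g) {C : NNReal}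
    (hC : LipschitzWith C g) (x : E d) : |conv ρ g x - g x| ≤ C * r := by
  refine hρ.abs_avg_le ((hρ.hasAvg_conv hg x).sub (hρ.hasAvg_const (g x)))
    (Eventually.of_forall fun t ht => ?_)
  have := hC.dist_le_mul (x - t) x
  rw [Real.dist_eq, dist_eq_norm, sub_sub_cancel_left, norm_neg] at this
  exact this.trans (mul_le_mul_of_nonneg_left ht C.2)

theorem Mollifier.bd_sum (hρ : Mollifier ρ r) {κ : Type*} (s : Finset κ) (β : κ → ℝ)
    {u : κ → E d → ℝ} {m k : ℕ} (hu : ∀ l ∈ s, MemB m (u l)) (hk : k ≤ m) {B : ℝ}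
    (h : ∀ α : Fin d → ℕ, ∑ i, α i = k → ∀ᵐ y, |∑ l ∈ s, β l * weakD α (u l) y| ≤ B) :
    Bd k (d ^ k * B) (fun x => ∑ l ∈ s, β l * conv ρ (u l) x) := by
  have hsum : (fun x => ∑ l ∈ s, β l * conv ρ (u l) x)
      = conv ρ fun x => ∑ l ∈ s, β l * u l x := by
    funext x
    exact (HasAvg.sum (F := fun l t => β l * u l (x - t)) s fun l hl =>
      (hρ.hasAvg_conv (hu l hl).bddBorel x).const_mul (β l)).2.symm
  have hb : BddBorel fun x => ∑ l ∈ s, β l * u l x := by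
    refine ⟨Finset.measurable_sum _ fun l hl => (hu l hl).1.measurable.const_mul _, ?_⟩
    choose! C hC using fun l hl => (hu l hl).2.1
    refine ⟨∑ l ∈ s, |β l| * C l, fun x => (Finset.abs_sum_le_sum_abs _ _).trans
      (Finset.sum_le_sum fun l hl => ?_)⟩
    rw [abs_mul]
    exact mul_le_mul_of_nonneg_left (hC l hl x) (abs_nonneg _)
  rw [hsum]
  refine bd_of_DL (hρ.smoothBdd hb).1 fun I hI x => ?_
  have hα : ∑ i, I.count i = k := (sum_count I).trans hI
  have hw := isBddWeakDeriv_sum s β (fun l hl => (hu l hl).bddBorel)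
    (fun l hl => (hu l hl).weakD (hα.trans_le hk))
  rw [DL_conv_of_weak hρ.smooth hρ.supp hb hw]
  refine hρ.abs_avg_le (hρ.hasAvg_conv ⟨hw.1, hw.2.1⟩ x) ?_
  filter_upwards [ae_comp_sub (h _ hα) x] with t ht _
  exact ht

theorem Mollifier.bd (hρ : Mollifier ρ r) {u : E d → ℝ} {m k : ℕ} (hu : MemB m u) (hk : k ≤ m)
    {B : ℝ} (h : ∀ α : Fin d → ℕ, ∑ i, α i = k → ∀ᵐ y, |weakD α u y| ≤ B) :
    Bd k (d ^ k * B) (conv ρ u) := by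
  simpa using hρ.bd_sum (κ := Unit) {()} (fun _ => 1) (u := fun _ => u) (by simpa using hu) hk
    (by simpa using h)

theorem exists_abs_weakD_le {m : ℕ} {u : E d → ℝ} (hu : MemB m u) :
    ∃ C, ∀ α : Fin d → ℕ, ∑ i, α i ≤ m → ∀ y, |weakD α u y| ≤ C := by
  have : ∀ α : Fin d → ℕ, ∃ C, ∑ i, α i ≤ m → ∀ y, |weakD α u y| ≤ C := fun α => by
    by_cases h : ∑ i, α i ≤ m
    · obtain ⟨C, hC⟩ := (hu.weakD h).2.1
      exact ⟨C, fun _ => hC⟩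
    · exact ⟨0, fun h' => absurd h' h⟩
  choose C hC using this
  refine ⟨∑ k ∈ Finset.range (m + 1), ∑ α ∈ Finset.piAntidiag (Finset.univ : Finset (Fin d)) k,
    |C α|, fun α hα y => ((hC α hα y).trans (le_abs_self _)).trans ?_⟩
  refine le_trans ?_ (Finset.single_le_sum (f := fun k =>
    ∑ α ∈ Finset.piAntidiag (Finset.univ : Finset (Fin d)) k, |C α|)
    (fun k _ => Finset.sum_nonneg fun α _ => abs_nonneg _)
    (Finset.mem_range.2 (Nat.lt_succ_of_le hα)))
  exact Finset.single_le_sum (f := fun α => |C α|) (fun α _ => abs_nonneg _)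
    (Finset.mem_piAntidiag.2 ⟨rfl, fun i _ => Finset.mem_univ i⟩)

theorem sq_weakD_le_sqD {u : E d → ℝ} {k : ℕ} {α : Fin d → ℕ} (hα : ∑ i, α i = k) (y : E d) :
    weakD α u y ^ 2 ≤ sqD k u y :=
  Finset.single_le_sum (f := fun α => weakD α u y ^ 2) (fun _ _ => sq_nonneg _)
    (Finset.mem_piAntidiag.2 ⟨hα, fun i _ => Finset.mem_univ i⟩)

theorem sqD_nonneg (k : ℕ) (u : E d → ℝ) (y : E d) : 0 ≤ sqD k u y :=
  Finset.sum_nonneg fun _ _ => sq_nonneg _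

theorem abs_weakD_le_normB {m : ℕ} {u : E d → ℝ} (hu : MemB m u) {α : Fin d → ℕ}
    (hα : ∑ i, α i ≤ m) : ∀ᵐ y, |weakD α u y| ≤ normB m u := by
  obtain ⟨C, hC⟩ := exists_abs_weakD_le hu
  have hb : IsBoundedUnder (· ≤ ·) (ae volume)
      fun x => ∑ k ∈ Finset.range (m + 1), sqD k u x := by
    refine isBoundedUnder_of ⟨∑ k ∈ Finset.range (m + 1),
      ∑ α ∈ Finset.piAntidiag (Finset.univ : Finset (Fin d)) k, C ^ 2, fun x => ?_⟩
    refine Finset.sum_le_sum fun k hk => Finset.sum_le_sum fun α hα => ?_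
    rw [← sq_abs]
    refine pow_le_pow_left₀ (abs_nonneg _) (hC α ?_ x) 2
    have h1 : ∑ i, α i = k := (Finset.mem_piAntidiag.1 hα).1
    have h2 := Finset.mem_range.1 hk
    omega
  filter_upwards [ae_le_essSup hb] with y hy
  refine Real.abs_le_sqrt (le_trans ?_ hy)
  exact (sq_weakD_le_sqD rfl y).trans (Finset.single_le_sum (f := fun k => sqD k u y)
    (fun k _ => sqD_nonneg k u y) (Finset.mem_range.2 (Nat.lt_succ_of_le hα)))

theorem pow_le_succ_pow {d k m : ℕ} (hk : k ≤ m) : (d : ℝ) ^ k ≤ ((d : ℝ) + 1) ^ m :=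
  (pow_le_pow_left₀ (Nat.cast_nonneg d) (by linarith) k).trans
    (pow_le_pow_right₀ (by linarith [Nat.cast_nonneg (α := ℝ) d]) hk)

theorem Mollifier.bd_normB (hρ : Mollifier ρ r) {u : E d → ℝ} {m k : ℕ} (hu : MemB m u)
    (hk : k ≤ m) : Bd k (((d : ℝ) + 1) ^ m * normB m u) (conv ρ u) :=
  (hρ.bd hu hk fun _ hα => abs_weakD_le_normB hu (hα.trans_le hk)).mono
    (mul_le_mul_of_nonneg_right (pow_le_succ_pow hk) (Real.sqrt_nonneg _))

end Mollifier

/-! ### Classical regularity of the elements of `𝔅^m` -/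

/-- Bounded Lipschitz functions of class `C^r` whose derivatives of order less than `r` are bounded
and Lipschitz and whose derivatives of order `r` are bounded. -/
def Reg : ℕ → (E d → ℝ) → Prop
  | 0, g => Continuous g ∧ ∃ C, ∀ x, |g x| ≤ C
  | r + 1, g => (∃ C, LipschitzWith C g) ∧ (∃ C, ∀ x, |g x| ≤ C) ∧ Differentiable ℝ g ∧
      ∀ i, Reg r (partialD i g)

theorem Reg.bddBorel {r : ℕ} {g : E d → ℝ} (h : Reg r g) : BddBorel g := by
  cases r with
  | zero => exact ⟨h.1.measurable, h.2⟩
  | succ r => exact ⟨h.2.2.1.continuous.measurable, h.2.1⟩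

theorem Reg.pred {r : ℕ} {g : E d → ℝ} (h : Reg (r + 1) g) : Reg r g := by
  induction r generalizing g with
  | zero => exact ⟨h.2.2.1.continuous, h.2.1⟩
  | succ r ih => exact ⟨h.1, h.2.1, h.2.2.1, fun i => ih (h.2.2.2 i)⟩

theorem reg_ulimD {u : ℕ → E d → ℝ} {m : ℕ} {C : ℝ} (hu : ∀ n, SmoothBdd (u n))
    (hb : ∀ n, ∀ j ≤ m, Bd j C (u n)) {r : ℕ} {I : List (Fin d)} (hI : I.length + r + 1 ≤ m) :
    Reg r (ulimD u I) := by
  induction r generalizing I with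
  | zero => exact ⟨continuous_ulimD hu hb hI, C, abs_ulimD_le hu hb (by omega)⟩
  | succ r ih =>
    refine ⟨⟨_, lipschitz_ulimD hu hb (by omega)⟩, ⟨C, abs_ulimD_le hu hb (by omega)⟩,
      fun x => (differentiable_ulimD hu hb (by omega) x).1, fun i => ?_⟩
    rw [show partialD i (ulimD u I) = ulimD u (i :: I) from
      funext fun x => (differentiable_ulimD hu hb (by omega) x).2 i]
    exact ih (by simp; omega)

theorem MemB.exists_bd {m : ℕ} {u : E d → ℝ} (hu : MemB m u) :
    ∃ C, ∀ n, ∀ j ≤ m, Bd j C (conv (bump n) u) :=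
  ⟨_, fun n _ hj => (mollifier_bump n).bd_normB hu hj⟩

theorem MemB.ulimD_conv {m : ℕ} {u : E d → ℝ} (hu : MemB m u) :
    ulimD (fun n => conv (bump n) u) [] = u := by
  obtain ⟨C, hC⟩ := hu.exists_bd
  funext x
  exact tendsto_nhds_unique (tendsto_ulimD (m := m)
    (fun n => (mollifier_bump n).smoothBdd hu.bddBorel) hC (by simp) x) (tendsto_conv_bump hu.1 x)

theorem MemB.reg {m r : ℕ} {u : E d → ℝ} (hu : MemB m u) (hr : r + 1 ≤ m) : Reg r u := by
  obtain ⟨C, hC⟩ := hu.exists_bd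
  rw [← hu.ulimD_conv]
  exact reg_ulimD (m := m) (fun n => (mollifier_bump n).smoothBdd hu.bddBorel) hC (by simpa using hr)

theorem partialD_shift (φ : E d → ℝ) (i : Fin d) (v : E d) :
    partialD i (fun x => φ (x + v)) = fun x => partialD i φ (x + v) := by
  simp only [partialD_eq_dirD]
  exact dirD_shift φ _ v

theorem partialD_const_mul {g : E d → ℝ} (hg : Differentiable ℝ g) (i : Fin d) (a : ℝ) :
    partialD i (fun x => a * g x) = fun x => a * partialD i g x := dirD_const_mul hg _ a

theorem Reg.const_mul {r : ℕ} {g : E d → ℝ} (h : Reg r g) (a : ℝ) : Reg r fun x => a * g x := by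
  have hb : (∃ C, ∀ x, |g x| ≤ C) → ∃ C, ∀ x, |a * g x| ≤ C := fun ⟨C, hC⟩ => ⟨|a| * C, fun x => by
    rw [abs_mul]
    exact mul_le_mul_of_nonneg_left (hC x) (abs_nonneg a)⟩
  induction r generalizing g with
  | zero => exact ⟨h.1.const_mul a |>.congr fun _ => rfl, hb h.2⟩
  | succ r ih =>
    obtain ⟨⟨C, hC⟩, h2, h3, h4⟩ := h
    refine ⟨⟨‖a‖₊ * C, LipschitzWith.of_dist_le_mul fun x y => ?_⟩, hb h2, h3.const_mul a,
      fun i => ?_⟩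
    · have := hC.dist_le_mul x y
      simp only [Real.dist_eq, ← mul_sub, abs_mul, NNReal.coe_mul, coe_nnnorm, Real.norm_eq_abs] at *
      rw [mul_assoc]
      exact mul_le_mul_of_nonneg_left this (abs_nonneg a)
    · rw [partialD_const_mul h3]
      refine ih (h4 i) fun ⟨C, hC⟩ => ⟨|a| * C, fun x => by
        rw [abs_mul]
        exact mul_le_mul_of_nonneg_left (hC x) (abs_nonneg a)⟩

theorem Reg.shift {r : ℕ} {g : E d → ℝ} (h : Reg r g) (v : E d) : Reg r fun x => g (x + v) := by
  induction r generalizing g with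
  | zero => exact ⟨h.1.comp (continuous_id.add continuous_const), h.2.imp fun _ hC _ => hC _⟩
  | succ r ih =>
    refine ⟨h.1.imp fun C hC => LipschitzWith.of_dist_le_mul fun x y => ?_,
      h.2.1.imp fun _ hC _ => hC _, h.2.2.1.comp (differentiable_id.add_const v), fun i => ?_⟩
    · simpa using hC.dist_le_mul (x + v) (y + v)
    · rw [partialD_shift]
      exact ih (h.2.2.2 i)

theorem Reg.sub {r : ℕ} {g g' : E d → ℝ} (h : Reg r g) (h' : Reg r g') :
    Reg r fun x => g x - g' x := by
  have hb : ∀ {g g' : E d → ℝ}, (∃ C, ∀ x, |g x| ≤ C) → (∃ C, ∀ x, |g' x| ≤ C) →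
      ∃ C, ∀ x, |g x - g' x| ≤ C := fun ⟨C, hC⟩ ⟨D, hD⟩ =>
    ⟨C + D, fun x => (abs_sub _ _).trans (add_le_add (hC x) (hD x))⟩
  induction r generalizing g g' with
  | zero => exact ⟨h.1.sub h'.1, hb h.2 h'.2⟩
  | succ r ih =>
    obtain ⟨⟨C, hC⟩, h2, h3, h4⟩ := h
    obtain ⟨⟨C', hC'⟩, h2', h3', h4'⟩ := h'
    refine ⟨⟨C + C', hC.sub hC'⟩, hb h2 h2', h3.sub h3', fun i => ?_⟩
    have : partialD i (fun x => g x - g' x) = fun x => partialD i g x - partialD i g' x := by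
      funext x
      rw [partialD, fderiv_fun_sub (h3 x) (h3' x)]
      rfl
    rw [this]
    exact ih (h4 i) (h4' i)

theorem Reg.bar {r : ℕ} {g : E d → ℝ} (h : Reg (r + 1) g) (S : Scheme d) (τ₀ h' : ℝ)
    (μ : E d ⊕ Fin d) : Reg r (S.bar τ₀ h' μ g) := by
  cases μ with
  | inl l => exact (((h.pred.shift _).sub h.pred).const_mul _).const_mul _
  | inr i => exact (h.2.2.2 i).const_mul _

theorem Mollifier.bar_conv {ρ : E d → ℝ} {r : ℝ} (hρ : Mollifier ρ r) {g : E d → ℝ} (hg : Reg 1 g)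
    (S : Scheme d) (τ₀ h : ℝ) (μ : E d ⊕ Fin d) :
    S.bar τ₀ h μ (conv ρ g) = conv ρ (S.bar τ₀ h μ g) := by
  funext x
  refine HasAvg.unique (k := ρ) (F := fun t => S.bar τ₀ h μ g (x - t)) ?_
    (hρ.hasAvg_conv (hg.bar S τ₀ h μ).bddBorel x)
  cases μ with
  | inl l =>
    have h1 := hρ.hasAvg_conv hg.bddBorel (x + h • l)
    simp only [add_sub_right_comm] at h1
    exact ((h1.sub (hρ.hasAvg_conv hg.bddBorel x)).const_mul _).const_mul _
  | inr i =>
    have hb := hg.bddBorel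
    obtain ⟨⟨C, hC⟩, -, hd, hi⟩ := hg
    have h1 := DL_conv_of_weak hρ.smooth hρ.supp hb
      (isBddWeakDeriv_partialD hC hd i)
    rw [DL_cons, DL_nil] at h1
    simp only [Scheme.bar, h1]
    exact (hρ.hasAvg_conv (hi i).bddBorel x).const_mul τ₀

end

end EllipticFD

namespace EllipticFD

noncomputable section

variable {d : ℕ}

/-! ### Operators of class `𝔎` -/

theorem SmoothBdd.bddBorel {φ : E d → ℝ} (h : SmoothBdd φ) : BddBorel φ :=
  ⟨h.1.continuous.measurable, h.bdd⟩

theorem bddBorel_sum {κ : Type*} (s : Finset κ) {ψ : κ → E d → ℝ} (h : ∀ i ∈ s, BddBorel (ψ i)) :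
    BddBorel (∑ i ∈ s, ψ i) := by
  rw [show ∑ i ∈ s, ψ i = fun x => ∑ i ∈ s, ψ i x from funext fun x => Finset.sum_apply x s ψ]
  refine ⟨Finset.measurable_sum _ fun i hi => (h i hi).1, ?_⟩
  choose! C hC using fun i hi => (h i hi).2
  refine ⟨∑ i ∈ s, C i, fun x => ?_⟩
  exact (Finset.abs_sum_le_sum_abs _ _).trans (Finset.sum_le_sum fun i hi => hC i hi x)

section

variable {𝒦 : (E d → ℝ) → E d → ℝ}

theorem Mem𝔎.map_sum (h𝒦 : Mem𝔎 𝒦) {κ : Type*} (s : Finset κ) {ψ : κ → E d → ℝ}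
    (h : ∀ i ∈ s, BddBorel (ψ i)) : 𝒦 (∑ i ∈ s, ψ i) = ∑ i ∈ s, 𝒦 (ψ i) := by
  classical
  induction s using Finset.induction_on with
  | empty =>
    have h0 : BddBorel (0 : E d → ℝ) := ⟨measurable_const, 0, fun _ => by simp⟩
    have := h𝒦.smul 0 0 h0
    simpa using this
  | insert i s hi ih =>
    rw [Finset.sum_insert hi, Finset.sum_insert hi,
      h𝒦.add _ _ (h i (Finset.mem_insert_self i s))
        (bddBorel_sum s fun j hj => h j (Finset.mem_insert_of_mem hj)),
      ih fun j hj => h j (Finset.mem_insert_of_mem hj)]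

theorem Mem𝔎.sum_le (h𝒦 : Mem𝔎 𝒦) {κ : Type*} (s : Finset κ) {ψ : κ → E d → ℝ}
    (h : ∀ i ∈ s, BddBorel (ψ i)) {B : ℝ} (hB : 0 ≤ B) (hψ : ∀ y, ∑ i ∈ s, ψ i y ≤ B) (x : E d) :
    ∑ i ∈ s, 𝒦 (ψ i) x ≤ B := by
  have h1 : BddBorel (fun _ : E d => (1 : ℝ)) := ⟨measurable_const, 1, fun _ => by simp⟩
  have hs := bddBorel_sum s h
  have hB1 : BddBorel (B • fun _ : E d => (1 : ℝ)) := ⟨measurable_const, |B|, fun _ => by simp⟩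
  have hs1 : BddBorel ((-1 : ℝ) • ∑ i ∈ s, ψ i) :=
    ⟨hs.1.const_smul _, hs.2.imp fun _ hC x => by simpa using hC x⟩
  have hadd : BddBorel ((B • fun _ : E d => (1 : ℝ)) + (-1 : ℝ) • ∑ i ∈ s, ψ i) := by
    refine ⟨hB1.1.add hs1.1, ?_⟩
    obtain ⟨C, hC⟩ := hB1.2
    obtain ⟨D, hD⟩ := hs1.2
    exact ⟨C + D, fun x => (abs_add_le _ _).trans (add_le_add (hC x) (hD x))⟩
  have key := h𝒦.nonneg _ hadd (fun y => by simpa using hψ y) x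
  rw [h𝒦.add _ _ hB1 hs1, h𝒦.smul _ _ h1, h𝒦.smul _ _ hs, h𝒦.map_sum s h] at key
  simp only [Pi.add_apply, Pi.smul_apply, smul_eq_mul, Finset.sum_apply] at key
  have := mul_le_mul_of_nonneg_left (h𝒦.one_le x) hB
  linarith

end

namespace Scheme

variable {S : Scheme d}

theorem smoothBdd_sqBar {φ : E d → ℝ} (hφ : SmoothBdd φ) (τ₀ h : ℝ) :
    SmoothBdd (S.sqBar τ₀ h φ) := by
  have := SmoothBdd.sum S.idx fun μ _ =>
    (smoothBdd_bar (S := S) hφ τ₀ h μ).mul (smoothBdd_bar (S := S) hφ τ₀ h μ)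
  simp only [← sq] at this
  exact this

theorem smoothBdd_sqBar₂ {φ : E d → ℝ} (hφ : SmoothBdd φ) (τ₀ h : ℝ) :
    SmoothBdd (S.sqBar₂ τ₀ h φ) := by
  have := SmoothBdd.sum S.idx fun μ _ => SmoothBdd.sum S.idx fun ν _ =>
    (smoothBdd_bar (S := S) (smoothBdd_bar (S := S) hφ τ₀ h ν) τ₀ h μ).mul
      (smoothBdd_bar (S := S) (smoothBdd_bar (S := S) hφ τ₀ h ν) τ₀ h μ)
  simp only [← sq] at this
  exact this

theorem sqBar_nonneg (τ₀ h : ℝ) (φ : E d → ℝ) (x : E d) : 0 ≤ S.sqBar τ₀ h φ x :=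
  Finset.sum_nonneg fun _ _ => sq_nonneg _

theorem sqBar₂_nonneg (τ₀ h : ℝ) (φ : E d → ℝ) (x : E d) : 0 ≤ S.sqBar₂ τ₀ h φ x :=
  Finset.sum_nonneg fun _ _ => Finset.sum_nonneg fun _ _ => sq_nonneg _

/-- The left-hand side of the second order structural assumption. -/
def lhs₂ (S : Scheme d) (τ₀ h : ℝ) (n : ℕ) (φ : E d → ℝ) (x : E d) : ℝ :=
  (n : ℝ) * ∑ ν ∈ S.idx, S.A τ₀ h (S.bar τ₀ h ν φ) x
    + (n : ℝ) * ((n : ℝ) - 1) * ∑ μ ∈ S.idx, ∑ ν ∈ S.idx,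
        S.bar τ₀ h μ (S.bar τ₀ h ν φ) x *
          S.Qμ h (fun ψ => S.bar τ₀ h μ (S.bar τ₀ h ν ψ)) (T h μ (T h ν φ)) x

/-- The quadratic part of the right-hand side of the second order structural assumption. -/
def rhs₂ (S : Scheme d) (τ₀ h δ K : ℝ) (φ : E d → ℝ) (x : E d) : ℝ :=
  (1 - δ) * ∑ μ ∈ S.idx, ∑ ν ∈ S.idx, S.𝒬 h (S.bar τ₀ h μ (S.bar τ₀ h ν φ)) x
    + K * ∑ μ ∈ S.idx, S.𝒬 h (S.bar τ₀ h μ φ) x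

theorem Structural₁.le_of_bound {m : ℕ} {δ K τ₀ h₀ : ℝ} (hS : S.Structural₁ m δ K τ₀ h₀)
    (hδ1 : δ ≤ 1) (hc : ∀ x, 0 ≤ S.c x) {h : ℝ} (hh : h ∈ Ioc 0 h₀) {φ : E d → ℝ}
    (hφ : SmoothBdd φ) {B : ℝ} (hB : ∀ y, S.sqBar τ₀ h φ y ≤ B) (x : E d) :
    (m : ℝ) * S.A τ₀ h φ x ≤
      (1 - δ) * ∑ μ ∈ S.idx, S.𝒬 h (S.bar τ₀ h μ φ) x + K * S.𝒬 h φ x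
        + 2 * (1 - δ) * S.c x * B := by
  obtain ⟨𝒦, h𝒦, hle⟩ := hS h hh
  have h1 := h𝒦.sum_le (κ := Unit) {()} (ψ := fun _ => S.sqBar τ₀ h φ)
    (fun _ _ => (smoothBdd_sqBar hφ τ₀ h).bddBorel) ((sqBar_nonneg τ₀ h φ 0).trans (hB 0))
    (by simpa using hB) x
  rw [Finset.sum_singleton] at h1
  have hc' : 0 ≤ 2 * (1 - δ) * S.c x := mul_nonneg (by linarith) (hc x)
  linarith [hle φ hφ x, mul_le_mul_of_nonneg_left h1 hc']

theorem Structural₂.sum_le_of_bound {m : ℕ} {δ K τ₀ h₀ : ℝ} (hS : S.Structural₂ m δ K τ₀ h₀)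
    (hδ1 : δ ≤ 1) (hK : 0 ≤ K) (hc : ∀ x, 0 ≤ S.c x) {h : ℝ} (hh : h ∈ Ioc 0 h₀) {n : ℕ}
    (hn : 1 ≤ n) (hnm : n ≤ m) {κ : Type*} (s : Finset κ) {φ : κ → E d → ℝ}
    (hφ : ∀ i ∈ s, SmoothBdd (φ i)) {B₁ B₂ : ℝ} (hB₁ : ∀ y, ∑ i ∈ s, S.sqBar τ₀ h (φ i) y ≤ B₁)
    (hB₂ : ∀ y, ∑ i ∈ s, S.sqBar₂ τ₀ h (φ i) y ≤ B₂) (x : E d) :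
    ∑ i ∈ s, S.lhs₂ τ₀ h n (φ i) x
      ≤ ∑ i ∈ s, S.rhs₂ τ₀ h δ K (φ i) x + 2 * (1 - δ) * S.c x * B₂ + K * B₁ := by
  obtain ⟨𝒦, h𝒦, hle⟩ := hS h hh n hn hnm
  have h1 := h𝒦.sum_le s (fun i hi => (smoothBdd_sqBar (S := S) (hφ i hi) τ₀ h).bddBorel)
    ((Finset.sum_nonneg fun i _ => sqBar_nonneg τ₀ h (φ i) 0).trans (hB₁ 0)) hB₁ x
  have h2 := h𝒦.sum_le s (fun i hi => (smoothBdd_sqBar₂ (S := S) (hφ i hi) τ₀ h).bddBorel)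
    ((Finset.sum_nonneg fun i _ => sqBar₂_nonneg τ₀ h (φ i) 0).trans (hB₂ 0)) hB₂ x
  have hc' : 0 ≤ 2 * (1 - δ) * S.c x := mul_nonneg (by linarith) (hc x)
  have h3 := Finset.sum_le_sum fun i hi => hle (φ i) (hφ i hi) x
  simp only [Finset.sum_add_distrib, ← Finset.mul_sum] at h3
  simp only [lhs₂, rhs₂, Finset.sum_add_distrib, ← Finset.mul_sum]
  linarith [mul_le_mul_of_nonneg_left h2 hc', mul_le_mul_of_nonneg_left h1 hK]

/-! ### The scheme with mollified coefficients -/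

/-- The scheme with mollified coefficients. -/
def moll (S : Scheme d) (ρ : E d → ℝ) (hρ : ∀ t, 0 ≤ ρ t) : Scheme d where
  Λ₁ := S.Λ₁
  zero_notMem := S.zero_notMem
  q l := conv ρ (S.q l)
  p l := conv ρ (S.p l)
  c := conv ρ S.c
  τ := S.τ
  q_nonneg l hl _ := integral_nonneg fun t => mul_nonneg (hρ t) (S.q_nonneg l hl _)
  τ_nonneg := S.τ_nonneg

theorem moll_bar (ρ : E d → ℝ) (hρ : ∀ t, 0 ≤ ρ t) (τ₀ h : ℝ) (μ : E d ⊕ Fin d) (φ : E d → ℝ) :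
    (S.moll ρ hρ).bar τ₀ h μ φ = S.bar τ₀ h μ φ := by
  cases μ <;> rfl

theorem bar_shift (τ₀ h : ℝ) (μ : E d ⊕ Fin d) (φ : E d → ℝ) (t : E d) :
    S.bar τ₀ h μ (fun y => φ (y + t)) = fun y => S.bar τ₀ h μ φ (y + t) := by
  cases μ with
  | inl l => funext y; simp only [bar, fdiff, add_right_comm]
  | inr i => simp only [bar, partialD_shift]

theorem T_shift (h : ℝ) (μ : E d ⊕ Fin d) (φ : E d → ℝ) (t : E d) :
    T h μ (fun y => φ (y + t)) = fun y => T h μ φ (y + t) := by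
  cases μ with
  | inl l => funext y; simp only [T, add_right_comm]
  | inr i => rfl

theorem fdiff_shift (h : ℝ) (l : E d) (φ : E d → ℝ) (t : E d) :
    fdiff h l (fun y => φ (y + t)) = fun y => fdiff h l φ (y + t) := by
  funext y; simp only [fdiff, add_right_comm]

variable {ρ : E d → ℝ} {r : ℝ}

theorem avg_Qμ (hρ : Mollifier ρ r) (h : ℝ) {B : (E d → ℝ) → E d → ℝ}
    (hB : ∀ l ∈ S.Λ₁, BddBorel (B (S.q l)))
    (hBc : ∀ l ∈ S.Λ₁, B (conv ρ (S.q l)) = conv ρ (B (S.q l))) (φ : E d → ℝ) (x : E d) :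
    HasAvg ρ (fun t => S.Qμ h B (fun y => φ (y + t)) (x - t))
      ((S.moll ρ hρ.nonneg).Qμ h B φ x) := by
  simp only [Qμ, fdiff_shift, sub_add_cancel]
  refine (HasAvg.sum _ fun l hl => ?_).const_mul _
  simp only [moll, hBc l hl]
  exact (hρ.hasAvg_conv (hB l hl) x).mul_const _

theorem avg_A (hρ : Mollifier ρ r) (hq : ∀ l ∈ S.Λ₁, Reg 1 (S.q l))
    (hp : ∀ l ∈ S.Λ₁, Reg 1 (S.p l)) (τ₀ h : ℝ) (φ : E d → ℝ) (x : E d) :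
    HasAvg ρ (fun t => S.A τ₀ h (fun y => φ (y + t)) (x - t))
      ((S.moll ρ hρ.nonneg).A τ₀ h φ x) := by
  simp only [A, bar_shift, sub_add_cancel, moll_bar]
  refine (HasAvg.sum _ fun μ _ => HasAvg.const_mul ?_ _).const_mul _
  have hbar : (S.moll ρ hρ.nonneg).bar τ₀ h μ = S.bar τ₀ h μ := funext fun φ => moll_bar _ _ _ _ _ _
  rw [hbar]
  simp only [T_shift, L₀μ]
  refine (avg_Qμ hρ h (fun l hl => ((hq l hl).bar S τ₀ h μ).bddBorel)
    (fun l hl => hρ.bar_conv (hq l hl) S τ₀ h μ) _ x).add (HasAvg.sum _ fun l hl => ?_)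
  simp only [fdiff_shift, sub_add_cancel, moll, hρ.bar_conv (hp l hl) S τ₀ h μ]
  exact (hρ.hasAvg_conv ((hp l hl).bar S τ₀ h μ).bddBorel x).mul_const _

theorem avg_𝒬 (hρ : Mollifier ρ r) (hq : ∀ l ∈ S.Λ₁, BddBorel (S.q l))
    (hp : ∀ l ∈ S.Λ₁, BddBorel (S.p l)) (h : ℝ) (φ : E d → ℝ) (x : E d) :
    HasAvg ρ (fun t => S.𝒬 h (fun y => φ (y + t)) (x - t)) ((S.moll ρ hρ.nonneg).𝒬 h φ x) := by
  simp only [𝒬, χ, fdiff_shift, sub_add_cancel]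
  exact HasAvg.sum _ fun l hl => ((hρ.hasAvg_conv (hq l hl) x).add
    ((hρ.hasAvg_conv (hp l hl) x).const_mul h)).mul_const _

theorem avg_lhs₂ (hρ : Mollifier ρ r) (hq : ∀ l ∈ S.Λ₁, Reg 2 (S.q l))
    (hp : ∀ l ∈ S.Λ₁, Reg 2 (S.p l)) (τ₀ h : ℝ) (n : ℕ) (φ : E d → ℝ) (x : E d) :
    HasAvg ρ (fun t => S.lhs₂ τ₀ h n (fun y => φ (y + t)) (x - t))
      ((S.moll ρ hρ.nonneg).lhs₂ τ₀ h n φ x) := by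
  simp only [lhs₂, bar_shift, T_shift, sub_add_cancel, moll_bar]
  refine HasAvg.add (HasAvg.const_mul (HasAvg.sum _ fun ν _ =>
    avg_A hρ (fun l hl => (hq l hl).pred) (fun l hl => (hp l hl).pred) τ₀ h _ x) _)
    (HasAvg.const_mul (HasAvg.sum _ fun μ _ => HasAvg.sum _ fun ν _ => HasAvg.const_mul
      (avg_Qμ hρ h (B := fun ψ => S.bar τ₀ h μ (S.bar τ₀ h ν ψ))
        (fun l hl => (((hq l hl).bar S τ₀ h ν).bar S τ₀ h μ).bddBorel)
        (fun l hl => ?_) _ x) _) _)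
  rw [hρ.bar_conv (hq l hl).pred, hρ.bar_conv ((hq l hl).bar S τ₀ h ν)]

theorem avg_rhs₂ (hρ : Mollifier ρ r) (hq : ∀ l ∈ S.Λ₁, BddBorel (S.q l))
    (hp : ∀ l ∈ S.Λ₁, BddBorel (S.p l)) (τ₀ h δ K : ℝ) (φ : E d → ℝ) (x : E d) :
    HasAvg ρ (fun t => S.rhs₂ τ₀ h δ K (fun y => φ (y + t)) (x - t))
      ((S.moll ρ hρ.nonneg).rhs₂ τ₀ h δ K φ x) := by
  simp only [rhs₂, bar_shift, moll_bar]
  exact ((HasAvg.sum _ fun μ _ => HasAvg.sum _ fun ν _ => avg_𝒬 hρ hq hp h _ x).const_mul _).add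
    ((HasAvg.sum _ fun μ _ => avg_𝒬 hρ hq hp h _ x).const_mul _)

theorem sqBar_shift (τ₀ h : ℝ) (φ : E d → ℝ) (t y : E d) :
    S.sqBar τ₀ h (fun y => φ (y + t)) y = S.sqBar τ₀ h φ (y + t) := by
  simp only [sqBar, bar_shift]

theorem sqBar₂_shift (τ₀ h : ℝ) (φ : E d → ℝ) (t y : E d) :
    S.sqBar₂ τ₀ h (fun y => φ (y + t)) y = S.sqBar₂ τ₀ h φ (y + t) := by
  simp only [sqBar₂, bar_shift]

end Scheme

end

end EllipticFD

namespace EllipticFD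

noncomputable section

open Filter Topology

variable {d : ℕ}

namespace Scheme

variable {S : Scheme d} {m : ℕ} {δ c₀ τ₀ K a b h₀ : ℝ} {M : Fin (m + 1) → ℝ} {f : E d → ℝ}
  {ρ : E d → ℝ} {r : ℝ}

theorem Regular.ae_weakD_le (hR : S.Regular m M f) {k : ℕ} (hk : k ≤ m) {α : Fin d → ℕ}
    (hα : ∑ i, α i = k) : ∀ᵐ y, ∑ l ∈ S.Λ₁, (weakD α (S.q l) y ^ 2 + weakD α (S.p l) y ^ 2)
      + weakD α S.c y ^ 2 ≤ (∑ j, |M j|) ^ 2 := by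
  filter_upwards [hR.2.2.2 ⟨k, Nat.lt_succ_of_le hk⟩] with y hy
  have h1 : M ⟨k, Nat.lt_succ_of_le hk⟩ ^ 2 ≤ (∑ j, |M j|) ^ 2 := by
    rw [← sq_abs]
    exact pow_le_pow_left₀ (abs_nonneg _) (Finset.single_le_sum (f := fun j => |M j|)
      (fun _ _ => abs_nonneg _) (Finset.mem_univ _)) 2
  refine le_trans ?_ (hy.trans h1)
  exact add_le_add (Finset.sum_le_sum fun l _ => add_le_add (sq_weakD_le_sqD hα y)
    (sq_weakD_le_sqD hα y)) (sq_weakD_le_sqD hα y)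

/-- A bound for the derivatives of the mollified coefficients. -/
def mollBound (d m : ℕ) (M : Fin (m + 1) → ℝ) : ℝ := ((d : ℝ) + 1) ^ m * ∑ j, |M j|

theorem moll_smooth (hm : 3 ≤ m) (hδ1 : δ ≤ 1) (hc₀ : 0 < c₀) (hK : 0 ≤ K) (ha : S.size = a)
    (hb : S.wsize = b) (hR : S.Regular m M f) (hχ : S.ChiNonneg h₀) (hbal : S.Balanced)
    (hc : ∀ x, c₀ ≤ S.c x) (hS₁ : S.Structural₁ m δ K τ₀ h₀) (hS₂ : S.Structural₂ m δ K τ₀ h₀)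
    (hρ : Mollifier ρ r) {h : ℝ} (hh : h ∈ Ioc 0 h₀) :
    (S.moll ρ hρ.nonneg).Smooth m δ c₀ τ₀ K a b (mollBound d m M) h := by
  have hqB : ∀ l ∈ S.Λ₁, BddBorel (S.q l) := fun l hl => (hR.1 l hl).1.bddBorel
  have hpB : ∀ l ∈ S.Λ₁, BddBorel (S.p l) := fun l hl => (hR.1 l hl).2.bddBorel
  have hcB : BddBorel S.c := hR.2.1.bddBorel
  have hq2 : ∀ l ∈ S.Λ₁, Reg 2 (S.q l) := fun l hl => (hR.1 l hl).1.reg hm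
  have hp2 : ∀ l ∈ S.Λ₁, Reg 2 (S.p l) := fun l hl => (hR.1 l hl).2.reg hm
  have hc0 : ∀ x, 0 ≤ S.c x := fun x => hc₀.le.trans (hc x)
  have hM : 0 ≤ ∑ j, |M j| := Finset.sum_nonneg fun _ _ => abs_nonneg _
  have hqs : ∀ l ∈ S.Λ₁, SmoothBdd (conv ρ (S.q l)) := fun l hl => hρ.smoothBdd (hqB l hl)
  have hps : ∀ l ∈ S.Λ₁, SmoothBdd (conv ρ (S.p l)) := fun l hl => hρ.smoothBdd (hpB l hl)
  have hpow : ∀ {k : ℕ} {A : ℝ}, k ≤ m → 0 ≤ A → (d : ℝ) ^ k * A ≤ ((d : ℝ) + 1) ^ m * A :=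
    fun hk hA => mul_le_mul_of_nonneg_right (pow_le_succ_pow hk) hA
  refine
    { ell := ⟨hh.1, fun l hl x => ?_, ?_, hc₀, fun x => ?_⟩
      size_eq := ha
      wsize_eq := hb
      q_smooth := hqs
      p_smooth := hps
      c_smooth := hρ.smoothBdd hcB
      q_bd := fun k hk l hl => ?_
      p_bd := fun k hk β => ?_
      c_bd := fun k hk => ?_
      balanced := fun x => ?_
      structural₁ := fun φ hφ B hB x => ?_
      structural₂ := fun n hn hnm s φ hφ B₁ B₂ hB₁ hB₂ x => ?_ }
  · exact hρ.avg_mono (hρ.hasAvg_const 0) ((hρ.hasAvg_conv (hqB l hl) x).add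
      ((hρ.hasAvg_conv (hpB l hl) x).const_mul h)) fun t => hχ h hh l hl _
  · obtain ⟨C, hC⟩ := (SmoothBdd.sum S.Λ₁ fun l hl => (hqs l hl).add ((hps l hl).const_mul h)).bdd
    exact ⟨C, fun x => (le_abs_self _).trans (hC x)⟩
  · exact hρ.avg_mono (hρ.hasAvg_const c₀) (hρ.hasAvg_conv hcB x) fun t => hc _
  · refine (hρ.bd (hR.1 l hl).1 hk (B := ∑ j, |M j|) fun α hα => ?_).mono (hpow hk hM)
    filter_upwards [hR.ae_weakD_le hk hα] with y hy
    refine abs_le_of_sq_le_sq ?_ hM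
    have h1 := Finset.single_le_sum (s := S.Λ₁)
      (f := fun l => weakD α (S.q l) y ^ 2 + weakD α (S.p l) y ^ 2)
      (fun l _ => add_nonneg (sq_nonneg _) (sq_nonneg _)) hl
    linarith [sq_nonneg (weakD α S.c y), sq_nonneg (weakD α (S.p l) y)]
  · have h1 := hρ.bd_sum S.Λ₁ β (fun l hl => (hR.1 l hl).2) hk
      (B := (∑ j, |M j|) * √(∑ l ∈ S.Λ₁, β l ^ 2)) fun α hα => by
        filter_upwards [hR.ae_weakD_le hk hα] with y hy
        refine abs_le_of_sq_le_sq ?_ (mul_nonneg hM (Real.sqrt_nonneg _))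
        rw [mul_pow, Real.sq_sqrt (Finset.sum_nonneg fun _ _ => sq_nonneg _), mul_comm]
        refine (Finset.sum_mul_sq_le_sq_mul_sq _ _ _).trans
          (mul_le_mul_of_nonneg_left ?_ (Finset.sum_nonneg fun _ _ => sq_nonneg _))
        rw [Finset.sum_add_distrib] at hy
        linarith [sq_nonneg (weakD α S.c y),
          Finset.sum_nonneg fun l (_ : l ∈ S.Λ₁) => sq_nonneg (weakD α (S.q l) y)]
    refine h1.mono ((hpow hk (mul_nonneg hM (Real.sqrt_nonneg _))).trans (le_of_eq ?_))
    rw [mollBound, mul_assoc]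
    rfl
  · refine (hρ.bd hR.2.1 hk (B := ∑ j, |M j|) fun α hα => ?_).mono (hpow hk hM)
    filter_upwards [hR.ae_weakD_le hk hα] with y hy
    refine abs_le_of_sq_le_sq ?_ hM
    linarith [Finset.sum_nonneg fun l (_ : l ∈ S.Λ₁) =>
      add_nonneg (sq_nonneg (weakD α (S.q l) y)) (sq_nonneg (weakD α (S.p l) y))]
  · ext i
    have h0 : ∀ y, ∑ l ∈ S.Λ₁, S.q l y * l i = 0 := fun y => by
      have := congrArg (fun v : E d => v i) (hbal y)
      simpa using this
    have h1 := HasAvg.sum S.Λ₁ fun l hl => (hρ.hasAvg_conv (hqB l hl) x).mul_const (l i)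
    simp only [h0] at h1
    have := h1.unique (hρ.hasAvg_const 0)
    simpa [moll] using this
  · simp only [moll_bar, sqBar] at hB ⊢
    refine hρ.avg_mono ((avg_A hρ (fun l hl => (hq2 l hl).pred) (fun l hl => (hp2 l hl).pred)
      τ₀ h φ x).const_mul m) ((((HasAvg.sum _ fun μ _ => avg_𝒬 hρ hqB hpB h _ x).const_mul _).add
        ((avg_𝒬 hρ hqB hpB h φ x).const_mul K)).add
          (((hρ.hasAvg_conv hcB x).const_mul (2 * (1 - δ))).mul_const B)) fun t => ?_
    have := hS₁.le_of_bound hδ1 hc0 hh (hφ.shift t) (fun y => by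
      rw [sqBar_shift]; exact hB (y + t)) (x - t)
    simp only [bar_shift] at this
    exact this
  · have hrw : ∀ φ, (S.moll ρ hρ.nonneg).sqBar τ₀ h φ = S.sqBar τ₀ h φ := fun φ => by
      funext y; simp only [sqBar, moll_bar]; rfl
    have hrw₂ : ∀ φ, (S.moll ρ hρ.nonneg).sqBar₂ τ₀ h φ = S.sqBar₂ τ₀ h φ := fun φ => by
      funext y; simp only [sqBar₂, moll_bar]; rfl
    simp only [hrw] at hB₁
    simp only [hrw₂] at hB₂
    refine hρ.avg_mono (HasAvg.sum s fun i _ => avg_lhs₂ hρ hq2 hp2 τ₀ h n (φ i) x)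
      (((HasAvg.sum s fun i _ => avg_rhs₂ hρ hqB hpB τ₀ h δ K (φ i) x).add
        (((hρ.hasAvg_conv hcB x).const_mul (2 * (1 - δ))).mul_const B₂)).add
          (hρ.hasAvg_const (K * B₁))) fun t => ?_
    exact hS₂.sum_le_of_bound hδ1 hK hc0 hh hn hnm s (fun i hi => (hφ i hi).shift t)
      (fun y => by simp only [sqBar_shift]; exact hB₁ (y + t))
      (fun y => by simp only [sqBar₂_shift]; exact hB₂ (y + t)) (x - t)

theorem moll_symm (hρ : ∀ t, 0 ≤ ρ t) (hS : S.Symm) : (S.moll ρ hρ).Symm := fun l hl =>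
  ⟨(hS l hl).1, fun x => by
    have : S.q l = S.q (-l) := funext (hS l hl).2
    simp only [moll, this]⟩

theorem moll_antisymmP (hρ : ∀ t, 0 ≤ ρ t) (hS : S.AntisymmP) : (S.moll ρ hρ).AntisymmP :=
  fun l hl x => by
    have : S.p (-l) = fun x => -S.p l x := funext (hS l hl)
    simp only [moll, this, conv, mul_neg, integral_neg]

end Scheme

end

end EllipticFD

namespace EllipticFD

noncomputable section

open Filter Topology

variable {d : ℕ}

/-! ### Averages of products -/

/-- Up to an error of order `1 / (n + 1)`, uniformly in `x`, the mollification of `F` at `x` is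
`v n x`. -/
def ConvNear (F : E d → ℝ) (v : ℕ → E d → ℝ) : Prop :=
  ∃ η : ℝ, ∀ n x, ∃ v', HasAvg (bump n) (fun t => F (x - t)) v' ∧ |v' - v n x| ≤ η / ((n : ℝ) + 1)

section ConvNear

variable {F G : E d → ℝ} {v w : ℕ → E d → ℝ}

theorem ConvNear.add (hF : ConvNear F v) (hG : ConvNear G w) :
    ConvNear (fun y => F y + G y) (fun n x => v n x + w n x) := by
  obtain ⟨η, hη⟩ := hF
  obtain ⟨ζ, hζ⟩ := hG
  refine ⟨η + ζ, fun n x => ?_⟩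
  obtain ⟨v', h1, h2⟩ := hη n x
  obtain ⟨w', h3, h4⟩ := hζ n x
  refine ⟨v' + w', h1.add h3, ?_⟩
  rw [add_sub_add_comm, add_div]
  exact (abs_add_le _ _).trans (add_le_add h2 h4)

theorem ConvNear.const_mul (hF : ConvNear F v) (a : ℝ) :
    ConvNear (fun y => a * F y) (fun n x => a * v n x) := by
  obtain ⟨η, hη⟩ := hF
  refine ⟨|a| * η, fun n x => ?_⟩
  obtain ⟨v', h1, h2⟩ := hη n x
  refine ⟨a * v', h1.const_mul a, ?_⟩
  rw [← mul_sub, abs_mul, mul_div_assoc]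
  exact mul_le_mul_of_nonneg_left h2 (abs_nonneg a)

theorem ConvNear.sub (hF : ConvNear F v) (hG : ConvNear G w) :
    ConvNear (fun y => F y - G y) (fun n x => v n x - w n x) := by
  simpa only [neg_one_mul, ← sub_eq_add_neg] using hF.add (hG.const_mul (-1))

theorem ConvNear.sum {κ : Type*} (s : Finset κ) {F : κ → E d → ℝ} {v : κ → ℕ → E d → ℝ}
    (h : ∀ i ∈ s, ConvNear (F i) (v i)) :
    ConvNear (fun y => ∑ i ∈ s, F i y) (fun n x => ∑ i ∈ s, v i n x) := by
  choose! η hη using h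
  refine ⟨∑ i ∈ s, η i, fun n x => ?_⟩
  choose! v' h1 h2 using fun i hi => hη i hi n x
  refine ⟨∑ i ∈ s, v' i, HasAvg.sum s h1, ?_⟩
  rw [← Finset.sum_sub_distrib, Finset.sum_div]
  exact (Finset.abs_sum_le_sum_abs _ _).trans (Finset.sum_le_sum h2)

theorem convNear_conv (hF : BddBorel F) : ConvNear F (fun n => conv (bump n) F) :=
  ⟨0, fun n x => ⟨_, (mollifier_bump n).hasAvg_conv hF x, by simp⟩⟩

theorem convNear_mul {C : NNReal} (hF : BddBorel F) (hC : LipschitzWith C F) (hG : BddBorel G) :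
    ConvNear (fun y => F y * G y) (fun n x => conv (bump n) F x * conv (bump n) G x) := by
  obtain ⟨D, hD⟩ := hG.2
  have hD0 : 0 ≤ D := (abs_nonneg _).trans (hD 0)
  have hFG : BddBorel fun y => F y * G y := by
    obtain ⟨B, hB⟩ := hF.2
    refine ⟨hF.1.mul hG.1, B * D, fun x => ?_⟩
    rw [abs_mul]
    exact mul_le_mul (hB x) (hD x) (abs_nonneg _) ((abs_nonneg _).trans (hB x))
  refine ⟨2 * C * D, fun n x => ⟨_, (mollifier_bump n).hasAvg_conv hFG x, ?_⟩⟩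
  have hρ : Mollifier (bump n : E d → ℝ) _ := mollifier_bump n
  refine hρ.abs_avg_le ((hρ.hasAvg_conv hFG x).sub
    ((hρ.hasAvg_conv hG x).const_mul (conv (bump n) F x))) (Eventually.of_forall fun t ht => ?_)
  have h1 := hρ.abs_conv_sub_le hF hC x
  have h2 : |F (x - t) - F x| ≤ C * (1 / ((n : ℝ) + 1)) := by
    have := hC.dist_le_mul (x - t) x
    rw [Real.dist_eq, dist_eq_norm, sub_sub_cancel_left, norm_neg] at this
    exact this.trans (mul_le_mul_of_nonneg_left ht C.2)
  rw [← sub_mul, abs_mul]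
  have h3 : |F (x - t) - conv (bump n) F x| ≤ 2 * (C * (1 / ((n : ℝ) + 1))) := by
    rw [abs_le] at *
    constructor <;> linarith [h1.1, h1.2, h2.1, h2.2]
  refine (mul_le_mul h3 (hD _) (abs_nonneg _) ((abs_nonneg _).trans h3)).trans (le_of_eq ?_)
  ring

theorem ConvNear.abs_le_of_ae_eq_zero (hF : ConvNear F v) (h0 : ∀ᵐ y, F y = 0) :
    ∃ η : ℝ, ∀ n x, |v n x| ≤ η / ((n : ℝ) + 1) := by
  obtain ⟨η, hη⟩ := hF
  refine ⟨η, fun n x => ?_⟩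
  obtain ⟨v', h1, h2⟩ := hη n x
  have h3 : |v'| ≤ 0 := (mollifier_bump n).abs_avg_le h1 (by
    filter_upwards [ae_comp_sub h0 x] with t ht _
    rw [ht, abs_zero])
  rwa [abs_nonpos_iff.1 h3, zero_sub, abs_neg] at h2

end ConvNear

/-! ### The limit equation -/

theorem count_singleton_eq (i : Fin d) : (fun k => [i].count k) = Pi.single i 1 := by
  funext k
  by_cases h : k = i
  · subst h; simp
  · simp [h, Ne.symm h]

theorem count_pair_eq (i j : Fin d) :
    (fun k => [i, j].count k) = Pi.single i 1 + Pi.single j 1 := by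
  rw [← count_singleton_eq i, ← count_singleton_eq j]
  funext k
  simp only [List.count_cons, List.count_nil, Pi.add_apply]
  ring

theorem dirD_eq_sum (l : E d) (φ : E d → ℝ) (x : E d) :
    dirD l φ x = ∑ i, l i * DL [i] φ x := fderiv_eq_sum_partialD φ x l

theorem dirD_dirD_eq_sum (l : E d) {φ : E d → ℝ} (hφ : ContDiff ℝ ∞ φ) (x : E d) :
    dirD l (dirD l φ) x = ∑ i, ∑ j, l i * l j * DL [i, j] φ x := by
  rw [dirD_eq_sum]
  refine Finset.sum_congr rfl fun i _ => ?_
  have h1 : dirD l φ = fun y => ∑ j, l j * partialD j φ y := funext (dirD_eq_sum l φ)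
  have h2 : HasFDerivAt (fun y => ∑ j, l j * partialD j φ y)
      (∑ j, l j • fderiv ℝ (partialD j φ) x) x :=
    HasFDerivAt.fun_sum fun j _ =>
      (smooth_differentiable (smooth_partialD hφ j) x).hasFDerivAt.const_mul (l j)
  rw [DL_cons, DL_nil, h1, partialD, h2.fderiv]
  simp only [sum_apply, Finset.mul_sum, mul_assoc]
  rfl

namespace Scheme

variable {S : Scheme d} {m : ℕ} {δ c₀ τ₀ K a b h₀ : ℝ} {M : Fin (m + 1) → ℝ} {f : E d → ℝ}

/-- The limit operator applied to a function with the given first and second derivatives. -/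
def limForm (S : Scheme d) (D : List (Fin d) → E d → ℝ) (x : E d) : ℝ :=
  (1 / 2 : ℝ) * ∑ l ∈ S.Λ₁, ∑ i, ∑ j, S.q l x * l i * l j * D [i, j] x
    + ∑ l ∈ S.Λ₁, ∑ i, S.p l x * l i * D [i] x - S.c x * D [] x

theorem Li_zero_sub (S : Scheme d) {φ : E d → ℝ} (hφ : ContDiff ℝ ∞ φ) (x : E d) :
    S.Li 0 φ x - S.c x * φ x = S.limForm (fun I => DL I φ) x := by
  simp only [Li, limForm, zero_add, Function.iterate_succ, Function.iterate_zero,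
    Function.comp_apply, id_eq, dirD_dirD_eq_sum _ hφ, dirD_eq_sum, Finset.mul_sum, DL_nil,
    Nat.cast_zero, mul_assoc]
  norm_num

theorem limitOp_eq_limForm (S : Scheme d) (v : E d → ℝ) (x : E d) (D : List (Fin d) → E d → ℝ)
    (h0 : D [] x = v x) (h1 : ∀ i, weakD (fun k => [i].count k) v x = D [i] x)
    (h2 : ∀ i j, weakD (fun k => [i, j].count k) v x = D [i, j] x) :
    S.limitOp v x = S.limForm D x := by
  simp only [count_singleton_eq] at h1
  simp only [count_pair_eq] at h2
  simp only [limitOp, limForm, h0, h1, h2]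

/-- The standing assumptions of the theorem. -/
structure Admissible (S : Scheme d) (m : ℕ) (δ c₀ τ₀ K a b h₀ : ℝ) (M : Fin (m + 1) → ℝ)
    (f : E d → ℝ) : Prop where
  hm : 3 ≤ m
  δ_pos : 0 < δ
  δ_le : δ ≤ 1
  c₀_pos : 0 < c₀
  τ₀_pos : 0 < τ₀
  K_nonneg : 0 ≤ K
  h₀_pos : 0 < h₀
  size_eq : S.size = a
  wsize_eq : S.wsize = b
  regular : S.Regular m M f
  χ_nonneg : S.ChiNonneg h₀
  balanced : S.Balanced
  le_c : ∀ x, c₀ ≤ S.c x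
  structural₁ : S.Structural₁ m δ K τ₀ h₀
  structural₂ : S.Structural₂ m δ K τ₀ h₀

/-- The `n`-th scheme with mollified coefficients. -/
def mollSeq (S : Scheme d) (n : ℕ) : Scheme d := S.moll (bump n) (mollifier_bump n).nonneg

namespace Admissible

variable (A : S.Admissible m δ c₀ τ₀ K a b h₀ M f)
include A

theorem smooth (n : ℕ) {h : ℝ} (hh : h ∈ Ioc 0 h₀) :
    (S.mollSeq n).Smooth m δ c₀ τ₀ K a b (mollBound d m M) h :=
  moll_smooth A.hm A.δ_le A.c₀_pos A.K_nonneg A.size_eq A.wsize_eq A.regular A.χ_nonneg A.balanced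
    A.le_c A.structural₁ A.structural₂ (mollifier_bump n) hh

end Admissible

end Scheme

end

end EllipticFD

namespace EllipticFD

noncomputable section

open Filter Topology

variable {d : ℕ}

namespace Scheme

/-- A bound for the derivatives of the mollifications of `f`. -/
def dataBound (d m : ℕ) (f : E d → ℝ) : ℝ := ((d : ℝ) + 1) ^ m * normB m f

/-- A sequence of steps tending to zero. -/
def mesh (h₀ : ℝ) (n : ℕ) : ℝ := h₀ / ((n : ℝ) + 1)

theorem mesh_mem {h₀ : ℝ} (h : 0 < h₀) (n : ℕ) : mesh h₀ n ∈ Ioc 0 h₀ :=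
  ⟨by unfold mesh; positivity, div_le_self h.le (by linarith [Nat.cast_nonneg (α := ℝ) n])⟩

theorem tendsto_mesh (h₀ : ℝ) : Tendsto (mesh h₀) (hyperfilter ℕ : Filter ℕ) (𝓝 0) :=
  tendsto_hyperfilter_inv h₀

variable {S : Scheme d} {m : ℕ} {δ c₀ τ₀ K a b h₀ : ℝ} {M : Fin (m + 1) → ℝ} {f : E d → ℝ}

namespace Admissible

variable (A : S.Admissible m δ c₀ τ₀ K a b h₀ M f)
include A

theorem tendsto_q {l : E d} (hl : l ∈ S.Λ₁) (x : E d) :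
    Tendsto (fun n => (S.mollSeq n).q l x) (hyperfilter ℕ : Filter ℕ) (𝓝 (S.q l x)) :=
  tendsto_conv_bump (A.regular.1 l hl).1.1 x

theorem tendsto_p {l : E d} (hl : l ∈ S.Λ₁) (x : E d) :
    Tendsto (fun n => (S.mollSeq n).p l x) (hyperfilter ℕ : Filter ℕ) (𝓝 (S.p l x)) :=
  tendsto_conv_bump (A.regular.1 l hl).2.1 x

theorem tendsto_c (x : E d) :
    Tendsto (fun n => (S.mollSeq n).c x) (hyperfilter ℕ : Filter ℕ) (𝓝 (S.c x)) :=
  tendsto_conv_bump A.regular.2.1.1 x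

theorem tendsto_L {h : ℝ} {u : ℕ → E d → ℝ} {w : E d → ℝ}
    (hu : ∀ x, Tendsto (fun n => u n x) (hyperfilter ℕ : Filter ℕ) (𝓝 (w x))) (x : E d) :
    Tendsto (fun n => (S.mollSeq n).L h (u n) x) (hyperfilter ℕ : Filter ℕ)
      (𝓝 (S.L h w x)) := by
  have hd : ∀ l, Tendsto (fun n => fdiff h l (u n) x) (hyperfilter ℕ : Filter ℕ)
      (𝓝 (fdiff h l w x)) := fun l => ((hu _).sub (hu _)).const_mul _
  exact (((tendsto_finsetSum _ fun l hl => (A.tendsto_q hl x).mul (hd l)).const_mul _).add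
    (tendsto_finsetSum _ fun l hl => (A.tendsto_p hl x).mul (hd l))).sub
      ((A.tendsto_c x).mul (hu x))

theorem tendsto_limForm {D : ℕ → List (Fin d) → E d → ℝ} {D' : List (Fin d) → E d → ℝ} (x : E d)
    (hD : ∀ I : List (Fin d), I.length ≤ 2 →
      Tendsto (fun n => D n I x) (hyperfilter ℕ : Filter ℕ) (𝓝 (D' I x))) :
    Tendsto (fun n => (S.mollSeq n).limForm (D n) x) (hyperfilter ℕ : Filter ℕ)
      (𝓝 (S.limForm D' x)) := by
  exact (((tendsto_finsetSum _ fun l hl => tendsto_finsetSum _ fun i _ =>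
    tendsto_finsetSum _ fun j _ => (((A.tendsto_q hl x).mul_const _).mul_const _).mul
      (hD [i, j] (by simp))).const_mul _).add
    (tendsto_finsetSum _ fun l hl => tendsto_finsetSum _ fun i _ =>
      ((A.tendsto_p hl x).mul_const _).mul (hD [i] (by simp)))).sub
    ((A.tendsto_c x).mul (hD [] (by simp)))

theorem elliptic {h : ℝ} (hh : h ∈ Ioc 0 h₀) : S.Elliptic c₀ h where
  h_pos := hh.1
  χ_nonneg := A.χ_nonneg h hh
  χ_bdd := by
    choose! C hC using fun l (hl : l ∈ S.Λ₁) => (A.regular.1 l hl).1.2.1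
    choose! D hD using fun l (hl : l ∈ S.Λ₁) => (A.regular.1 l hl).2.2.1
    refine ⟨∑ l ∈ S.Λ₁, (C l + h * D l), fun x => Finset.sum_le_sum fun l hl => ?_⟩
    exact add_le_add ((le_abs_self _).trans (hC l hl x))
      (mul_le_mul_of_nonneg_left ((le_abs_self _).trans (hD l hl x)) hh.1.le)
  c₀_pos := A.c₀_pos
  le_c := A.le_c

theorem smoothBdd_f (n : ℕ) : SmoothBdd (conv (bump n) f) :=
  (mollifier_bump n).smoothBdd A.regular.2.2.1.bddBorel

theorem bd_f (n : ℕ) : ∀ j ≤ m, Bd j (dataBound d m f) (conv (bump n) f) :=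
  fun _ hj => (mollifier_bump n).bd_normB A.regular.2.2.1 hj

theorem tendsto_f (x : E d) :
    Tendsto (fun n => conv (bump n) f x) (hyperfilter ℕ : Filter ℕ) (𝓝 (f x)) :=
  tendsto_conv_bump A.regular.2.2.1.1 x

end Admissible

/-! ### The discrete solution -/

/-- The solution of the finite difference equation, as a limit of smooth functions. -/
def discreteSol (S : Scheme d) (f : E d → ℝ) (h : ℝ) (x : E d) : ℝ :=
  ulim fun n => (S.mollSeq n).sol h (conv (bump n) f) x

/-- The coefficients of the expansion, as limits of smooth functions. -/
def coeff (S : Scheme d) (h₀ : ℝ) (f : E d → ℝ) (j : ℕ) (x : E d) : ℝ :=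
  ulim fun n => (S.mollSeq n).corr (mesh h₀ n) (conv (bump n) f) j x

theorem coeff_zero_eq (S : Scheme d) (h₀ : ℝ) (f : E d → ℝ) : S.coeff h₀ f 0
    = ulimD (fun n => (S.mollSeq n).corr (mesh h₀ n) (conv (bump n) f) 0) [] := rfl

namespace Admissible

variable (A : S.Admissible m δ c₀ τ₀ K a b h₀ M f)
include A

theorem isDiscreteSol_sol {h : ℝ} (hh : h ∈ Ioc 0 h₀) (n : ℕ) :
    (S.mollSeq n).IsDiscreteSol h (conv (bump n) f) ((S.mollSeq n).sol h (conv (bump n) f)) :=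
  ⟨((A.smooth n hh).sol_spec (A.smoothBdd_f n)).1.bdd,
    ((A.smooth n hh).sol_spec (A.smoothBdd_f n)).2⟩

theorem abs_sol_le {h : ℝ} (hh : h ∈ Ioc 0 h₀) (n : ℕ) (x : E d) :
    |(S.mollSeq n).sol h (conv (bump n) f) x| ≤ dataBound d m f / c₀ := by
  obtain ⟨h1, h2⟩ := A.isDiscreteSol_sol hh n
  refine (A.smooth n hh).ell.abs_le_of_L h1 (fun y => ?_) x
  rw [eq_neg_of_add_eq_zero_left (h2 y), abs_neg]
  exact (A.bd_f n 0 (Nat.zero_le m)).abs_le y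

theorem tendsto_sol {h : ℝ} (hh : h ∈ Ioc 0 h₀) (x : E d) :
    Tendsto (fun n => (S.mollSeq n).sol h (conv (bump n) f) x) (hyperfilter ℕ : Filter ℕ)
      (𝓝 (S.discreteSol f h x)) :=
  tendsto_ulim fun n => A.abs_sol_le hh n x

theorem isDiscreteSol {h : ℝ} (hh : h ∈ Ioc 0 h₀) : S.IsDiscreteSol h f (S.discreteSol f h) := by
  refine ⟨⟨_, fun x => abs_ulim_le fun n => A.abs_sol_le hh n x⟩, fun x => ?_⟩
  refine tendsto_nhds_unique ((A.tendsto_L (A.tendsto_sol hh) x).add (A.tendsto_f x)) ?_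
  simp only [(A.isDiscreteSol_sol hh _).2 x]
  exact tendsto_const_nhds

/-! ### The limit solution -/

theorem exists_bd_corr_zero : ∃ C, ∀ n, ∀ j ≤ m,
    Bd j C ((S.mollSeq n).corr (mesh h₀ n) (conv (bump n) f) 0) := by
  obtain ⟨N, -, hN⟩ := bd_corr d m a b (mollBound d m M) A.δ_pos A.δ_le A.c₀_pos A.τ₀_pos
    A.K_nonneg 0
  exact ⟨_, fun n j hj => hN _ _ _ _ 3 (Or.inl rfl) (by omega)
    (A.smooth n (mesh_mem A.h₀_pos n)) (A.smoothBdd_f n) (A.bd_f n) j (by omega)⟩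

theorem smoothBdd_corr (j n : ℕ) :
    SmoothBdd ((S.mollSeq n).corr (mesh h₀ n) (conv (bump n) f) j) :=
  (A.smooth n (mesh_mem A.h₀_pos n)).smoothBdd_corr (A.smoothBdd_f n) j

theorem memB_coeff_zero : MemB m (S.coeff h₀ f 0) := by
  obtain ⟨C, hC⟩ := A.exists_bd_corr_zero
  exact memB_ulimD (A.smoothBdd_corr 0) hC (by have := A.hm; omega)

/-- The consistency of the scheme with the limit equation. -/
theorem abs_L_sub_limForm_le {B : ℝ} : ∃ C, ∀ (n : ℕ) (φ : E d → ℝ), SmoothBdd φ →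
    (∀ j ≤ m, Bd j B φ) → ∀ x,
      |(S.mollSeq n).L (mesh h₀ n) φ x - (S.mollSeq n).limForm (fun I => DL I φ) x|
        ≤ C / ((n : ℝ) + 1) := by
  refine ⟨h₀ * (mollBound d m M * (a ^ 3 + a ^ 2) * B), fun n φ hφ hB x => ?_⟩
  have h1 := (A.smooth n (mesh_mem A.h₀_pos n)).taylor_L hφ 0 (hB 2 (by have := A.hm; omega))
    (hB 3 A.hm) x
  simp only [zero_add, Finset.range_one, Finset.sum_singleton, pow_zero, Nat.factorial,
    Nat.cast_one, div_one, one_mul, pow_one, Li_zero_sub _ hφ.1] at h1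
  rwa [mesh, div_mul_eq_mul_div] at h1

theorem isLimitSol_coeff_zero : S.IsLimitSol f (S.coeff h₀ f 0) := by
  have hm := A.hm
  obtain ⟨C, hC⟩ := A.exists_bd_corr_zero
  have hs := A.smoothBdd_corr 0
  set u : ℕ → E d → ℝ := fun n => (S.mollSeq n).corr (mesh h₀ n) (conv (bump n) f) 0 with hu
  have hlim : ∀ x, S.limForm (ulimD u) x + f x = 0 := fun x => by
    obtain ⟨N, hN⟩ := A.abs_L_sub_limForm_le (B := C)
    have h1 : Tendsto (fun n => (S.mollSeq n).limForm (fun I => DL I (u n)) x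
        + conv (bump n) f x) (hyperfilter ℕ : Filter ℕ) (𝓝 (S.limForm (ulimD u) x + f x)) :=
      (A.tendsto_limForm x fun I hI => tendsto_ulimD hs hC (hI.trans (by omega)) x).add
        (A.tendsto_f x)
    refine tendsto_nhds_unique h1 (squeeze_zero_norm (fun n => ?_) (tendsto_hyperfilter_inv N))
    have h2 := hN n (u n) (hs n) (hC n) x
    have h3 := (A.smooth n (mesh_mem A.h₀_pos n)).L_corr_zero (A.smoothBdd_f n) x
    rw [eq_neg_of_add_eq_zero_left h3, abs_sub_comm, sub_neg_eq_add] at h2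
    exact h2
  have hw : ∀ I : List (Fin d), I.length ≤ 2 → ∀ᵐ x,
      weakD (fun k => I.count k) (ulimD u []) x = ulimD u I x := fun I hI => by
    have h1 := isBddWeakDeriv_ulimW hs hC (by omega) (I := I) (by omega)
    rw [ulimW_eq hs hC (by omega)] at h1
    exact (isBddWeakDeriv_weakD ⟨_, h1⟩).ae_eq h1
  have h1 : ∀ᵐ x, ∀ i : Fin d, weakD (fun k => [i].count k) (ulimD u []) x = ulimD u [i] x :=
    ae_all_iff.2 fun i => hw [i] (by simp)
  have h2 : ∀ᵐ x, ∀ i j : Fin d,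
      weakD (fun k => [i, j].count k) (ulimD u []) x = ulimD u [i, j] x :=
    ae_all_iff.2 fun i => ae_all_iff.2 fun j => hw [i, j] (by simp)
  refine ⟨A.memB_coeff_zero.mono (by omega), ?_⟩
  filter_upwards [h1, h2] with x hx1 hx2
  rw [coeff_zero_eq, S.limitOp_eq_limForm _ x (ulimD u) rfl hx1 hx2]
  exact hlim x

theorem convNear_limForm {w : E d → ℝ} (hw : MemB m w) :
    ConvNear (fun x => S.limForm (fun I => weakD (fun k => I.count k) w) x)
      (fun n x => (S.mollSeq n).limForm (fun I => DL I (conv (bump n) w)) x) := by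
  have hm := A.hm
  have hD : ∀ I : List (Fin d), I.length ≤ 2 → ∀ {g : E d → ℝ}, MemB m g →
      ConvNear (fun x => g x * weakD (fun k => I.count k) w x)
        (fun n x => conv (bump n) g x * DL I (conv (bump n) w) x) := fun I hI g hg => by
    have h1 := hw.weakD (α := fun k => I.count k) (by rw [sum_count]; omega)
    obtain ⟨C, hC⟩ := (hg.reg (r := 1) (by omega)).1
    have h2 := convNear_mul hg.bddBorel hC ⟨h1.1, h1.2.1⟩
    simp only [DL_conv_of_weak (mollifier_bump _).smooth (mollifier_bump _).supp hw.bddBorel h1]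
    exact h2
  refine ((ConvNear.const_mul (ConvNear.sum _ fun l hl => ConvNear.sum _ fun i _ =>
    ConvNear.sum _ fun j _ => ?_) _).add
    (ConvNear.sum _ fun l hl => ConvNear.sum _ fun i _ => ?_)).sub ?_
  · have := (hD [i, j] (by simp) (A.regular.1 l hl).1).const_mul (l i * l j)
    refine (congrArg₂ ConvNear ?_ ?_).mp this
    · funext x; ring
    · funext n x; simp only [mollSeq, moll]; ring
  · have := (hD [i] (by simp) (A.regular.1 l hl).2).const_mul (l i)
    refine (congrArg₂ ConvNear ?_ ?_).mp this
    · funext x; ring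
    · funext n x; simp only [mollSeq, moll]; ring
  · exact hD [] (by simp) A.regular.2.1

theorem limit_unique {w : E d → ℝ} (hw : MemB m w) (hsol : S.IsLimitSol f w) :
    w = S.coeff h₀ f 0 := by
  have hm := A.hm
  obtain ⟨B, hB⟩ := hw.exists_bd
  obtain ⟨C, hC⟩ := A.abs_L_sub_limForm_le (B := B)
  obtain ⟨C', hC'⟩ := A.exists_bd_corr_zero
  have hw0 : ∀ᵐ x, weakD (fun k => ([] : List (Fin d)).count k) w x = w x := by
    refine (hw.weakD (by simp)).ae_eq ⟨hw.1.measurable, hw.2.1, fun φ hφ _ => ?_⟩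
    rw [multiD_count hφ]
    simp
  obtain ⟨η, hη⟩ := ((A.convNear_limForm hw).add
    (convNear_conv A.regular.2.2.1.bddBorel)).abs_le_of_ae_eq_zero (by
      filter_upwards [hsol.2, hw0] with x hx hx0
      rw [← hx, S.limitOp_eq_limForm w x (fun I => weakD (fun k => I.count k) w) hx0
        (fun _ => rfl) fun _ _ => rfl])
  have hs : ∀ n, SmoothBdd (conv (bump n) w) := fun n => (mollifier_bump n).smoothBdd hw.bddBorel
  funext x
  have h1 : Tendsto (fun n => conv (bump n) w x
      - (S.mollSeq n).corr (mesh h₀ n) (conv (bump n) f) 0 x) (hyperfilter ℕ : Filter ℕ)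
      (𝓝 (w x - S.coeff h₀ f 0 x)) :=
    (tendsto_conv_bump hw.1 x).sub (tendsto_ulim fun n => (hC' n 0 (Nat.zero_le m)).abs_le x)
  refine sub_eq_zero.1 (tendsto_nhds_unique h1
    (squeeze_zero_norm (fun n => ?_) (tendsto_hyperfilter_inv ((C + η) / c₀))))
  have hS := A.smooth n (mesh_mem A.h₀_pos n)
  have h2 := hS.ell.abs_le_of_L (B := (C + η) / ((n : ℝ) + 1))
    ((hs n).sub (A.smoothBdd_corr 0 n)).bdd (fun y => ?_) x
  · rwa [Real.norm_eq_abs, div_right_comm]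
  · rw [L_sub, eq_neg_of_add_eq_zero_left (hS.L_corr_zero (A.smoothBdd_f n) y), sub_neg_eq_add]
    have h3 := hC n _ (hs n) (hB n) y
    have h4 := hη n y
    rw [add_div]
    refine le_trans ?_ (add_le_add h3 h4)
    refine le_trans (le_of_eq ?_) (abs_add_le _ _)
    congr 1
    ring

end Admissible

end Scheme

end

end EllipticFD

namespace EllipticFD

noncomputable section

open Filter Topology

variable {d : ℕ}

namespace Scheme

/-- The three alternatives under which the expansion of order `k` holds. -/
def Expandable (S : Scheme d) (m k : ℕ) : Prop :=
  3 * k + 3 ≤ m ∨ (2 * k + 3 ≤ m ∧ S.Symm) ∨ (Odd k ∧ 2 * k + 2 ≤ m ∧ S.Symm ∧ S.AntisymmP)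

/-- Bounds for all the approximate coefficients entering the expansion of order `k`. -/
theorem bd_corr_of_expandable (d m : ℕ) {δ c₀ τ₀ K : ℝ} (a b M : ℝ) (hδ : 0 < δ) (hδ1 : δ ≤ 1)
    (hc₀ : 0 < c₀) (hτ₀ : 0 < τ₀) (hK : 0 ≤ K) (k : ℕ) :
    ∃ N : ℝ, 0 ≤ N ∧ ∀ (S : Scheme d) (h : ℝ) (f : E d → ℝ) (F : ℝ), S.Expandable m k →
      S.Smooth m δ c₀ τ₀ K a b M h → SmoothBdd f → (∀ j ≤ m, Bd j F f) →
      ∀ j ≤ k, ∀ r ≤ k - j + 3, Bd r (N * F) (S.corr h f j) := by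
  choose N hN0 hN using fun s => bd_corr d m a b M hδ hδ1 hc₀ hτ₀ hK s
  refine ⟨∑ j ∈ Finset.range (k + 1), N j, Finset.sum_nonneg fun j _ => hN0 j,
    fun S h f F hk hS hf hF j hj r hr => ?_⟩
  have hF0 : 0 ≤ F := (hF 0 (Nat.zero_le m)).nonneg
  have hNj : N j * F ≤ (∑ j ∈ Finset.range (k + 1), N j) * F :=
    mul_le_mul_of_nonneg_right (Finset.single_le_sum (f := N) (fun j _ => hN0 j)
      (Finset.mem_range.2 (Nat.lt_succ_of_le hj))) hF0
  rcases hk with hk | ⟨hk, hsym⟩ | ⟨hodd, hk, hsym, hp⟩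
  · exact (hN j S h f F 3 (Or.inl rfl) (by omega) hS hf hF r (by omega)).mono hNj
  · exact (hN j S h f F 2 (Or.inr ⟨rfl, hsym⟩) (by omega) hS hf hF r (by omega)).mono hNj
  · rcases hj.lt_or_eq with hj | rfl
    · exact (hN j S h f F 2 (Or.inr ⟨rfl, hsym⟩) (by omega) hS hf hF r (by omega)).mono hNj
    · rw [hS.corr_odd hsym hp hf j hodd]
      exact (bd_zero_fun r).mono ((mul_nonneg (hN0 j) hF0).trans hNj)

variable {S : Scheme d} {m : ℕ} {δ c₀ τ₀ K a b h₀ : ℝ} {M : Fin (m + 1) → ℝ} {f : E d → ℝ}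

theorem Expandable.moll {k : ℕ} (h : S.Expandable m k) (n : ℕ) : (S.mollSeq n).Expandable m k :=
  h.imp_right (Or.imp (fun h => ⟨h.1, moll_symm _ h.2⟩)
    fun h => ⟨h.1, h.2.1, moll_symm _ h.2.2.1, moll_antisymmP _ h.2.2.2⟩)

theorem Admissible.abs_remainder_le (A : S.Admissible m δ c₀ τ₀ K a b h₀ M f) {k : ℕ} {N : ℝ}
    (hN : ∀ (S : Scheme d) (h : ℝ) (f : E d → ℝ) (F : ℝ), S.Expandable m k →
      S.Smooth m δ c₀ τ₀ K a b (mollBound d m M) h → SmoothBdd f → (∀ j ≤ m, Bd j F f) →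
      ∀ j ≤ k, ∀ r ≤ k - j + 3, Bd r (N * F) (S.corr h f j))
    (hk : S.Expandable m k) {h : ℝ} (hh : h ∈ Ioc 0 h₀) (x : E d) :
    |S.discreteSol f h x - ∑ j ∈ Finset.range (k + 1),
        h ^ j / (j.factorial : ℝ) * S.coeff h₀ f j x|
      ≤ ((∑ j ∈ Finset.range (k + 1), mollBound d m M * (a ^ (k - j + 3) + a ^ (k - j + 2))) / c₀)
        * (N * dataBound d m f) * h ^ (k + 1) := by
  have hG : ∀ n, ∀ j ≤ k, ∀ r ≤ k - j + 3, Bd r (N * dataBound d m f)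
      ((S.mollSeq n).corr (mesh h₀ n) (conv (bump n) f) j) := fun n =>
    hN _ _ _ _ (hk.moll n) (A.smooth n (mesh_mem A.h₀_pos n)) (A.smoothBdd_f n) (A.bd_f n)
  have h1 : ∀ j ∈ Finset.range (k + 1), Tendsto
      (fun n => h ^ j / (j.factorial : ℝ) * (S.mollSeq n).corr (mesh h₀ n) (conv (bump n) f) j x)
      (hyperfilter ℕ : Filter ℕ) (𝓝 (h ^ j / (j.factorial : ℝ) * S.coeff h₀ f j x)) :=
    fun j hj => (tendsto_ulim fun n => (hG n j (Nat.lt_succ_iff.1 (Finset.mem_range.1 hj)) 0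
      (Nat.zero_le _)).abs_le x).const_mul _
  have h2 := ((A.tendsto_sol hh x).sub (tendsto_finsetSum _ h1)).abs
  refine le_of_tendsto_of_tendsto h2 ?_ (Eventually.of_forall fun n =>
    (A.smooth n hh).expansion (A.smooth n (mesh_mem A.h₀_pos n)) (A.smoothBdd_f n)
      (A.isDiscreteSol_sol hh n) (hG n) x)
  simpa using tendsto_const_nhds.add ((tendsto_mesh h₀).mul_const _)

theorem Admissible.coeff_eq_zero (A : S.Admissible m δ c₀ τ₀ K a b h₀ M f) (hsym : S.Symm)
    (hp : S.AntisymmP) {j : ℕ} (hj : Odd j) : S.coeff h₀ f j = 0 := by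
  funext x
  have h1 : ∀ n, (S.mollSeq n).corr (mesh h₀ n) (conv (bump n) f) j x = 0 := fun n => by
    rw [(A.smooth n (mesh_mem A.h₀_pos n)).corr_odd (moll_symm _ hsym) (moll_antisymmP _ hp)
      (A.smoothBdd_f n) j hj]
  have h2 := abs_ulim_le (u := fun n => (S.mollSeq n).corr (mesh h₀ n) (conv (bump n) f) j x)
    (C := 0) fun n => by rw [h1 n, abs_zero]
  exact abs_nonpos_iff.1 h2

end Scheme

end

end EllipticFD

theorem theorem4p20p11p08 (d m : ℕ) (hm : 3 ≤ m)
    (δ c₀ τ₀ K a b : ℝ) (hδ : 0 < δ) (hδ1 : δ ≤ 1) (hc₀ : 0 < c₀) (hτ₀ : 0 < τ₀) (hK : 1 ≤ K)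
    (M : Fin (m + 1) → ℝ) :
    ∃ N : ℝ, ∀ (h₀ : ℝ) (S : Scheme d) (f : E d → ℝ) (k : ℕ),
      0 < h₀ → S.size = a → S.wsize = b →
      S.Regular m M f → S.ChiNonneg h₀ → S.Balanced → (∀ x, c₀ ≤ S.c x) →
      S.Structural₁ m δ K τ₀ h₀ → S.Structural₂ m δ K τ₀ h₀ →
      (3 * k + 3 ≤ m ∨ (2 * k + 3 ≤ m ∧ S.Symm) ∨
        (Odd k ∧ 2 * k + 2 ≤ m ∧ S.Symm ∧ S.AntisymmP)) →
      ∃ (vh : ℝ → E d → ℝ) (v : ℕ → E d → ℝ) (R : ℝ → E d → ℝ),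
        (∀ h ∈ Set.Ioc 0 h₀, S.IsDiscreteSol h f (vh h) ∧
          ∀ w, S.IsDiscreteSol h f w → w = vh h) ∧
        (MemB m (v 0) ∧ S.IsLimitSol f (v 0) ∧
          ∀ w, MemB m w → S.IsLimitSol f w → w = v 0) ∧
        (∀ h ∈ Set.Ioc 0 h₀, ∀ x,
          vh h x = v 0 x + ∑ j ∈ Finset.Icc 1 k, h ^ j / (Nat.factorial j : ℝ) * v j x
            + h ^ (k + 1) * R h x) ∧
        (∀ h ∈ Set.Ioc 0 h₀, ∀ x, |R h x| ≤ N * normB m f) ∧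
        ((Odd k ∧ 2 * k + 2 ≤ m ∧ S.Symm ∧ S.AntisymmP) →
          ∀ j, j ≤ k → Odd j → v j = 0) := by
  have hK0 : 0 ≤ K := zero_le_one.trans hK
  set M' := Scheme.mollBound d m M with hM'
  choose N hN0 hN using
    fun k => Scheme.bd_corr_of_expandable d m a b M' hδ hδ1 hc₀ hτ₀ hK0 k
  set C : ℕ → ℝ := fun k =>
    ((∑ j ∈ Finset.range (k + 1), M' * (a ^ (k - j + 3) + a ^ (k - j + 2))) / c₀)
      * (N k * ((d : ℝ) + 1) ^ m) with hC
  refine ⟨∑ k ∈ Finset.range (m + 1), |C k|,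
    fun h₀ S f k hh₀ ha hb hR hχ hbal hc hS₁ hS₂ hk => ?_⟩
  have A : S.Admissible m δ c₀ τ₀ K a b h₀ M f :=
    ⟨hm, hδ, hδ1, hc₀, hτ₀, hK0, hh₀, ha, hb, hR, hχ, hbal, hc, hS₁, hS₂⟩
  have hkm : k ≤ m := by rcases hk with h | h | h <;> omega
  refine ⟨S.discreteSol f, S.coeff h₀ f, fun h x => (S.discreteSol f h x
      - ∑ j ∈ Finset.range (k + 1), h ^ j / (j.factorial : ℝ) * S.coeff h₀ f j x) / h ^ (k + 1),
    fun h hh => ⟨A.isDiscreteSol hh, fun w hw => (A.elliptic hh).unique (A.isDiscreteSol hh) hw⟩,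
    ⟨A.memB_coeff_zero, A.isLimitSol_coeff_zero, fun w => A.limit_unique⟩,
    fun h hh x => ?_, fun h hh x => ?_, fun hiii j _ hj => A.coeff_eq_zero hiii.2.2.1 hiii.2.2.2 hj⟩
  · have h1 : ∑ j ∈ Finset.range (k + 1), h ^ j / (j.factorial : ℝ) * S.coeff h₀ f j x
        = S.coeff h₀ f 0 x
          + ∑ j ∈ Finset.Icc 1 k, h ^ j / (j.factorial : ℝ) * S.coeff h₀ f j x := by
      rw [Finset.range_eq_Ico, Finset.sum_eq_sum_Ico_succ_bot (Nat.succ_pos k)]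
      simp [← Finset.Ico_add_one_right_eq_Icc]
    rw [mul_div_cancel₀ _ (pow_ne_zero _ hh.1.ne'), h1]
    ring
  · have h1 := A.abs_remainder_le (hN k) hk hh x
    have h2 : 0 < h ^ (k + 1) := pow_pos hh.1 _
    rw [abs_div, abs_of_pos h2, div_le_iff₀ h2]
    refine h1.trans (mul_le_mul_of_nonneg_right ?_ h2.le)
    refine le_trans (le_of_eq ?_) (mul_le_mul_of_nonneg_right
      ((le_abs_self (C k)).trans (Finset.single_le_sum (f := fun k => |C k|)
        (fun _ _ => abs_nonneg _) (Finset.mem_range.2 (Nat.lt_succ_of_le hkm))))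
      (Real.sqrt_nonneg _))
    rw [Scheme.dataBound, normB]
    ring
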